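/- **Setting.** $M$ access points (APs) with $N_t$ transmit and $N_r$ receive antennas serve $K_d$ downlink and $K_u$ uplink UEs, $K=K_d+K_u$. AP $m$ serves the downlink UEs in $\kappa_{dm}$ and the uplink UEs in $\kappa_{um}$; $\mathcal M^d_k=\{m:k\in\kappa_{dm}\}$, $\mathcal M^u_l=\{m:l\in\kappa_{um}\}$. Let $\tau_c>\tau_t=\tau_t^d+\tau_t^u$, $\tau_t^d\ge K_d$, $\tau_t^u\ge K_u$ be the coherence and pilot lengths, $\tau_f=(\tau_c-\tau_t)/\tau_c$, $\rho_t,\rho_d,\rho_u,N_0>0$, fading coefficients $\beta^d_{mk},\beta^u_{ml}>0$, $\tilde\beta_{kl},\beta_{\mathrm{RI},mi},\gamma_{\mathrm{RI}}\ge0$, quantizer constants $\tilde a>0$, $\tilde b\ge\tilde a^2$, and $\gamma^\varepsilon_{m\phi}=\frac{\tau^\varepsilon_t\rho_t(\beta^\varepsilon_{m\phi})^2}{\tau^\varepsilon_t\rho_t\beta^\varepsilon_{m\phi}+1}$ for $\varepsilon\in\{d,u\}$, $\phi\in\{k,l\}$. Put $A^d_{mk}=\tilde aN_t\sqrt{\rho_d}\gamma^d_{mk}$,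 $B^d_{kmq}=\tilde bN_t\rho_d\beta^d_{mk}\gamma^d_{mq}$, $D^d_{kl}=\rho_u\tilde\beta_{kl}$, $A^u_l=\tilde a^2N_r^2\rho_u(\sum_{m\in\mathcal M^u_l}\gamma^u_{ml})^2$, $B^u_{lq}=\tilde bN_r\rho_u\sum_{m\in\mathcal M^u_l}\gamma^u_{ml}\beta^u_{mq}$, $D^u_{lik}=\tilde b^2N_rN_t\rho_d\gamma^d_{ik}\sum_{m\in\mathcal M^u_l}\gamma^u_{ml}\beta_{\mathrm{RI},mi}\gamma_{\mathrm{RI}}$, $E^u_l=(\tilde b-\tilde a^2)N_r^2\rho_u\sum_{m\in\mathcal M^u_l}(\gamma^u_{ml})^2$, $F^u_l=\tilde bN_r\sum_{m\in\mathcal M^u_l}\gamma^u_{ml}$. The power variables are $\eta=(\eta_{mk})_{k\in\kappa_{dm}}$ and $\Theta=(\theta_l)_l$. With $I^d_k=\sum_m\sum_{q\in\kappa_{dm}}B^d_{kmq}\eta_{mq}+\sum_lD^d_{kl}\theta_l+1$ and $I^u_l=\sum_qB^u_{lq}\theta_q+\sum_i\sum_{k\in\kappa_{di}}D^u_{lik}\eta_{ik}+E^u_l\theta_l+F^u_l$,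 let $$S^d_k=\tau_f\log_2\Big(1+\frac{(\sum_{m\in\mathcal M^d_k}A^d_{mk}\sqrt{\eta_{mk}})^2}{I^d_k}\Big),\qquad S^u_l=\tau_f\log_2\Big(1+\frac{A^u_l\theta_l}{I^u_l}\Big),$$ $p^d_k=P_{\mathrm{fix}}+N_t\rho_dN_0\sum_{m\in\mathcal M^d_k}\frac{\gamma^d_{mk}\eta_{mk}}{\alpha_m}+P^d_{\mathrm{tc},k}$, $p^u_l=P_{\mathrm{fix}}+\rho_uN_0\frac{\theta_l}{\alpha'_l}+P^u_{\mathrm{tc},l}$, with $\alpha_m,\alpha'_l,P^d_{\mathrm{tc},k},P^u_{\mathrm{tc},l}>0$ and $P_{\mathrm{fix}}=\frac1K\sum_m\big(P_{0,m}+(N_t+N_r)P_{\mathrm{tc},m}+P_{\mathrm{ft}}\frac{R_{\mathrm{fh},m}}{C_{\mathrm{fh},m}}\big)$, $P_{0,m},P_{\mathrm{tc},m},P_{\mathrm{ft}}\ge0$, $R_{\mathrm{fh},m}=2\nu_m(|\kappa_{dm}|+|\kappa_{um}|)(\tau_c-\tau_t)/T_c\le C_{\mathrm{fh},m}$, where $\nu_m\in\mathbb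 N$ is the number of quantization bits and $T_c,C_{\mathrm{fh},m}>0$. With weights $w^\varepsilon_\phi>0$ and quality-of-service levels $S^d_{ok},S^u_{ol}>0$, problem **P2** is $$\max_{\eta,\Theta}\ \mathrm{WSEE}=\sum_kw^d_k\frac{S^d_k}{p^d_k}+\sum_lw^u_l\frac{S^u_l}{p^u_l}\quad\text{s.t.}\quad S^d_k\ge S^d_{ok},\ S^u_l\ge S^u_{ol},\ \tilde b\sum_{k\in\kappa_{dm}}\gamma^d_{mk}\eta_{mk}\le\tfrac1{N_t},\ \eta_{mk}\ge0,\ 0\le\theta_l\le1.$$ **Convex program P6.** Write $c_{mk}=\sqrt{\eta_{mk}}$, $C=(c_{mk})$. Each UE $\phi$ has slack variables $f_\phi,\Psi_\phi,\zeta_\phi,\lambda_\phi$ (superscripts $\varepsilon$ suppressed). Given a point $(C,\Theta)^{(n)}$, its slack values are $\lambda^{d,(n)}_k=\sum_{m\in\mathcal M^d_k}A^d_{mk}c_{mk}^{(n)}$, $\lambda^{u,(n)}_l=\sqrt{A^u_l\theta^{(n)}_l}$, $\zeta^{(n)}_\phi=(\lambda^{(n)}_\phi)^2/I_\phi$, $\Psi^{(n)}_\phi=\sqrt{\tau_f\log_2(1+\zeta^{(n)}_\phi)}$,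 $f^{(n)}_\phi=(\Psi^{(n)}_\phi)^2/p_\phi$. With $\Lambda^{(n)}(x_1^2/x_2)=2\frac{x_1^{(n)}}{x_2^{(n)}}x_1-\big(\frac{x_1^{(n)}}{x_2^{(n)}}\big)^2x_2$, problem P6 maximizes $\sum_\phi w_\phi f_\phi$ over $(C,\Theta,f,\Psi,\zeta,\lambda)$ subject to the power constraints $c_{mk}\ge0$, $\tilde b\sum_{k\in\kappa_{dm}}\gamma^d_{mk}c_{mk}^2\le1/N_t$, $0\le\theta_l\le1$, and for every UE $I_\phi\le\Lambda^{(n)}(\lambda_\phi^2/\zeta_\phi)$, $p_\phi\le\Lambda^{(n)}(\Psi_\phi^2/f_\phi)$, $\Psi_\phi^2\le\tau_f\log_2(1+\zeta_\phi)$, $\log_2(1+\zeta_\phi)\ge S_{o\phi}/\tau_f$, together with $0\le\lambda^d_k\le\sum_{m\in\mathcal M^d_k}A^d_{mk}c_{mk}$ and $(\lambda^u_l)^2\le A^u_l\theta_l$. **Consensus form P7 and ADMM.** Each UE $\phi$ holds $\Omega_\phi=(\widetilde C_\phi,\widetilde\Theta_\phi,f_\phi,\Psi_\phi,\lambda_\phi,\zeta_\phi)$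 in the set $\mathcal S^{(n)}_\phi$ given by the power constraints and the constraints of UE $\phi$ in P6, written for the local copy; P7 maximizes $\sum_\phi w_\phi f_\phi$ subject to $\Omega_\phi\in\mathcal S^{(n)}_\phi$, $\widetilde C_\phi=\widetilde C$, $\widetilde\Theta_\phi=\widetilde\Theta$. With multipliers $\chi_\phi,\xi_\phi$ and penalties $\rho_C,\rho_\theta>0$, iteration $p\to p+1$ of the ADMM is: (1) $\Omega_\phi^{(p+1)}$ maximizes over $\mathcal S^{(n)}_\phi$ $$w_\phi f_\phi-\langle\chi^{(p)}_\phi,\widetilde C_\phi-\widetilde C^{(p)}\rangle-\langle\xi^{(p)}_\phi,\widetilde\Theta_\phi-\widetilde\Theta^{(p)}\rangle-\tfrac{\rho^{(p)}_C}2\|\widetilde C_\phi-\widetilde C^{(p)}\|_F^2-\tfrac{\rho^{(p)}_\theta}2\|\widetilde\Theta_\phi-\widetilde\Theta^{(p)}\|^2;$$ (2) $\chi^{(p+1)}_\phi=\chi^{(p)}_\phi+\rho^{(p)}_C(\widetilde C^{(p+1)}_\phi-\widetilde C^{(p)})$, $\xi^{(p+1)}_\phi=\xi^{(p)}_\phi+\rho^{(p)}_\theta(\widetilde\Theta^{(p+1)}_\phi-\widetilde\Theta^{(p)})$;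 (3) $\widetilde C^{(p+1)}=\frac1K\sum_\phi(\widetilde C^{(p+1)}_\phi+\chi^{(p+1)}_\phi/\rho^{(p)}_C)$, $\widetilde\Theta^{(p+1)}=\frac1K\sum_\phi(\widetilde\Theta^{(p+1)}_\phi+\xi^{(p+1)}_\phi/\rho^{(p)}_\theta)$; (4) with the residual norms $\|r^{(p+1)}\|^2=\sum_\phi(\|\widetilde C_\phi-\widetilde C\|_F^2+\|\widetilde\Theta_\phi-\widetilde\Theta\|^2)^{(p+1)}$, $\|s^{(p+1)}\|^2=K(\|\widetilde C^{(p+1)}-\widetilde C^{(p)}\|_F^2+\|\widetilde\Theta^{(p+1)}-\widetilde\Theta^{(p)}\|^2)$, both penalties are multiplied by $\vartheta^{\rm incr}$ if $\|r^{(p+1)}\|>\mu\|s^{(p+1)}\|$, divided by $\vartheta^{\rm decr}$ if $\|s^{(p+1)}\|>\mu\|r^{(p+1)}\|$, and kept otherwise ($\mu,\vartheta^{\rm incr},\vartheta^{\rm decr}>1$). In each ADMM run this penalty update is applied for finitely (arbitrarily) many iterations, after which the penalties are kept fixed. **Decentralized algorithm.** Start from $(C,\Theta)^{(1)}$. In SCA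 iteration $n$, compute the slack values of $(C,\Theta)^{(n)}$, run the ADMM with $(\widetilde C,\widetilde\Theta)$ and all the local copies initialized at $(C,\Theta)^{(n)}$ (arbitrary initial multipliers and positive penalties), and let $(C,\Theta)^{(n+1)}$ be the limit of the global variables. **Remark (Convergence of the decentralized algorithm).** Assume that P2 has a feasible point with $S^d_k>S^d_{ok}$ and $S^u_l>S^u_{ol}$ for all $k,l$, and that the algorithm starts at a feasible point of P2 (with $C^{(1)}\ge0$). Then the algorithm can be run, and for each of its runs the following holds, with $\eta^{(n)}_{mk}=(c^{(n)}_{mk})^2$. 1. *ADMM solves each P6.* For every $n$, $C^{(n)}\ge 0$ and $(\eta^{(n)},\Theta^{(n)})$ is feasible for P2; $\|r^{(p)}\|\to0$ and $\|s^{(p)}\|\to0$ as $p\to\infty$; the global variables and all local variables of the ADMM converge to an optimal solution of P7, and this is an optimal solution of P6, with power variables $(C,\Theta)^{(n+1)}$. 2. *The SCA converges to KKT points of P2.* $\mathrm{WSEE}(\eta^{(n)},\Theta^{(n)})$ is non-decreasing and convergent; $\|(C,\Theta)^{(n+1)}-(C,\Theta)^{(n)}\|\to0$; the sequence $(\eta^{(n)},\Theta^{(n)})$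 has accumulation points, each of them is a KKT point of P2 (in particular P2 is differentiable there), and the distance of $(\eta^{(n)},\Theta^{(n)})$ to the set of KKT points of P2 tends to $0$. If some accumulation point is isolated in the set of KKT points of P2, then the whole sequence converges to it. -/

import Mathlib

open Filter Topology

noncomputable section

/-- `IsKKTPoint F g y`: the point `y` satisfies the Karush-Kuhn-Tucker conditions of the problem
`max F` subject to `g i ≥ 0` for all `i`. Differentiability at `y` of all the functions involved is
part of the definition. -/
def IsKKTPoint {E : Type*} [NormedAddCommGroup E] [NormedSpace ℝ E] {ι : Type*} [Fintype ι]
    (F : E → ℝ) (g : ι → E → ℝ) (y : E) : Prop :=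
  (∀ i, 0 ≤ g i y) ∧ DifferentiableAt ℝ F y ∧ (∀ i, DifferentiableAt ℝ (g i) y) ∧
    ∃ μ : ι → ℝ, (∀ i, 0 ≤ μ i) ∧ (∀ i, μ i * g i y = 0) ∧
      fderiv ℝ F y + ∑ i, μ i • fderiv ℝ (g i) y = 0

/-- The parameters of a full-duplex cell-free massive MIMO system with `M` access points (APs),
`Kd` downlink and `Ku` uplink user equipments (UEs). -/
structure FDSystem (M Kd Ku : ℕ) where
  /-- transmit and receive antennas per AP -/
  Nt : ℕ
  Nr : ℕ
  Nt_pos : 0 < Nt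
  Nr_pos : 0 < Nr
  /-- samples per coherence interval, and pilot lengths of the downlink and uplink UEs -/
  tauC : ℕ
  tauTd : ℕ
  tauTu : ℕ
  pilots_d : Kd ≤ tauTd
  pilots_u : Ku ≤ tauTu
  tau_lt : tauTd + tauTu < tauC
  /-- duration of the coherence interval -/
  Tc : ℝ
  Tc_pos : 0 < Tc
  /-- normalized pilot, downlink and uplink transmit SNRs, and noise power -/
  rhoT : ℝ
  rhoD : ℝ
  rhoU : ℝ
  N0 : ℝ
  rhoT_pos : 0 < rhoT
  rhoD_pos : 0 < rhoD
  rhoU_pos : 0 < rhoU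
  N0_pos : 0 < N0
  /-- large scale fading coefficients AP to downlink UE, and uplink UE to AP -/
  betaD : Fin M → Fin Kd → ℝ
  betaU : Fin M → Fin Ku → ℝ
  betaD_pos : ∀ m k, 0 < betaD m k
  betaU_pos : ∀ m l, 0 < betaU m l
  /-- large scale fading between a downlink UE and an uplink UE -/
  betaUDI : Fin Kd → Fin Ku → ℝ
  betaUDI_nonneg : ∀ k l, 0 ≤ betaUDI k l
  /-- residual (intra- and inter-AP) interference: `betaRI m i` is from the `i`th AP to the `m`th AP -/
  betaRI : Fin M → Fin M → ℝ
  gammaRI : ℝ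
  betaRI_nonneg : ∀ m i, 0 ≤ betaRI m i
  gammaRI_nonneg : 0 ≤ gammaRI
  /-- the two constants of the fronthaul quantizer; `qb - qa ^ 2` is the distortion power -/
  qa : ℝ
  qb : ℝ
  qa_pos : 0 < qa
  qa_sq_le : qa ^ 2 ≤ qb
  /-- downlink and uplink UEs served by each AP -/
  kappaD : Fin M → Finset (Fin Kd)
  kappaU : Fin M → Finset (Fin Ku)
  /-- fronthaul quantization bits and fronthaul capacities; the rate is within the capacity -/
  nu : Fin M → ℕ
  Cfh : Fin M → ℝ
  Cfh_pos : ∀ m, 0 < Cfh m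
  fronthaul : ∀ m, 2 * (nu m : ℝ) * (((kappaD m).card : ℝ) + ((kappaU m).card : ℝ)) *
    ((tauC : ℝ) - ((tauTd : ℝ) + (tauTu : ℝ))) / Tc ≤ Cfh m
  /-- power amplifier efficiencies of the APs and of the uplink UEs -/
  ampAP : Fin M → ℝ
  ampUE : Fin Ku → ℝ
  ampAP_pos : ∀ m, 0 < ampAP m
  ampUE_pos : ∀ l, 0 < ampUE l
  /-- fixed fronthaul power, AP transceiver chain power, maximal fronthaul traffic power, and
  transceiver chain powers of the UEs -/
  P0 : Fin M → ℝ
  PtcAP : Fin M → ℝ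
  Pft : ℝ
  PtcD : Fin Kd → ℝ
  PtcU : Fin Ku → ℝ
  P0_nonneg : ∀ m, 0 ≤ P0 m
  PtcAP_nonneg : ∀ m, 0 ≤ PtcAP m
  Pft_nonneg : 0 ≤ Pft
  PtcD_pos : ∀ k, 0 < PtcD k
  PtcU_pos : ∀ l, 0 < PtcU l
  /-- weights of the UEs in the WSEE -/
  wD : Fin Kd → ℝ
  wU : Fin Ku → ℝ
  wD_pos : ∀ k, 0 < wD k
  wU_pos : ∀ l, 0 < wU l
  /-- minimum spectral efficiencies -/
  SoD : Fin Kd → ℝ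
  SoU : Fin Ku → ℝ
  SoD_pos : ∀ k, 0 < SoD k
  SoU_pos : ∀ l, 0 < SoU l

/-- The four scalar slack variables `f, Ψ, ζ, λ` of one UE. -/
structure UEVars where
  f : ℝ
  psi : ℝ
  zeta : ℝ
  lam : ℝ

/-- The first-order Taylor approximation of `x₁² / x₂` at `(a₁, a₂)`, evaluated at `(x₁, x₂)`. -/
def taylorQuot (a₁ a₂ x₁ x₂ : ℝ) : ℝ :=
  2 * (a₁ / a₂) * x₁ - (a₁ / a₂) ^ 2 * x₂

/-- Tuning parameters of the penalty update rule of the ADMM. -/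
structure PenaltyParams where
  mu : ℝ
  incr : ℝ
  decr : ℝ
  mu_gt : 1 < mu
  incr_gt : 1 < incr
  decr_gt : 1 < decr

namespace FDSystem

variable {M Kd Ku : ℕ} (P : FDSystem M Kd Ku)

/-! ### Spectral efficiency, power consumption, and the problem `P2` -/

/-- Pairs (AP `m`, downlink UE `k`) such that `m` serves `k`. -/
abbrev Served : Type := {p : Fin M × Fin Kd // p.2 ∈ P.kappaD p.1}

/-- Power variables: one real per served downlink pair, and one real per uplink UE. A point is
read as `(η, Θ)` in `P2`, and as `(C, Θ)` with `c = √η` in the algorithm. -/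
abbrev PowerVec : Type := (P.Served → ℝ) × (Fin Ku → ℝ)

/-- The UEs: downlink ones, then uplink ones. -/
abbrev UE (_P : FDSystem M Kd Ku) : Type := Fin Kd ⊕ Fin Ku

/-- The APs that serve the `l`th uplink UE. -/
def apsU (l : Fin Ku) : Finset (Fin M) := Finset.univ.filter fun m => l ∈ P.kappaU m

/-- The served pairs that involve the `k`th downlink UE. -/
def pairsOfUE (k : Fin Kd) : Finset P.Served := Finset.univ.filter fun s => s.1.2 = k

/-- The served pairs that involve the `m`th AP. -/
def pairsOfAP (m : Fin M) : Finset P.Served := Finset.univ.filter fun s => s.1.1 = m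

def gammaD (m : Fin M) (k : Fin Kd) : ℝ :=
  P.tauTd * P.rhoT * P.betaD m k ^ 2 / (P.tauTd * P.rhoT * P.betaD m k + 1)

def gammaU (m : Fin M) (l : Fin Ku) : ℝ :=
  P.tauTu * P.rhoT * P.betaU m l ^ 2 / (P.tauTu * P.rhoT * P.betaU m l + 1)

def tauF : ℝ := ((P.tauC : ℝ) - ((P.tauTd : ℝ) + (P.tauTu : ℝ))) / P.tauC

def coefAd (s : P.Served) : ℝ := P.qa * P.Nt * √P.rhoD * P.gammaD s.1.1 s.1.2

def coefBd (k : Fin Kd) (s : P.Served) : ℝ :=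
  P.qb * P.Nt * P.rhoD * P.betaD s.1.1 k * P.gammaD s.1.1 s.1.2

def coefDd (k : Fin Kd) (l : Fin Ku) : ℝ := P.rhoU * P.betaUDI k l

def coefAu (l : Fin Ku) : ℝ :=
  P.qa ^ 2 * (P.Nr : ℝ) ^ 2 * P.rhoU * (∑ m ∈ P.apsU l, P.gammaU m l) ^ 2

def coefBu (l q : Fin Ku) : ℝ :=
  P.qb * P.Nr * P.rhoU * ∑ m ∈ P.apsU l, P.gammaU m l * P.betaU m q

def coefDu (l : Fin Ku) (s : P.Served) : ℝ :=
  P.qb ^ 2 * P.Nr * P.Nt * P.rhoD * P.gammaD s.1.1 s.1.2 *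
    ∑ m ∈ P.apsU l, P.gammaU m l * P.betaRI m s.1.1 * P.gammaRI

def coefEu (l : Fin Ku) : ℝ :=
  (P.qb - P.qa ^ 2) * (P.Nr : ℝ) ^ 2 * P.rhoU * ∑ m ∈ P.apsU l, P.gammaU m l ^ 2

def coefFu (l : Fin Ku) : ℝ := P.qb * P.Nr * ∑ m ∈ P.apsU l, P.gammaU m l

/-- Interference plus noise of the `k`th downlink UE, as a function of `y = (η, Θ)`. -/
def denD (k : Fin Kd) (y : P.PowerVec) : ℝ :=
  ∑ s, P.coefBd k s * y.1 s + ∑ l, P.coefDd k l * y.2 l + 1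

/-- Interference plus noise of the `l`th uplink UE, as a function of `y = (η, Θ)`. -/
def denU (l : Fin Ku) (y : P.PowerVec) : ℝ :=
  ∑ q, P.coefBu l q * y.2 q + ∑ s, P.coefDu l s * y.1 s + P.coefEu l * y.2 l + P.coefFu l

/-- Spectral efficiency of the `k`th downlink UE. -/
def seD (k : Fin Kd) (y : P.PowerVec) : ℝ :=
  P.tauF * Real.logb 2
    (1 + (∑ s ∈ P.pairsOfUE k, P.coefAd s * √(y.1 s)) ^ 2 / P.denD k y)

/-- Spectral efficiency of the `l`th uplink UE. -/
def seU (l : Fin Ku) (y : P.PowerVec) : ℝ :=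
  P.tauF * Real.logb 2 (1 + P.coefAu l * y.2 l / P.denU l y)

/-- Fronthaul rate of the `m`th AP. -/
def Rfh (m : Fin M) : ℝ :=
  2 * (P.nu m : ℝ) * (((P.kappaD m).card : ℝ) + ((P.kappaU m).card : ℝ)) *
    ((P.tauC : ℝ) - ((P.tauTd : ℝ) + (P.tauTu : ℝ))) / P.Tc

def Pfix : ℝ :=
  1 / ((Kd : ℝ) + (Ku : ℝ)) *
    ∑ m, (P.P0 m + ((P.Nt : ℝ) + (P.Nr : ℝ)) * P.PtcAP m + P.Pft * (P.Rfh m / P.Cfh m))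

/-- Power consumed for the `k`th downlink UE. -/
def powD (k : Fin Kd) (y : P.PowerVec) : ℝ :=
  P.Pfix + P.Nt * P.rhoD * P.N0 *
    ∑ s ∈ P.pairsOfUE k, 1 / P.ampAP s.1.1 * P.gammaD s.1.1 s.1.2 * y.1 s + P.PtcD k

/-- Power consumed by the `l`th uplink UE. -/
def powU (l : Fin Ku) (y : P.PowerVec) : ℝ :=
  P.Pfix + P.rhoU * P.N0 * (1 / P.ampUE l) * y.2 l + P.PtcU l

/-- The weighted sum energy efficiency (without the constant bandwidth factor): the objective of
`P2`. -/
def wsee (y : P.PowerVec) : ℝ :=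
  ∑ k, P.wD k * (P.seD k y / P.powD k y) + ∑ l, P.wU l * (P.seU l y / P.powU l y)

/-- Left-hand side of the transmit power constraint of the `m`th AP. -/
def apLoad (m : Fin M) (y : P.PowerVec) : ℝ :=
  P.qb * ∑ s ∈ P.pairsOfAP m, P.gammaD s.1.1 s.1.2 * y.1 s

/-- Index set of the constraints of `P2`: quality of service of downlink and uplink UEs, AP power,
`η ≥ 0`, `Θ ≥ 0`, `Θ ≤ 1`. -/
abbrev P2Index : Type := (Fin Kd ⊕ Fin Ku) ⊕ (Fin M ⊕ (P.Served ⊕ (Fin Ku ⊕ Fin Ku)))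

/-- The constraints of `P2`, each in the form `0 ≤ P.p2Con i (η, Θ)`. -/
def p2Con : P.P2Index → P.PowerVec → ℝ
  | .inl (.inl k), y => P.seD k y - P.SoD k
  | .inl (.inr l), y => P.seU l y - P.SoU l
  | .inr (.inl m), y => 1 / (P.Nt : ℝ) - P.apLoad m y
  | .inr (.inr (.inl s)), y => y.1 s
  | .inr (.inr (.inr (.inl l))), y => y.2 l
  | .inr (.inr (.inr (.inr l))), y => 1 - y.2 l

/-- `(η, Θ)` is feasible for `P2`. -/
def P2Feasible (y : P.PowerVec) : Prop := ∀ i, 0 ≤ P.p2Con i y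

/-- `(η, Θ)` is a KKT point of `P2`. -/
def IsKKTP2 (y : P.PowerVec) : Prop := IsKKTPoint P.wsee P.p2Con y

/-! ### Successive convex approximation: the problem `P6` -/

/-- `(C, Θ) ↦ (η, Θ)` with `η = c²`. -/
def toEta (x : P.PowerVec) : P.PowerVec := (fun s => x.1 s ^ 2, x.2)

/-- The power constraints on `(C, Θ)`. -/
def PowerFeasible (x : P.PowerVec) : Prop :=
  (∀ m, P.apLoad m (P.toEta x) ≤ 1 / (P.Nt : ℝ)) ∧ (∀ s, 0 ≤ x.1 s) ∧
    ∀ l, 0 ≤ x.2 l ∧ x.2 l ≤ 1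

/-- The constraints of `P6` that belong to the `k`th downlink UE; `a` holds the values of
`f, Ψ, ζ, λ` of this UE at which the quotients are linearized. (`0 < 1 + ζ` is the domain of the
logarithm.) -/
def UEFeasibleD (k : Fin Kd) (a v : UEVars) (x : P.PowerVec) : Prop :=
  v.lam ≤ ∑ s ∈ P.pairsOfUE k, P.coefAd s * x.1 s ∧ 0 ≤ v.lam ∧
  P.denD k (P.toEta x) ≤ taylorQuot a.lam a.zeta v.lam v.zeta ∧
  0 < 1 + v.zeta ∧
  v.psi ^ 2 ≤ P.tauF * Real.logb 2 (1 + v.zeta) ∧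
  P.powD k (P.toEta x) ≤ taylorQuot a.psi a.f v.psi v.f ∧
  P.SoD k / P.tauF ≤ Real.logb 2 (1 + v.zeta)

/-- The constraints of `P6` that belong to the `l`th uplink UE. -/
def UEFeasibleU (l : Fin Ku) (a v : UEVars) (x : P.PowerVec) : Prop :=
  v.lam ^ 2 ≤ P.coefAu l * x.2 l ∧
  P.denU l (P.toEta x) ≤ taylorQuot a.lam a.zeta v.lam v.zeta ∧
  0 < 1 + v.zeta ∧
  v.psi ^ 2 ≤ P.tauF * Real.logb 2 (1 + v.zeta) ∧
  P.powU l (P.toEta x) ≤ taylorQuot a.psi a.f v.psi v.f ∧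
  P.SoU l / P.tauF ≤ Real.logb 2 (1 + v.zeta)

def UEFeasible : P.UE → UEVars → UEVars → P.PowerVec → Prop
  | .inl k => P.UEFeasibleD k
  | .inr l => P.UEFeasibleU l

def weight : P.UE → ℝ
  | .inl k => P.wD k
  | .inr l => P.wU l

/-- The variables of `P6`. -/
structure P6Point where
  ue : P.UE → UEVars
  pw : P.PowerVec

/-- Feasibility for `P6`, linearized at `a`. -/
def P6Feasible (a : P.UE → UEVars) (v : P.P6Point) : Prop :=
  P.PowerFeasible v.pw ∧ ∀ φ, P.UEFeasible φ (a φ) (v.ue φ) v.pw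

/-- `v` is an optimal solution of `P6`, linearized at `a`. -/
def IsOptimalP6 (a : P.UE → UEVars) (v : P.P6Point) : Prop :=
  P.P6Feasible a v ∧ ∀ v', P.P6Feasible a v' →
    ∑ φ, P.weight φ * (v'.ue φ).f ≤ ∑ φ, P.weight φ * (v.ue φ).f

/-- The slack variables `λ, ζ, Ψ, f` that belong to `(C, Θ)`: all the inequalities that link them
hold with equality, in turn (the Taylor approximation at a point agrees with the quotient there). -/
def tight (x : P.PowerVec) : P.UE → UEVars
  | .inl k =>
    let lam := ∑ s ∈ P.pairsOfUE k, P.coefAd s * x.1 s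
    let zeta := lam ^ 2 / P.denD k (P.toEta x)
    let psi := √(P.tauF * Real.logb 2 (1 + zeta))
    ⟨psi ^ 2 / P.powD k (P.toEta x), psi, zeta, lam⟩
  | .inr l =>
    let lam := √(P.coefAu l * x.2 l)
    let zeta := lam ^ 2 / P.denU l (P.toEta x)
    let psi := √(P.tauF * Real.logb 2 (1 + zeta))
    ⟨psi ^ 2 / P.powU l (P.toEta x), psi, zeta, lam⟩

/-! ### The consensus form `P7` and the ADMM -/

/-- The variables held by the server of one UE: its slack variables and its local copy of
`(C, Θ)`. -/
structure LocalVars where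
  ue : UEVars
  pw : P.PowerVec

/-- The local feasible set of the UE `φ`. -/
def localSet (a : P.UE → UEVars) (φ : P.UE) : Set P.LocalVars :=
  {Ω | P.PowerFeasible Ω.pw ∧ P.UEFeasible φ (a φ) Ω.ue Ω.pw}

/-- Feasibility for `P7`: local feasibility, and consensus with the global variables. -/
def P7Feasible (a : P.UE → UEVars) (z : P.PowerVec) (Ω : P.UE → P.LocalVars) : Prop :=
  ∀ φ, Ω φ ∈ P.localSet a φ ∧ (Ω φ).pw = z

/-- `(z, Ω)` is an optimal solution of `P7`. -/
def IsOptimalP7 (a : P.UE → UEVars) (z : P.PowerVec) (Ω : P.UE → P.LocalVars) : Prop :=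
  P.P7Feasible a z Ω ∧ ∀ z' Ω', P.P7Feasible a z' Ω' →
    ∑ φ, P.weight φ * (Ω' φ).ue.f ≤ ∑ φ, P.weight φ * (Ω φ).ue.f

/-- The objective of the local problem `P8` (on the local feasible set): the part of the augmented
Lagrangian that belongs to the UE `φ`, with multipliers `χ` for `C` and `Θ`, global variables `z`,
and penalties `rC`, `rT` for `C` and `Θ`. -/
def localObj (φ : P.UE) (χ z : P.PowerVec) (rC rT : ℝ) (Ω : P.LocalVars) : ℝ :=
  P.weight φ * Ω.ue.f
    - ∑ s, χ.1 s * (Ω.pw.1 s - z.1 s) - ∑ l, χ.2 l * (Ω.pw.2 l - z.2 l)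
    - rC / 2 * ∑ s, (Ω.pw.1 s - z.1 s) ^ 2 - rT / 2 * ∑ l, (Ω.pw.2 l - z.2 l) ^ 2

/-- State of the ADMM: global variables, local variables, multipliers of the consensus constraints
of each UE, and the two penalty parameters. -/
structure ADMMState where
  glob : P.PowerVec
  loc : P.UE → P.LocalVars
  mult : P.UE → P.PowerVec
  rC : ℝ
  rT : ℝ

/-- Squared Euclidean (Frobenius) distance of two points `(C, Θ)`. -/
def distSq (x x' : P.PowerVec) : ℝ :=
  ∑ s, (x.1 s - x'.1 s) ^ 2 + ∑ l, (x.2 l - x'.2 l) ^ 2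

/-- Norm of the primal residual. -/
def primalRes (st : P.ADMMState) : ℝ := √(∑ φ, P.distSq (st.loc φ).pw st.glob)

/-- Norm of the dual residual of an iteration that leads from `st` to `st'`. -/
def dualRes (st st' : P.ADMMState) : ℝ :=
  √(((Kd : ℝ) + (Ku : ℝ)) * P.distSq st'.glob st.glob)

/-- One ADMM iteration: local problems `P8`, then multipliers, then global variables. -/
def ADMMStep (a : P.UE → UEVars) (st st' : P.ADMMState) : Prop :=
  (∀ φ, st'.loc φ ∈ P.localSet a φ ∧ ∀ Ω ∈ P.localSet a φ,
    P.localObj φ (st.mult φ) st.glob st.rC st.rT Ω ≤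
      P.localObj φ (st.mult φ) st.glob st.rC st.rT (st'.loc φ)) ∧
  (∀ φ s, (st'.mult φ).1 s = (st.mult φ).1 s + st.rC * ((st'.loc φ).pw.1 s - st.glob.1 s)) ∧
  (∀ φ l, (st'.mult φ).2 l = (st.mult φ).2 l + st.rT * ((st'.loc φ).pw.2 l - st.glob.2 l)) ∧
  (∀ s, st'.glob.1 s = 1 / ((Kd : ℝ) + (Ku : ℝ)) *
    ∑ φ, ((st'.loc φ).pw.1 s + 1 / st.rC * (st'.mult φ).1 s)) ∧
  (∀ l, st'.glob.2 l = 1 / ((Kd : ℝ) + (Ku : ℝ)) *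
    ∑ φ, ((st'.loc φ).pw.2 l + 1 / st.rT * (st'.mult φ).2 l))

open Classical in
/-- The residual balancing rule for a penalty parameter `r`. -/
def penaltyUpdate (q : PenaltyParams) (st st' : P.ADMMState) (r : ℝ) : ℝ :=
  if q.mu * P.dualRes st st' < P.primalRes st' then r * q.incr
  else if q.mu * P.primalRes st' < P.dualRes st st' then r / q.decr
  else r

/-- `st` is an infinite run of the ADMM for `P7`, linearized at `tight x` and initialized at `x`;
initial multipliers and positive initial penalties are arbitrary. The penalties follow the residual
balancing rule for the first `N` iterations and are constant afterwards, for some `N`. -/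
structure IsADMMRun (q : PenaltyParams) (x : P.PowerVec) (st : ℕ → P.ADMMState) : Prop where
  glob_zero : (st 0).glob = x
  loc_zero : ∀ φ, (st 0).loc φ = ⟨P.tight x φ, x⟩
  rC_pos : 0 < (st 0).rC
  rT_pos : 0 < (st 0).rT
  step : ∀ p, P.ADMMStep (P.tight x) (st p) (st (p + 1))
  penalty : ∃ N : ℕ,
    (∀ p < N, (st (p + 1)).rC = P.penaltyUpdate q (st p) (st (p + 1)) (st p).rC ∧
      (st (p + 1)).rT = P.penaltyUpdate q (st p) (st (p + 1)) (st p).rT) ∧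
    (∀ p ≥ N, (st (p + 1)).rC = (st p).rC ∧ (st (p + 1)).rT = (st p).rT)

/-- A run of the decentralized algorithm with iterates `x n = (C, Θ)` of the outer loop and the
ADMM iterations `st n` inside the `n`th one. If the global variables of the `n`th ADMM converge,
then their limit is the next outer iterate (that they converge is not presupposed). -/
structure IsDecentralizedRun (q : PenaltyParams) (x : ℕ → P.PowerVec)
    (st : ℕ → ℕ → P.ADMMState) : Prop where
  inner : ∀ n, P.IsADMMRun q (x n) (st n)
  outer : ∀ n x', Tendsto (fun p => (st n p).glob) atTop (𝓝 x') → x (n + 1) = x'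

/-- What it means that the ADMM run `st`, linearized at `a`, solves the convex program `P6` with
power variables `x'`: both residuals vanish, and the global and all the local variables converge to
an optimal solution of `P7`, which is an optimal solution of `P6`. -/
def ADMMSolves (a : P.UE → UEVars) (st : ℕ → P.ADMMState) (x' : P.PowerVec) : Prop :=
  Tendsto (fun p => P.primalRes (st p)) atTop (𝓝 0) ∧
  Tendsto (fun p => P.dualRes (st p) (st (p + 1))) atTop (𝓝 0) ∧
  Tendsto (fun p => (st p).glob) atTop (𝓝 x') ∧
  ∃ v : P.UE → UEVars,
    P.IsOptimalP6 a ⟨v, x'⟩ ∧ P.IsOptimalP7 a x' (fun φ => ⟨v φ, x'⟩) ∧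
    ∀ φ, Tendsto (fun p => ((st p).loc φ).pw) atTop (𝓝 x') ∧
      Tendsto (fun p => ((st p).loc φ).ue.f) atTop (𝓝 (v φ).f) ∧
      Tendsto (fun p => ((st p).loc φ).ue.psi) atTop (𝓝 (v φ).psi) ∧
      Tendsto (fun p => ((st p).loc φ).ue.zeta) atTop (𝓝 (v φ).zeta) ∧
      Tendsto (fun p => ((st p).loc φ).ue.lam) atTop (𝓝 (v φ).lam)

end FDSystem

end

/-! The slack variables of `P6` can be eliminated. For fixed powers the constraints of a UE bound λ,
ζ, Ψ, f one after the other, and the best choice makes each bound tight (`UEFeasible.le_surEE`).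
What remains is to maximize a concave function `surObj` of the powers over a compact convex set
`surFeas`. Its building blocks `surSinr` and `surEE` are minorants of the true SINR and energy
efficiency, because the gap is controlled by a square, and they touch the true functions at the
point of linearization.

ADMM. Every surrogate problem satisfies Slater's condition (`Admissible.exists_isSlater`): in the
coordinates (C, √Θ) the signals are linear and the square roots of the interference are convex, so a
small move towards a strictly feasible point of `P2` makes the linearized constraints strict. Hence
Lagrange multipliers exist, and distributing the gradient of the Lagrangian over the UEs gives a
saddle point of the consensus problem (`IsMultiplier.exists_saddle`). Once the penalties are
constant, the weighted distance of multipliers and local powers to any saddle point decreases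
(`admm_fejer_step`), and a cluster point that is itself a saddle point must be the limit
(`admm_consensus_tendsto`).

SCA. Maximizing a touching minorant cannot decrease the WSEE. Along any ultrafilter at infinity let
x' and y' be the limits of the iterates and of their successors. Then y' solves the surrogate
problem at x' (`IsSurOpt.of_tendsto`). The WSEE has the same limit along both, so x' solves its own
surrogate problem too, and uniqueness (`IsSurOpt.unique`) gives y' = x'. Thus steps vanish and all
limits are fixed points.

Fixed points are KKT points (`IsSurOpt.isKKTP2`): the minorants have the same gradients as the true
functions at the point of contact, so the multipliers carry over. This needs positive powers. A
vanishing c would be raised at once, since the signal gains to first order and interference and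
power grow only to second order (`IsMultiplier.fst_pos`); a vanishing θ contradicts the quality of
service. So √η is differentiable there and C ↦ η has an invertible derivative. -/

noncomputable section

/-! ### Convex duality and proximal points. -/

/-- Lagrange multipliers of a concave program that satisfies Slater's condition. -/
theorem exists_lagrange_multipliers {E ι : Type*} [AddCommGroup E] [Module ℝ E] [Fintype ι]
    {C : Set E} {f : E → ℝ} {g : ι → E → ℝ} (hf : ConcaveOn ℝ C f)
    (hg : ∀ i, ConcaveOn ℝ C (g i)) {x₁ : E} (hx₁ : x₁ ∈ C) (hgx₁ : ∀ i, 0 < g i x₁) {v : ℝ}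
    (hv : ∀ x ∈ C, (∀ i, 0 ≤ g i x) → f x ≤ v) :
    ∃ μ : ι → ℝ, (∀ i, 0 ≤ μ i) ∧ ∀ x ∈ C, f x + ∑ i, μ i * g i x ≤ v := by
  classical
  -- All constraint and objective values that are strictly exceeded at some point of `C`. Strictness
  -- makes `A` open, so that it can be separated from the unattainable point (0, v) without an
  -- interior argument.
  let A : Set ((ι → ℝ) × ℝ) := ⋃ x ∈ C, (Set.univ.pi fun i => Set.Iio (g i x)) ×ˢ Set.Iio (f x)
  have hmemA : ∀ u t, (u, t) ∈ A ↔ ∃ x ∈ C, (∀ i, u i < g i x) ∧ t < f x := by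
    intro u t; simp [A, and_left_comm]
  have hA₁ : IsOpen A := isOpen_biUnion fun x _ =>
    (isOpen_set_pi Set.finite_univ fun i _ => isOpen_Iio).prod isOpen_Iio
  have hA₂ : Convex ℝ A := by
    rintro ⟨u, t⟩ h₁ ⟨u', t'⟩ h₂ a b ha hb hab
    rw [hmemA] at h₁ h₂
    obtain ⟨x, hx, hu, ht⟩ := h₁
    obtain ⟨x', hx', hu', ht'⟩ := h₂
    have key : ∀ p q p' q' : ℝ, p < q → p' < q' → a * p + b * p' < a * q + b * q' := by
      intro p q p' q' h h'
      rcases ha.eq_or_lt with rfl | ha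
      · have : b = 1 := by linarith
        subst this; linarith
      · nlinarith [mul_lt_mul_of_pos_left h ha, mul_le_mul_of_nonneg_left h'.le hb]
    show (a • u + b • u', a • t + b • t') ∈ A
    rw [hmemA]
    refine ⟨a • x + b • x', hf.1 hx hx' ha hb hab, fun i => ?_, ?_⟩
    · exact (key _ _ _ _ (hu i) (hu' i)).trans_le ((hg i).2 hx hx' ha hb hab)
    · exact (key _ _ _ _ ht ht').trans_le (hf.2 hx hx' ha hb hab)
  have hA₃ : ((0 : ι → ℝ), v) ∉ A := by
    rw [hmemA]
    rintro ⟨x, hx, h, h'⟩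
    exact absurd (hv x hx fun i => (h i).le) (not_le.2 h')
  obtain ⟨F, hF⟩ := geometric_hahn_banach_open_point hA₂ hA₁ hA₃
  set m : ι → ℝ := fun i => F (Pi.single i 1, 0) with hm
  set s : ℝ := F (0, 1) with hs
  have hFe : ∀ u t, F (u, t) = ∑ i, m i * u i + s * t := by
    intro u t
    have h1 : ((u, t) : (ι → ℝ) × ℝ) = ∑ i, u i • (Pi.single i (1 : ℝ), (0 : ℝ)) + t • (0, 1) := by
      refine Prod.ext ?_ ?_
      · funext j
        simp [Prod.fst_sum, Finset.sum_apply, Pi.single_apply]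
      · simp [Prod.snd_sum]
    rw [h1, map_add, map_sum, map_smul]
    simp only [map_smul, smul_eq_mul, hm, hs]
    congr 1
    · exact Finset.sum_congr rfl fun i _ => mul_comm _ _
    · ring
  -- `A` is unbounded downwards in every coordinate, so a functional bounded above on it has
  -- nonnegative coefficients.
  have hlim : ∀ c d K : ℝ, (∀ r : ℝ, 0 < r → d - r * c < K) → 0 ≤ c := by
    intro c d K h
    by_contra! hc
    have := h ((|K - d| + 1) / (-c)) (by have := abs_nonneg (K - d); apply div_pos <;> linarith)
    have h2 : (|K - d| + 1) / (-c) * c = -(|K - d| + 1) := by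
      have : c ≠ 0 := hc.ne
      field_simp
    rw [h2] at this
    linarith [le_abs_self (K - d)]
  have hval : F (0, v) = s * v := by rw [hFe]; simp
  have hm0 : ∀ i, 0 ≤ m i := by
    intro i
    refine hlim (m i) (∑ j, m j * (g j x₁ - 1) + s * (f x₁ - 1)) (s * v) fun r hr => ?_
    have h1 := hF (fun j => g j x₁ - 1 - if j = i then r else 0, f x₁ - 1) ((hmemA _ _).2
      ⟨x₁, hx₁, fun j => by split_ifs <;> linarith, by linarith⟩)
    rw [hval, hFe] at h1
    have h2 : ∑ j, m j * (g j x₁ - 1 - if j = i then r else 0) =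
        ∑ j, m j * (g j x₁ - 1) - r * m i := by
      simp_rw [mul_sub _ (_ - _), Finset.sum_sub_distrib]
      simp [mul_comm]
    linarith
  have hs0 : 0 ≤ s := by
    refine hlim s (∑ j, m j * (g j x₁ - 1) + s * (f x₁ - 1)) (s * v) fun r hr => ?_
    have h1 := hF (fun j => g j x₁ - 1, f x₁ - 1 - r) ((hmemA _ _).2
      ⟨x₁, hx₁, fun j => by linarith, by linarith⟩)
    rw [hval, hFe] at h1
    linarith
  -- By Slater's condition `A` contains a point with constraint part 0; if `s` vanished, the strict
  -- separation there would read 0 < 0.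
  have hs1 : 0 < s := by
    refine hs0.lt_of_ne fun h0 => ?_
    have h1 := hF (0, f x₁ - 1) ((hmemA _ _).2 ⟨x₁, hx₁, fun j => hgx₁ j, by linarith⟩)
    rw [hval, hFe, ← h0] at h1
    simp at h1
  -- The actual values lie only in the closure of `A`; lower all of them by δ, where δ times the
  -- total weight is at most ε.
  have hfin : ∀ x ∈ C, ∑ i, m i * g i x + s * f x ≤ s * v := by
    intro x hx
    refine le_of_forall_pos_lt_add fun ε hε => ?_
    set T := ∑ i, m i + s with hT
    have hT0 : 0 ≤ T := by have := Finset.sum_nonneg fun i (_ : i ∈ Finset.univ) => hm0 i; linarith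
    set δ := ε / (T + 1) with hδ
    have hδ0 : 0 < δ := by positivity
    have h1 := hF (fun j => g j x - δ, f x - δ) ((hmemA _ _).2
      ⟨x, hx, fun j => by linarith, by linarith⟩)
    rw [hval, hFe] at h1
    have h2 : ∑ i, m i * (g i x - δ) + s * (f x - δ) =
        ∑ i, m i * g i x + s * f x - T * δ := by
      simp_rw [mul_sub, Finset.sum_sub_distrib, ← Finset.sum_mul]
      rw [hT]; ring
    have h3 : T * δ ≤ ε := by
      rw [hδ, mul_div_assoc', div_le_iff₀ (by positivity)]
      nlinarith
    linarith
  refine ⟨fun i => m i / s, fun i => div_nonneg (hm0 i) hs0, fun x hx => ?_⟩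
  have h1 := hfin x hx
  have h2 : f x + ∑ i, m i / s * g i x = (∑ i, m i * g i x + s * f x) / s := by
    rw [add_div, Finset.sum_div, mul_div_cancel_left₀ _ hs1.ne', add_comm]
    congr 1
    exact Finset.sum_congr rfl fun i _ => by ring
  rw [h2, div_le_iff₀ hs1]
  linarith

/-- Along the segment from `x` to `y` the difference quotients of a concave function are at least `f
y - f x`. Only one-sided slopes at `x` are used, so `x` may lie on the boundary of `C`. -/
theorem ConcaveOn.le_add_fderiv {E : Type*} [NormedAddCommGroup E] [NormedSpace ℝ E] {C : Set E}
    {f : E → ℝ} {f' : E →L[ℝ] ℝ} (hf : ConcaveOn ℝ C f) {x y : E} (hx : x ∈ C) (hy : y ∈ C)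
    (hd : HasFDerivAt f f' x) : f y ≤ f x + f' (y - x) := by
  have h1 : HasDerivAt (fun t : ℝ => f (x + t • (y - x))) (f' (y - x)) 0 := by
    have := hd.hasLineDerivAt (y - x)
    simpa [HasLineDerivAt] using this
  have h2 := h1.tendsto_slope_zero_right
  have h3 : ∀ᶠ t : ℝ in 𝓝[>] 0, f y - f x ≤ t⁻¹ • (f (x + (0 + t) • (y - x)) -
      f (x + (0 : ℝ) • (y - x))) := by
    filter_upwards [Ioo_mem_nhdsGT (zero_lt_one (α := ℝ))] with t ht
    have h4 := hf.2 hx hy (sub_nonneg.2 ht.2.le) ht.1.le (by ring)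
    have h5 : (1 - t) • x + t • y = x + t • (y - x) := by module
    rw [h5] at h4
    simp only [smul_eq_mul] at h4
    rw [zero_add, zero_smul, add_zero, smul_eq_mul, inv_mul_eq_div, le_div_iff₀ ht.1]
    linarith
  have := ge_of_tendsto h2 h3
  linarith

/-- A maximizer of a concave function minus a proximal term: the updated scaled multiplier is a
supergradient there. -/
theorem le_add_of_isMax_prox {E : Type*} [AddCommGroup E] [Module ℝ E]
    (B : E →ₗ[ℝ] E →ₗ[ℝ] ℝ) (hB : ∀ u v, B u v = B v u) {X : Set E} {h : E → ℝ}
    (hh : ConcaveOn ℝ X h) {u z x : E} (hx : x ∈ X)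
    (hmax : ∀ y ∈ X, h y - B u (y - z) - B (y - z) (y - z) / 2 ≤
      h x - B u (x - z) - B (x - z) (x - z) / 2) {y : E} (hy : y ∈ X) :
    h y ≤ h x + B (u + (x - z)) (y - x) := by
  -- Compare the maximizer with the point at fraction `t` on the way to `y`: the proximal term
  -- contributes an error of order t², which disappears after division by `t` and `t → 0`.
  have key : ∀ t : ℝ, 0 < t → t ≤ 1 →
      h y - h x - B (u + (x - z)) (y - x) ≤ t * (B (y - x) (y - x) / 2) := by
    intro t ht ht1
    have h4 := hh.2 hx hy (sub_nonneg.2 ht1) ht.le (by ring)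
    have h5 : (1 - t) • x + t • y = x + t • (y - x) := by module
    have h6 := hmax _ (hh.1 hx hy (sub_nonneg.2 ht1) ht.le (by ring))
    rw [h5] at h4 h6
    have h7 : x + t • (y - x) - z = (x - z) + t • (y - x) := by module
    rw [h7] at h6
    simp only [map_add, map_smul, LinearMap.add_apply, LinearMap.smul_apply, smul_eq_mul,
      hB (y - x) (x - z)] at h6 h4 ⊢
    have : t * (h y - h x - (B u (y - x) + B (x - z) (y - x))) ≤
      t * (t * (B (y - x) (y - x) / 2)) := by nlinarith
    exact le_of_mul_le_mul_left this ht
  have hlim : Tendsto (fun t : ℝ => t * (B (y - x) (y - x) / 2)) (𝓝[>] 0) (𝓝 0) := by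
    have : Continuous fun t : ℝ => t * (B (y - x) (y - x) / 2) := by fun_prop
    simpa using this.continuousWithinAt.tendsto (x := (0 : ℝ)) (s := Set.Ioi 0)
  have := ge_of_tendsto hlim (by
    filter_upwards [Ioo_mem_nhdsGT (zero_lt_one (α := ℝ))] with t ht using key t ht.1 ht.2.le)
  linarith

/-! ### Convergence of the consensus ADMM. -/

/-- One step of the Fejér estimate of the consensus ADMM with scaled multipliers `u` and local
variables `x`, measured at a saddle point with scaled multipliers `us` and consensus point `zs`. -/
theorem admm_fejer_step {E Φ : Type*} [AddCommGroup E] [Module ℝ E] [Fintype Φ]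
    (B : E →ₗ[ℝ] E →ₗ[ℝ] ℝ) (hB : ∀ u v, B u v = B v u) {h : Φ → E → ℝ}
    {zs z : E} {us x u x' u' : Φ → E}
    (h1 : ∀ φ, h φ zs ≤ h φ (x' φ) + B (u' φ) (zs - x' φ))
    (h2 : ∀ φ, h φ (x' φ) ≤ h φ zs + B (us φ) (x' φ - zs))
    (h3 : ∀ φ, h φ (x φ) ≤ h φ (x' φ) + B (u' φ) (x φ - x' φ))
    (h4 : ∀ φ, h φ (x' φ) ≤ h φ (x φ) + B (u φ) (x' φ - x φ))
    (hu : ∀ φ, u' φ = u φ + (x' φ - z)) (hz : ∑ φ, (u φ + (x φ - z)) = 0)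
    (hus : ∑ φ, us φ = 0) :
    ∑ φ, (B (u' φ - us φ) (u' φ - us φ) + B (x' φ - zs) (x' φ - zs)) +
      ∑ φ, (B (u' φ - u φ) (u' φ - u φ) + B (x' φ - x φ) (x' φ - x φ)) ≤
    ∑ φ, (B (u φ - us φ) (u φ - us φ) + B (x φ - zs) (x φ - zs)) := by
  -- Subtracting the balance `hz` of the old iterate from the multiplier update removes `z`.
  have hsum : ∑ φ, u' φ = ∑ φ, (x' φ - x φ) := by
    rw [← sub_eq_zero, ← Finset.sum_sub_distrib, ← hz]
    exact Finset.sum_congr rfl fun φ _ => by rw [hu φ]; abel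
  have hcross : ∑ φ, B (u' φ - us φ - (x' φ - x φ)) (z - zs) = 0 := by
    rw [← LinearMap.sum_apply, ← map_sum, Finset.sum_sub_distrib, Finset.sum_sub_distrib, hus,
      hsum]
    simp
  -- The pairs `a1 + a2` and `a3 + a4` are monotonicity inequalities of supergradients: new iterate
  -- against saddle point, and new iterate against old one. Twice their sum is the claim after
  -- expansion. The last term on the left has no sign for a single `φ`, but sums to zero by
  -- `hcross`.
  have key : ∀ φ, B (u' φ - us φ) (u' φ - us φ) + B (x' φ - zs) (x' φ - zs) +
      (B (u' φ - u φ) (u' φ - u φ) + B (x' φ - x φ) (x' φ - x φ)) +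
      2 * B (u' φ - us φ - (x' φ - x φ)) (z - zs) ≤
      B (u φ - us φ) (u φ - us φ) + B (x φ - zs) (x φ - zs) := by
    intro φ
    have a1 := h1 φ
    have a2 := h2 φ
    have a3 := h3 φ
    have a4 := h4 φ
    have hz' : z = x' φ - (u' φ - u φ) := by rw [hu φ]; abel
    rw [hz']
    generalize x' φ = p at *
    generalize u' φ = q at *
    generalize us φ = r at *
    generalize x φ = s at *
    generalize u φ = t at *
    simp only [map_sub, LinearMap.sub_apply] at a1 a2 a3 a4 ⊢
    have e1 := hB p q
    have e2 := hB p r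
    have e3 := hB p s
    have e4 := hB p t
    have e5 := hB p zs
    have e6 := hB q r
    have e7 := hB q s
    have e8 := hB q t
    have e9 := hB q zs
    have e10 := hB r s
    have e11 := hB r t
    have e12 := hB r zs
    have e13 := hB s t
    have e14 := hB s zs
    have e15 := hB t zs
    linarith
  have := Finset.sum_le_sum fun φ (_ : φ ∈ Finset.univ) => key φ
  simp only [Finset.sum_add_distrib, ← Finset.mul_sum, hcross] at this ⊢
  linarith

/-- Convergence of the consensus ADMM with fixed penalties (absorbed in the inner product `B`), for
concave local objectives `h φ` on compact local sets `X φ`, if a saddle point exists. -/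
theorem admm_consensus_tendsto {E Φ : Type*} [NormedAddCommGroup E] [NormedSpace ℝ E]
    [FiniteDimensional ℝ E] [Fintype Φ] [Nonempty Φ]
    (B : E →ₗ[ℝ] E →ₗ[ℝ] ℝ) (hB : ∀ u v, B u v = B v u)
    {κ : ℝ} (hκ : 0 < κ) (hBκ : ∀ v, κ * ‖v‖ ^ 2 ≤ B v v)
    {X : Φ → Set E} (hX : ∀ φ, IsClosed (X φ)) {h : Φ → E → ℝ} (hh : ∀ φ, ContinuousOn (h φ) (X φ))
    {z : ℕ → E} {x u : ℕ → Φ → E} (hmem : ∀ p φ, x p φ ∈ X φ)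
    (hsub : ∀ p φ, ∀ y ∈ X φ, h φ y ≤ h φ (x p φ) + B (u p φ) (y - x p φ))
    (hu : ∀ p φ, u (p + 1) φ = u p φ + (x (p + 1) φ - z p))
    (hz : ∀ p, ∑ φ, (u p φ + (x p φ - z p)) = 0)
    {zs : E} (hzs : ∀ φ, zs ∈ X φ) {d : Φ → E →ₗ[ℝ] ℝ} (hd : ∑ φ, d φ = 0)
    (hds : ∀ φ, ∀ y ∈ X φ, h φ y ≤ h φ zs + d φ (y - zs)) :
    ∃ z', (∀ φ, z' ∈ X φ) ∧ (∀ y, (∀ φ, y ∈ X φ) → ∑ φ, h φ y ≤ ∑ φ, h φ z') ∧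
      Tendsto z atTop (𝓝 z') ∧ ∀ φ, Tendsto (fun p => x p φ) atTop (𝓝 z') := by
  have hB0 : ∀ v, 0 ≤ B v v := fun v => (by positivity : 0 ≤ κ * ‖v‖ ^ 2).trans (hBκ v)
  have hBz : ∀ v, B v v = 0 → v = 0 := by
    intro v hv
    have h1 := hBκ v
    rw [hv] at h1
    have : ‖v‖ ^ 2 ≤ 0 := by nlinarith [sq_nonneg ‖v‖]
    exact norm_eq_zero.1 (by nlinarith [norm_nonneg v])
  have hBcont : Continuous fun q : E × E => B q.1 q.2 := by
    let B' : E →L[ℝ] E →L[ℝ] ℝ := LinearMap.toContinuousLinearMap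
      ((LinearMap.toContinuousLinearMap : (E →ₗ[ℝ] ℝ) ≃ₗ[ℝ] (E →L[ℝ] ℝ)).toLinearMap.comp B)
    have : (fun q : E × E => B q.1 q.2) = fun q : E × E => B' q.1 q.2 := by
      funext q; simp [B']
    rw [this]
    fun_prop
  -- the functionals `d φ` as scaled multipliers
  have hBinj : Function.Injective B := by
    rw [← LinearMap.ker_eq_bot, LinearMap.ker_eq_bot']
    intro v hv
    exact hBz v (by rw [hv]; rfl)
  -- A positive definite form is injective into the dual, which has the same dimension; so each `d
  -- φ` is represented by a scaled multiplier.
  have hBsurj : Function.Surjective B :=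
    (LinearMap.injective_iff_surjective_of_finrank_eq_finrank
      (Subspace.dual_finrank_eq (K := ℝ) (V := E)).symm).1 hBinj
  choose us hus using fun φ => hBsurj (d φ)
  have hus0 : ∑ φ, us φ = 0 := hBinj (by rw [map_sum, map_zero, ← hd]; simp only [hus])
  -- Lyapunov function
  let V : (Φ → E) → E → ℕ → ℝ := fun us zs p =>
    ∑ φ, (B (u p φ - us φ) (u p φ - us φ) + B (x p φ - zs) (x p φ - zs))
  have hV : ∀ (us : Φ → E) (zs : E), ∑ φ, us φ = 0 → (∀ φ, zs ∈ X φ) →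
      (∀ φ, ∀ y ∈ X φ, h φ y ≤ h φ zs + B (us φ) (y - zs)) → ∀ p, V us zs (p + 1) +
      ∑ φ, (B (u (p + 1) φ - u p φ) (u (p + 1) φ - u p φ) +
        B (x (p + 1) φ - x p φ) (x (p + 1) φ - x p φ)) ≤ V us zs p := by
    intro us zs h1 h2 h3 p
    exact admm_fejer_step B hB (h := h) (fun φ => hsub _ φ _ (h2 φ)) (fun φ => h3 φ _ (hmem _ φ))
      (fun φ => hsub _ φ _ (hmem _ φ)) (fun φ => hsub _ φ _ (hmem _ φ)) (hu p) (hz p) h1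
  have hΔ0 : ∀ p, 0 ≤ ∑ φ, (B (u (p + 1) φ - u p φ) (u (p + 1) φ - u p φ) +
        B (x (p + 1) φ - x p φ) (x (p + 1) φ - x p φ)) := fun p =>
    Finset.sum_nonneg fun φ _ => add_nonneg (hB0 _) (hB0 _)
  have hVanti : ∀ (us : Φ → E) (zs : E), ∑ φ, us φ = 0 → (∀ φ, zs ∈ X φ) →
      (∀ φ, ∀ y ∈ X φ, h φ y ≤ h φ zs + B (us φ) (y - zs)) → Antitone (V us zs) :=
    fun us zs h1 h2 h3 => antitone_nat_of_succ_le fun p => by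
      linarith [hV us zs h1 h2 h3 p, hΔ0 p]
  have hV0 : ∀ us zs p, 0 ≤ V us zs p := fun us zs p =>
    Finset.sum_nonneg fun φ _ => add_nonneg (hB0 _) (hB0 _)
  have hVlim : ∀ (us : Φ → E) (zs : E), ∑ φ, us φ = 0 → (∀ φ, zs ∈ X φ) →
      (∀ φ, ∀ y ∈ X φ, h φ y ≤ h φ zs + B (us φ) (y - zs)) →
      ∃ l, Tendsto (V us zs) atTop (𝓝 l) := fun us zs h1 h2 h3 =>
    ⟨_, tendsto_atTop_ciInf (hVanti us zs h1 h2 h3) ⟨0, by rintro _ ⟨p, rfl⟩; exact hV0 _ _ _⟩⟩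
  have hds' : ∀ φ, ∀ y ∈ X φ, h φ y ≤ h φ zs + B (us φ) (y - zs) := by
    intro φ; rw [hus]; exact hds φ
  -- norms are controlled by `B`
  have hnorm : ∀ {F : Filter ℕ} (w : ℕ → E), Tendsto (fun p => B (w p) (w p)) F (𝓝 0) →
      Tendsto w F (𝓝 0) := by
    intro F w hw
    rw [tendsto_zero_iff_norm_tendsto_zero]
    have h1 : Tendsto (fun p => √(B (w p) (w p) / κ)) F (𝓝 0) := by
      simpa using (hw.div_const κ).sqrt
    refine squeeze_zero (fun _ => norm_nonneg _) (fun p => Real.le_sqrt_of_sq_le ?_) h1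
    rw [le_div_iff₀ hκ, mul_comm]
    exact hBκ _
  have hsumz : ∀ {F : Filter ℕ} (w w' : ℕ → Φ → E),
      Tendsto (fun p => ∑ φ, (B (w p φ) (w p φ) + B (w' p φ) (w' p φ))) F (𝓝 0) →
      ∀ φ, Tendsto (fun p => w p φ) F (𝓝 0) ∧ Tendsto (fun p => w' p φ) F (𝓝 0) := by
    intro F w w' hw φ
    have hle : ∀ p, B (w p φ) (w p φ) + B (w' p φ) (w' p φ) ≤
        ∑ φ, (B (w p φ) (w p φ) + B (w' p φ) (w' p φ)) := fun p =>
      Finset.single_le_sum (f := fun φ => B (w p φ) (w p φ) + B (w' p φ) (w' p φ))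
        (fun φ _ => add_nonneg (hB0 _) (hB0 _)) (Finset.mem_univ φ)
    exact ⟨hnorm _ (squeeze_zero (fun _ => hB0 _) (fun p => by linarith [hle p, hB0 (w' p φ)]) hw),
      hnorm _ (squeeze_zero (fun _ => hB0 _) (fun p => by linarith [hle p, hB0 (w p φ)]) hw)⟩
  have hΔ : Tendsto (fun p => ∑ φ, (B (u (p + 1) φ - u p φ) (u (p + 1) φ - u p φ) +
        B (x (p + 1) φ - x p φ) (x (p + 1) φ - x p φ))) atTop (𝓝 0) := by
    obtain ⟨l, hl⟩ := hVlim us zs hus0 hzs hds'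
    have h1 : Tendsto (fun p => V us zs p - V us zs (p + 1)) atTop (𝓝 0) := by
      simpa using hl.sub (hl.comp (tendsto_add_atTop_nat 1))
    exact squeeze_zero hΔ0 (fun p => by linarith [hV us zs hus0 hzs hds' p]) h1
  have hΔ' := hsumz (fun p φ => u (p + 1) φ - u p φ) (fun p φ => x (p + 1) φ - x p φ) hΔ
  -- The multiplier update gives x p - z p = (u (p+1) - u p) - (x (p+1) - x p), and both increments
  -- vanish.
  have hxz : ∀ φ, Tendsto (fun p => x p φ - z p) atTop (𝓝 0) := by
    intro φ
    have h1 := (hΔ' φ).1.sub (hΔ' φ).2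
    rw [sub_zero] at h1
    refine h1.congr fun p => ?_
    rw [hu]; abel
  have husum : Tendsto (fun p => ∑ φ, u p φ) atTop (𝓝 0) := by
    have h1 : Tendsto (fun p => -∑ φ, (x p φ - z p)) atTop (𝓝 0) := by
      simpa using (tendsto_finsetSum Finset.univ fun φ _ => hxz φ).neg
    refine h1.congr fun p => ?_
    rw [eq_comm, ← sub_eq_zero, sub_neg_eq_add, ← Finset.sum_add_distrib, hz]
  -- a cluster point
  obtain ⟨R, hR⟩ : ∃ R, ∀ p φ, ‖u p φ - us φ‖ ≤ R ∧ ‖x p φ - zs‖ ≤ R := by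
    refine ⟨√(V us zs 0 / κ), fun p φ => ?_⟩
    have h1 : B (u p φ - us φ) (u p φ - us φ) + B (x p φ - zs) (x p φ - zs) ≤ V us zs 0 :=
      (Finset.single_le_sum (f := fun φ => B (u p φ - us φ) (u p φ - us φ) +
        B (x p φ - zs) (x p φ - zs)) (fun φ _ => add_nonneg (hB0 _) (hB0 _))
        (Finset.mem_univ φ)).trans (hVanti us zs hus0 hzs hds' (Nat.zero_le p))
    have h2 : ∀ w : E, B w w ≤ V us zs 0 → ‖w‖ ≤ √(V us zs 0 / κ) := fun w hw =>
      Real.le_sqrt_of_sq_le (by rw [le_div_iff₀ hκ, mul_comm]; exact (hBκ w).trans hw)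
    exact ⟨h2 _ (by linarith [hB0 (x p φ - zs)]), h2 _ (by linarith [hB0 (u p φ - us φ)])⟩
  -- A fixed ultrafilter yields limits of all the bounded sequences at once, without passing to
  -- common subsequences.
  have hclus : ∀ (w : ℕ → E) (c : E), (∀ p, ‖w p - c‖ ≤ R) →
      ∃ w', Tendsto w (hyperfilter ℕ : Filter ℕ) (𝓝 w') := by
    intro w c hw
    have := (isCompact_closedBall c R).ultrafilter_le_nhds ((hyperfilter ℕ).map w) (by
      rw [le_principal_iff, Ultrafilter.mem_coe, Ultrafilter.mem_map]
      exact Filter.mem_of_superset univ_mem fun p _ => by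
        simpa [dist_eq_norm] using hw p)
    obtain ⟨w', -, hw'⟩ := this
    exact ⟨w', hw'⟩
  choose u' hu' using fun φ => hclus (fun p => u p φ) (us φ) fun p => (hR p φ).1
  choose x' hx' using fun φ => hclus (fun p => x p φ) zs fun p => (hR p φ).2
  have hHle : (hyperfilter ℕ : Filter ℕ) ≤ atTop := Nat.hyperfilter_le_atTop
  have φ₀ : Φ := Classical.arbitrary Φ
  have hxz' : ∀ φ, x' φ = x' φ₀ := by
    intro φ
    have h1 := ((hx' φ).sub (hx' φ₀))
    have h2 := ((hxz φ).sub (hxz φ₀)).mono_left hHle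
    simp only [sub_sub_sub_cancel_right, sub_zero] at h2
    exact sub_eq_zero.1 (tendsto_nhds_unique h1 h2)
  set z' := x' φ₀ with hz'
  have hx'' : ∀ φ, Tendsto (fun p => x p φ) (hyperfilter ℕ : Filter ℕ) (𝓝 z') := fun φ => by
    rw [← hxz' φ]; exact hx' φ
  have hz'X : ∀ φ, z' ∈ X φ := fun φ =>
    (hX φ).mem_of_tendsto (hx'' φ) (Eventually.of_forall fun p => hmem p φ)
  have hu'0 : ∑ φ, u' φ = 0 :=
    tendsto_nhds_unique (tendsto_finsetSum Finset.univ fun φ _ => hu' φ) (husum.mono_left hHle)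
  -- The supergradient inequalities pass to the limit, so the cluster point is itself a saddle point
  -- with multipliers `u'`.
  have hsad : ∀ φ, ∀ y ∈ X φ, h φ y ≤ h φ z' + B (u' φ) (y - z') := by
    intro φ y hy
    have h1 : Tendsto (fun p => h φ (x p φ)) (hyperfilter ℕ : Filter ℕ) (𝓝 (h φ z')) :=
      (hh φ z' (hz'X φ)).tendsto.comp (tendsto_nhdsWithin_iff.2
        ⟨hx'' φ, Eventually.of_forall fun p => hmem p φ⟩)
    have h2 : Tendsto (fun p => B (u p φ) (y - x p φ)) (hyperfilter ℕ : Filter ℕ)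
        (𝓝 (B (u' φ) (y - z'))) :=
      (hBcont.tendsto (u' φ, y - z')).comp ((hu' φ).prodMk_nhds ((hx'' φ).const_sub y))
    exact ge_of_tendsto (h1.add h2) (Eventually.of_forall fun p => hsub p φ y hy)
  -- The Lyapunov function of this new saddle point is monotone, hence convergent; along the
  -- ultrafilter it tends to 0, so its limit is 0.
  have hV' : Tendsto (V u' z') atTop (𝓝 0) := by
    obtain ⟨l, hl⟩ := hVlim u' z' hu'0 hz'X hsad
    have h1 : Tendsto (V u' z') (hyperfilter ℕ : Filter ℕ) (𝓝 0) := by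
      have hb : ∀ {w : ℕ → E} {c : E}, Tendsto w (hyperfilter ℕ : Filter ℕ) (𝓝 c) →
          Tendsto (fun p => B (w p - c) (w p - c)) (hyperfilter ℕ : Filter ℕ) (𝓝 0) := by
        intro w c hw
        have h2 : Tendsto (fun p => w p - c) (hyperfilter ℕ : Filter ℕ) (𝓝 0) := by
          simpa using hw.sub_const c
        have h3 := (hBcont.tendsto ((0 : E), (0 : E))).comp (h2.prodMk_nhds h2)
        rwa [show B ((0 : E), (0 : E)).1 ((0 : E), (0 : E)).2 = 0 by simp] at h3
      have h3 := tendsto_finsetSum Finset.univ fun φ _ => (hb (hu' φ)).add (hb (hx'' φ))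
      rwa [show ∑ _φ : Φ, ((0 : ℝ) + 0) = 0 by simp] at h3
    rwa [tendsto_nhds_unique (hl.mono_left hHle) h1] at hl
  have hxlim : ∀ φ, Tendsto (fun p => x p φ) atTop (𝓝 z') := by
    intro φ
    have := (hsumz (fun p φ => u p φ - u' φ) (fun p φ => x p φ - z') hV' φ).2
    simpa using this.add_const z'
  refine ⟨z', hz'X, fun y hy => ?_, ?_, hxlim⟩
  · have h1 := Finset.sum_le_sum fun φ (_ : φ ∈ Finset.univ) => hsad φ y (hy φ)
    rw [Finset.sum_add_distrib, ← LinearMap.sum_apply, ← map_sum, hu'0] at h1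
    simpa using h1
  · simpa using (hxlim φ₀).sub (hxz φ₀)

/-! ### Sequences with vanishing steps. -/

/-- A sequence in a proper space with vanishing steps converges to every cluster point that is
isolated among its cluster points. -/
theorem tendsto_of_isolated_mapClusterPt {E : Type*} [MetricSpace E] [ProperSpace E] {s : ℕ → E}
    (hs : Tendsto (fun n => dist (s (n + 1)) (s n)) atTop (𝓝 0)) {y : E}
    (hy : MapClusterPt y atTop s)
    (hiso : ∃ U ∈ 𝓝 y, ∀ y' ∈ U, MapClusterPt y' atTop s → y' = y) :
    Tendsto s atTop (𝓝 y) := by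
  obtain ⟨U, hU, hiso⟩ := hiso
  obtain ⟨ε₀, hε₀, hε₀U⟩ := Metric.mem_nhds_iff.1 hU
  rw [Metric.tendsto_atTop']
  intro ε hε
  set r := min ε ε₀ / 3 with hr
  have hr0 : 0 < r := by have := lt_min hε hε₀; positivity
  have hrε : r < ε := by have := min_le_left ε ε₀; linarith
  have hrε₀ : 2 * r < ε₀ := by have := min_le_right ε ε₀; linarith
  -- Infinitely many visits to the closed annulus would produce a cluster point in it, which is
  -- different from `y` but inside the isolating neighbourhood.
  have hann : ∀ᶠ n in atTop, ¬ (r ≤ dist (s n) y ∧ dist (s n) y ≤ 2 * r) := by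
    by_contra hcon
    have hfr : ∃ᶠ n in atTop, s n ∈ Metric.closedBall y (2 * r) ∩ {w | r ≤ dist w y} := by
      refine (not_eventually.1 hcon).mono fun n hn => ?_
      rw [not_not] at hn
      exact ⟨hn.2, hn.1⟩
    have hK : IsCompact (Metric.closedBall y (2 * r) ∩ {w | r ≤ dist w y}) :=
      (isCompact_closedBall y (2 * r)).inter_right (isClosed_le continuous_const (by fun_prop))
    obtain ⟨w, hw, hwc⟩ := hK.exists_mapClusterPt_of_frequently hfr
    have := hiso w (hε₀U (lt_of_le_of_lt hw.1 hrε₀)) hwc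
    subst this
    have := hw.2
    simp only [Set.mem_ofPred_eq, dist_self] at this
    linarith
  have hstep : ∀ᶠ n in atTop, dist (s (n + 1)) (s n) < r := hs.eventually (gt_mem_nhds hr0)
  obtain ⟨N, hN⟩ := (hann.and hstep).exists_forall_of_atTop
  obtain ⟨n₀, hn₀, hn₀r⟩ := (hy.frequently (Metric.ball_mem_nhds y hr0)).forall_exists_of_atTop N
  refine ⟨n₀, fun n hn => ?_⟩
  -- Steps shorter than `r` cannot cross an annulus of width `r`, so the sequence is trapped in the
  -- inner ball.
  have : ∀ k, dist (s (n₀ + k)) y < r := by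
    intro k
    induction k with
    | zero => exact hn₀r
    | succ k ih =>
      have h1 := (hN (n₀ + k) (by omega)).2
      have h2 := (hN (n₀ + (k + 1)) (by omega)).1
      have h3 := dist_triangle (s (n₀ + (k + 1))) (s (n₀ + k)) y
      rw [← add_assoc] at h2 h3 ⊢
      by_contra! h4
      exact h2 ⟨h4, by linarith⟩
  have h5 := this (n - n₀)
  rw [Nat.add_sub_cancel' hn.le] at h5
  linarith

namespace FDSystem

variable {M Kd Ku : ℕ} (P : FDSystem M Kd Ku)

/-! ### Positivity of the coefficients -/

theorem tauTd_pos (k : Fin Kd) : (0 : ℝ) < P.tauTd := by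
  have := P.pilots_d
  have := k.pos
  exact_mod_cast (by omega : 0 < P.tauTd)

theorem tauTu_pos (l : Fin Ku) : (0 : ℝ) < P.tauTu := by
  have := P.pilots_u
  have := l.pos
  exact_mod_cast (by omega : 0 < P.tauTu)

theorem Nt_cast_pos : (0 : ℝ) < P.Nt := by exact_mod_cast P.Nt_pos

theorem Nr_cast_pos : (0 : ℝ) < P.Nr := by exact_mod_cast P.Nr_pos

theorem gammaD_pos (m : Fin M) (k : Fin Kd) : 0 < P.gammaD m k := by
  have := P.tauTd_pos k
  have := P.rhoT_pos
  have := P.betaD_pos m k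
  unfold gammaD
  positivity

theorem gammaU_pos (m : Fin M) (l : Fin Ku) : 0 < P.gammaU m l := by
  have := P.tauTu_pos l
  have := P.rhoT_pos
  have := P.betaU_pos m l
  unfold gammaU
  positivity

theorem tauF_pos : 0 < P.tauF := by
  have h : (P.tauTd : ℝ) + P.tauTu < P.tauC := by exact_mod_cast P.tau_lt
  have h1 : (0 : ℝ) ≤ P.tauTd := Nat.cast_nonneg _
  have h2 : (0 : ℝ) ≤ P.tauTu := Nat.cast_nonneg _
  exact div_pos (by linarith) (by linarith)

theorem qb_pos : 0 < P.qb := (pow_pos P.qa_pos 2).trans_le P.qa_sq_le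

theorem coefAd_pos (s : P.Served) : 0 < P.coefAd s := by
  have := P.qa_pos
  have := P.Nt_cast_pos
  have := Real.sqrt_pos.2 P.rhoD_pos
  have := P.gammaD_pos s.1.1 s.1.2
  unfold coefAd
  positivity

theorem coefAu_pos {l : Fin Ku} (hl : (P.apsU l).Nonempty) : 0 < P.coefAu l := by
  have := P.qa_pos
  have := P.Nr_cast_pos
  have := P.rhoU_pos
  have := Finset.sum_pos (fun m _ => P.gammaU_pos m l) hl
  unfold coefAu
  positivity

theorem Pfix_nonneg : 0 ≤ P.Pfix := by
  have h : (P.tauTd : ℝ) + P.tauTu < P.tauC := by exact_mod_cast P.tau_lt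
  have h' : 0 < (P.tauC : ℝ) - (P.tauTd + P.tauTu) := by linarith
  have hT := P.Tc_pos
  unfold Pfix Rfh
  refine mul_nonneg (by positivity) (Finset.sum_nonneg fun m _ => ?_)
  have := P.P0_nonneg m
  have := P.PtcAP_nonneg m
  have := P.Pft_nonneg
  have := P.Cfh_pos m
  positivity

/-! ### Uniform notation for both kinds of UEs -/

/-- Affine functions of the power variables. -/
def affForm (a : P.Served → ℝ) (b : Fin Ku → ℝ) (c : ℝ) (y : P.PowerVec) : ℝ :=
  ∑ s, a s * y.1 s + ∑ l, b l * y.2 l + c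

def den : P.UE → P.PowerVec → ℝ
  | .inl k => P.denD k
  | .inr l => P.denU l

def pow : P.UE → P.PowerVec → ℝ
  | .inl k => P.powD k
  | .inr l => P.powU l

def se : P.UE → P.PowerVec → ℝ
  | .inl k => P.seD k
  | .inr l => P.seU l

def minSE : P.UE → ℝ
  | .inl k => P.SoD k
  | .inr l => P.SoU l

/-- Square root of the signal power of a UE, as a function of `(C, Θ)`. -/
def sig : P.UE → P.PowerVec → ℝ
  | .inl k => fun x => ∑ s ∈ P.pairsOfUE k, P.coefAd s * x.1 s
  | .inr l => fun x => √(P.coefAu l * x.2 l)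

def denS : P.UE → P.Served → ℝ
  | .inl k => P.coefBd k
  | .inr l => P.coefDu l

/-- The quantizer distortion E of an uplink UE multiplies its own power, hence the extra diagonal
term. -/
def denT : P.UE → Fin Ku → ℝ
  | .inl k => P.coefDd k
  | .inr l => fun q => P.coefBu l q + if q = l then P.coefEu l else 0

def denC : P.UE → ℝ
  | .inl _ => 1
  | .inr l => P.coefFu l

def powS : P.UE → P.Served → ℝ
  | .inl k => fun s => if s.1.2 = k then
      P.Nt * P.rhoD * P.N0 * (1 / P.ampAP s.1.1 * P.gammaD s.1.1 s.1.2) else 0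
  | .inr _ => 0

def powT : P.UE → Fin Ku → ℝ
  | .inl _ => 0
  | .inr l => fun q => if q = l then P.rhoU * P.N0 * (1 / P.ampUE l) else 0

def powC : P.UE → ℝ
  | .inl k => P.Pfix + P.PtcD k
  | .inr l => P.Pfix + P.PtcU l

def loadS (m : Fin M) (s : P.Served) : ℝ :=
  if s.1.1 = m then P.qb * P.gammaD s.1.1 s.1.2 else 0

theorem den_eq (φ : P.UE) (y : P.PowerVec) :
    P.den φ y = P.affForm (P.denS φ) (P.denT φ) (P.denC φ) y := by
  cases φ with
  | inl k => rfl
  | inr l =>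
    simp only [den, denU, affForm, denS, denT, denC, add_mul, Finset.sum_add_distrib, ite_mul,
      zero_mul, Finset.sum_ite_eq', Finset.mem_univ, if_true]
    ring

theorem pow_eq (φ : P.UE) (y : P.PowerVec) :
    P.pow φ y = P.affForm (P.powS φ) (P.powT φ) (P.powC φ) y := by
  cases φ with
  | inl k =>
    simp only [pow, powD, affForm, powS, powT, powC, pairsOfUE, Finset.sum_filter, ite_mul,
      zero_mul, Pi.zero_apply, Finset.sum_const_zero, Finset.mul_sum, mul_ite, mul_zero]
    simp only [mul_assoc]
    ring
  | inr l =>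
    simp only [pow, powU, affForm, powS, powT, powC, ite_mul,
      zero_mul, Pi.zero_apply, Finset.sum_const_zero, Finset.sum_ite_eq', Finset.mem_univ, if_true]
    ring

theorem apLoad_eq (m : Fin M) (y : P.PowerVec) :
    P.apLoad m y = P.affForm (P.loadS m) 0 0 y := by
  simp only [apLoad, affForm, loadS, pairsOfAP, Finset.sum_filter, ite_mul,
      zero_mul, Pi.zero_apply, Finset.sum_const_zero, Finset.mul_sum, mul_ite, mul_zero, mul_assoc,
      add_zero]

theorem denS_nonneg (φ : P.UE) (s : P.Served) : 0 ≤ P.denS φ s := by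
  have h1 := P.qb_pos
  have h2 := P.Nt_cast_pos
  have h3 := P.Nr_cast_pos
  have h4 := P.rhoD_pos
  have h5 := P.gammaD_pos s.1.1 s.1.2
  cases φ with
  | inl k =>
    have := P.betaD_pos s.1.1 k
    simp only [denS, coefBd]
    positivity
  | inr l =>
    simp only [denS, coefDu]
    refine mul_nonneg (by positivity) (Finset.sum_nonneg fun m _ => ?_)
    have := P.gammaU_pos m l
    have := P.betaRI_nonneg m s.1.1
    have := P.gammaRI_nonneg
    positivity

theorem denT_nonneg (φ : P.UE) (q : Fin Ku) : 0 ≤ P.denT φ q := by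
  have h1 := P.qb_pos
  have h3 := P.Nr_cast_pos
  have h4 := P.rhoU_pos
  cases φ with
  | inl k =>
    have := P.betaUDI_nonneg k q
    simp only [denT, coefDd]
    positivity
  | inr l =>
    simp only [denT, coefBu, coefEu]
    have h5 : 0 ≤ P.qb - P.qa ^ 2 := sub_nonneg.2 P.qa_sq_le
    refine add_nonneg (mul_nonneg (by positivity) (Finset.sum_nonneg fun m _ => ?_)) ?_
    · exact (mul_pos (P.gammaU_pos m l) (P.betaU_pos m q)).le
    · split_ifs
      · exact mul_nonneg (by positivity) (Finset.sum_nonneg fun m _ => sq_nonneg _)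
      · exact le_rfl

theorem powS_nonneg (φ : P.UE) (s : P.Served) : 0 ≤ P.powS φ s := by
  have h2 := P.Nt_cast_pos
  have h4 := P.rhoD_pos
  have h5 := P.gammaD_pos s.1.1 s.1.2
  have h6 := P.N0_pos
  have h7 := P.ampAP_pos s.1.1
  cases φ with
  | inl k => simp only [powS]; split_ifs <;> positivity
  | inr l => exact le_rfl

theorem powS_own_pos (s : P.Served) : 0 < P.powS (.inl s.1.2) s := by
  have h2 := P.Nt_cast_pos
  have h4 := P.rhoD_pos
  have h5 := P.gammaD_pos s.1.1 s.1.2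
  have h6 := P.N0_pos
  have h7 := P.ampAP_pos s.1.1
  simp only [powS, if_true]
  positivity

theorem powT_nonneg (φ : P.UE) (q : Fin Ku) : 0 ≤ P.powT φ q := by
  cases φ with
  | inl k => exact le_rfl
  | inr l =>
    have h4 := P.rhoU_pos
    have h6 := P.N0_pos
    have h7 := P.ampUE_pos l
    simp only [powT]
    split_ifs <;> positivity

theorem powC_pos (φ : P.UE) : 0 < P.powC φ := by
  have := P.Pfix_nonneg
  cases φ with
  | inl k => exact add_pos_of_nonneg_of_pos this (P.PtcD_pos k)
  | inr l => exact add_pos_of_nonneg_of_pos this (P.PtcU_pos l)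

theorem loadS_nonneg (m : Fin M) (s : P.Served) : 0 ≤ P.loadS m s := by
  have := P.qb_pos
  have h5 := P.gammaD_pos s.1.1 s.1.2
  unfold loadS
  split_ifs <;> positivity

theorem loadS_own_pos (s : P.Served) : 0 < P.loadS s.1.1 s := by
  have := P.qb_pos
  have h5 := P.gammaD_pos s.1.1 s.1.2
  simp only [loadS, if_true]
  positivity

theorem weight_pos (φ : P.UE) : 0 < P.weight φ := by
  cases φ with
  | inl k => exact P.wD_pos k
  | inr l => exact P.wU_pos l

theorem minSE_pos (φ : P.UE) : 0 < P.minSE φ := by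
  cases φ with
  | inl k => exact P.SoD_pos k
  | inr l => exact P.SoU_pos l

/-- Every UE is served by some AP. -/
structure Covered : Prop where
  d : ∀ k, (P.pairsOfUE k).Nonempty
  u : ∀ l, (P.apsU l).Nonempty

variable {P}

theorem Covered.denC_pos (hP : P.Covered) (φ : P.UE) : 0 < P.denC φ := by
  cases φ with
  | inl k => exact one_pos
  | inr l =>
    have := P.qb_pos
    have := P.Nr_cast_pos
    have := Finset.sum_pos (fun m _ => P.gammaU_pos m l) (hP.u l)
    simp only [denC, coefFu]
    positivity

variable (P)

/-- An unserved UE has no signal, hence spectral efficiency 0, which is below its positive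
quality-of-service level. `Covered` keeps the noise terms `denC` and the uplink gains positive. -/
theorem covered_of_feasible {y : P.PowerVec} (hy : P.P2Feasible y) : P.Covered := by
  constructor
  · intro k
    by_contra h
    rw [Finset.not_nonempty_iff_eq_empty] at h
    have h1 := hy (.inl (.inl k))
    simp only [p2Con, seD, h, Finset.sum_empty] at h1
    simp at h1
    linarith [P.SoD_pos k]
  · intro l
    by_contra h
    rw [Finset.not_nonempty_iff_eq_empty] at h
    have h1 := hy (.inl (.inr l))
    simp only [p2Con, seU, coefAu, h, Finset.sum_empty] at h1
    simp at h1
    linarith [P.SoU_pos l]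

/-! ### The orthant of nonnegative power variables -/

def orthant : Set P.PowerVec := {x | (∀ s, 0 ≤ x.1 s) ∧ ∀ l, 0 ≤ x.2 l}

variable {P}

theorem PowerFeasible.mem_orthant {x : P.PowerVec} (hx : P.PowerFeasible x) : x ∈ P.orthant :=
  ⟨hx.2.1, fun l => (hx.2.2 l).1⟩

theorem toEta_mem_orthant {x : P.PowerVec} (hx : x ∈ P.orthant) : P.toEta x ∈ P.orthant :=
  ⟨fun s => sq_nonneg (x.1 s), hx.2⟩

theorem affForm_mono {a : P.Served → ℝ} {b : Fin Ku → ℝ} (ha : ∀ s, 0 ≤ a s) (hb : ∀ l, 0 ≤ b l)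
    (c : ℝ) {y y' : P.PowerVec} (h : ∀ s, y.1 s ≤ y'.1 s) (h' : ∀ l, y.2 l ≤ y'.2 l) :
    P.affForm a b c y ≤ P.affForm a b c y' := by
  unfold affForm
  gcongr with s _ l _
  · exact ha s
  · exact h s
  · exact hb l
  · exact h' l

theorem le_affForm {a : P.Served → ℝ} {b : Fin Ku → ℝ} (ha : ∀ s, 0 ≤ a s) (hb : ∀ l, 0 ≤ b l)
    (c : ℝ) {y : P.PowerVec} (hy : y ∈ P.orthant) : c ≤ P.affForm a b c y := by
  have h := affForm_mono (P := P) ha hb c (y := 0) (y' := y) hy.1 hy.2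
  simpa [affForm] using h

theorem continuous_affForm (a : P.Served → ℝ) (b : Fin Ku → ℝ) (c : ℝ) :
    Continuous (P.affForm a b c) := by
  unfold affForm
  fun_prop

theorem differentiable_affForm (a : P.Served → ℝ) (b : Fin Ku → ℝ) (c : ℝ) :
    Differentiable ℝ (P.affForm a b c) := by
  unfold affForm
  fun_prop

theorem continuous_toEta : Continuous P.toEta := by
  unfold toEta
  fun_prop

theorem differentiable_toEta : Differentiable ℝ P.toEta := by
  unfold toEta
  fun_prop

/-- The form is quadratic and diagonal in `C` but affine in Θ, so only the coefficients of `C` need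
a sign. -/
theorem convexOn_affForm_toEta {a : P.Served → ℝ} (ha : ∀ s, 0 ≤ a s) (b : Fin Ku → ℝ) (c : ℝ) :
    ConvexOn ℝ Set.univ fun x => P.affForm a b c (P.toEta x) := by
  refine ⟨convex_univ, fun x _ x' _ t t' ht ht' htt => ?_⟩
  simp only [affForm, toEta, smul_eq_mul, Prod.fst_add, Prod.snd_add, Prod.smul_fst,
    Prod.smul_snd, Pi.add_apply, Pi.smul_apply]
  have h1 : ∑ s, a s * (t * x.1 s + t' * x'.1 s) ^ 2 ≤
      t * ∑ s, a s * x.1 s ^ 2 + t' * ∑ s, a s * x'.1 s ^ 2 := by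
    rw [Finset.mul_sum, Finset.mul_sum, ← Finset.sum_add_distrib]
    refine Finset.sum_le_sum fun s _ => ?_
    have h3 : (t * x.1 s + t' * x'.1 s) ^ 2 ≤ t * x.1 s ^ 2 + t' * x'.1 s ^ 2 := by
      have : t * x.1 s ^ 2 + t' * x'.1 s ^ 2 - (t * x.1 s + t' * x'.1 s) ^ 2 =
        t * t' * (x.1 s - x'.1 s) ^ 2 := by
        obtain rfl : t' = 1 - t := by linarith
        ring
      nlinarith [mul_nonneg (mul_nonneg ht ht') (sq_nonneg (x.1 s - x'.1 s))]
    nlinarith [mul_le_mul_of_nonneg_left h3 (ha s)]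
  have h2 : ∑ l, b l * (t * x.2 l + t' * x'.2 l) =
      t * ∑ l, b l * x.2 l + t' * ∑ l, b l * x'.2 l := by
    rw [Finset.mul_sum, Finset.mul_sum, ← Finset.sum_add_distrib]
    exact Finset.sum_congr rfl fun l _ => by ring
  have h3 : t * c + t' * c = c := by rw [← add_mul, htt, one_mul]
  rw [h2]
  linarith

theorem Covered.den_pos (hP : P.Covered) (φ : P.UE) {y : P.PowerVec} (hy : y ∈ P.orthant) :
    0 < P.den φ y := by
  rw [den_eq]
  exact (hP.denC_pos φ).trans_le (le_affForm (P.denS_nonneg φ) (P.denT_nonneg φ) _ hy)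

theorem pow_pos' (φ : P.UE) {y : P.PowerVec} (hy : y ∈ P.orthant) : 0 < P.pow φ y := by
  rw [pow_eq]
  exact (P.powC_pos φ).trans_le (le_affForm (P.powS_nonneg φ) (P.powT_nonneg φ) _ hy)

theorem convex_orthant : Convex ℝ P.orthant := by
  intro x hx y hy a b ha hb _
  exact ⟨fun s => add_nonneg (mul_nonneg ha (hx.1 s)) (mul_nonneg hb (hy.1 s)),
    fun l => add_nonneg (mul_nonneg ha (hx.2 l)) (mul_nonneg hb (hy.2 l))⟩

theorem sig_nonneg (φ : P.UE) {x : P.PowerVec} (hx : x ∈ P.orthant) : 0 ≤ P.sig φ x := by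
  cases φ with
  | inl k => exact Finset.sum_nonneg fun s _ => mul_nonneg (P.coefAd_pos s).le (hx.1 s)
  | inr l => exact Real.sqrt_nonneg _

theorem continuous_sig (φ : P.UE) : Continuous (P.sig φ) := by
  cases φ with
  | inl k => simp only [sig]; fun_prop
  | inr l => simp only [sig]; fun_prop

theorem concaveOn_sig (φ : P.UE) : ConcaveOn ℝ P.orthant (P.sig φ) := by
  refine ⟨convex_orthant, fun x hx x' hx' t t' ht ht' htt => ?_⟩
  cases φ with
  | inl k =>
    simp only [sig, Prod.fst_add, Prod.smul_fst, Pi.add_apply, Pi.smul_apply, smul_eq_mul,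
      Finset.mul_sum, ← Finset.sum_add_distrib]
    exact (Finset.sum_congr rfl fun s _ => by ring).le
  | inr l =>
    have hA : 0 ≤ P.coefAu l := by
      have := P.rhoU_pos
      unfold coefAu
      positivity
    have h := Real.strictConcaveOn_sqrt.concaveOn.2 (Set.mem_Ici.2 (mul_nonneg hA (hx.2 l)))
      (Set.mem_Ici.2 (mul_nonneg hA (hx'.2 l))) ht ht' htt
    simp only [sig, Prod.snd_add, Prod.smul_snd, Pi.add_apply, Pi.smul_apply, smul_eq_mul] at h ⊢
    refine h.trans (le_of_eq ?_)
    congr 1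
    ring

theorem continuous_den_toEta (φ : P.UE) : Continuous fun x => P.den φ (P.toEta x) := by
  simp only [den_eq]
  exact (continuous_affForm _ _ _).comp continuous_toEta

theorem continuous_pow_toEta (φ : P.UE) : Continuous fun x => P.pow φ (P.toEta x) := by
  simp only [pow_eq]
  exact (continuous_affForm _ _ _).comp continuous_toEta

theorem convexOn_den_toEta (φ : P.UE) : ConvexOn ℝ Set.univ fun x => P.den φ (P.toEta x) := by
  simp only [den_eq]
  exact convexOn_affForm_toEta (P.denS_nonneg φ) _ _

theorem convexOn_pow_toEta (φ : P.UE) : ConvexOn ℝ Set.univ fun x => P.pow φ (P.toEta x) := by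
  simp only [pow_eq]
  exact convexOn_affForm_toEta (P.powS_nonneg φ) _ _

theorem convexOn_apLoad_toEta (m : Fin M) :
    ConvexOn ℝ Set.univ fun x => P.apLoad m (P.toEta x) := by
  simp only [apLoad_eq]
  exact convexOn_affForm_toEta (P.loadS_nonneg m) _ _

/-! ### The set of admissible powers -/

theorem convex_powerFeasible : Convex ℝ {x | P.PowerFeasible x} := by
  intro x hx y hy a b ha hb hab
  refine ⟨fun m => ?_, (convex_orthant hx.mem_orthant hy.mem_orthant ha hb hab).1, fun l =>
    ⟨(convex_orthant hx.mem_orthant hy.mem_orthant ha hb hab).2 l, ?_⟩⟩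
  · refine ((convexOn_apLoad_toEta m).2 (Set.mem_univ x) (Set.mem_univ y) ha hb hab).trans ?_
    calc a • P.apLoad m (P.toEta x) + b • P.apLoad m (P.toEta y)
        ≤ a * (1 / P.Nt) + b * (1 / P.Nt) := by
          gcongr
          · exact mul_le_mul_of_nonneg_left (hx.1 m) ha
          · exact mul_le_mul_of_nonneg_left (hy.1 m) hb
      _ = 1 / P.Nt := by rw [← add_mul, hab, one_mul]
  · show a * x.2 l + b * y.2 l ≤ 1
    nlinarith [mul_le_mul_of_nonneg_left (hx.2.2 l).2 ha,
      mul_le_mul_of_nonneg_left (hy.2.2 l).2 hb]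

theorem isClosed_powerFeasible : IsClosed {x | P.PowerFeasible x} := by
  simp only [PowerFeasible, Set.ofPred_and, Set.ofPred_forall, apLoad_eq]
  exact (isClosed_iInter fun m => isClosed_le
      ((continuous_affForm _ _ _).comp continuous_toEta) continuous_const).inter
    ((isClosed_iInter fun s => isClosed_le continuous_const (by fun_prop)).inter
      (isClosed_iInter fun l => (isClosed_le continuous_const (by fun_prop)).inter
        (isClosed_le (by fun_prop) continuous_const)))

theorem isCompact_powerFeasible : IsCompact {x | P.PowerFeasible x} := by
  have h : {x | P.PowerFeasible x} ⊆
      Set.Icc (0 : P.PowerVec) (fun s => √(1 / P.Nt / P.loadS s.1.1 s), fun _ => 1) := by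
    intro x hx
    refine ⟨⟨hx.2.1, fun l => (hx.2.2 l).1⟩, ⟨fun s => ?_, fun l => (hx.2.2 l).2⟩⟩
    -- A single served pair cannot exceed the power budget of its AP; this bounds each coordinate of
    -- `C`.
    refine Real.le_sqrt_of_sq_le ?_
    rw [le_div_iff₀ (P.loadS_own_pos s), mul_comm]
    refine le_trans ?_ (hx.1 s.1.1)
    rw [apLoad_eq]
    simp only [affForm, toEta, Pi.zero_apply, zero_mul, Finset.sum_const_zero, add_zero]
    exact Finset.single_le_sum (f := fun s' => P.loadS s.1.1 s' * x.1 s' ^ 2)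
      (fun s' _ => mul_nonneg (P.loadS_nonneg _ _) (sq_nonneg _)) (Finset.mem_univ s)
  exact isCompact_Icc.of_isClosed_subset isClosed_powerFeasible h

variable (P)

/-! ### Spectral efficiency as a function of the SINR -/

def rate (t : ℝ) : ℝ := P.tauF * Real.logb 2 (1 + t)

/-- The SINR that the quality of service of a UE requires. -/
def minSinr (φ : P.UE) : ℝ := (2 : ℝ) ^ (P.minSE φ / P.tauF) - 1

def sinr (φ : P.UE) (x : P.PowerVec) : ℝ := P.sig φ x ^ 2 / P.den φ (P.toEta x)

variable {P}

theorem minSinr_pos (φ : P.UE) : 0 < P.minSinr φ := by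
  have := Real.one_lt_rpow (one_lt_two) (div_pos (P.minSE_pos φ) P.tauF_pos)
  unfold minSinr
  linarith

theorem minSE_div_le_logb_iff (φ : P.UE) {t : ℝ} (ht : 0 < 1 + t) :
    P.minSE φ / P.tauF ≤ Real.logb 2 (1 + t) ↔ P.minSinr φ ≤ t := by
  rw [Real.le_logb_iff_rpow_le one_lt_two ht, minSinr]
  constructor <;> intro h <;> linarith

theorem minSE_le_rate_iff (φ : P.UE) {t : ℝ} (ht : 0 < 1 + t) :
    P.minSE φ ≤ P.rate t ↔ P.minSinr φ ≤ t := by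
  rw [← minSE_div_le_logb_iff φ ht, div_le_iff₀ P.tauF_pos, rate, mul_comm]

theorem minSE_lt_rate_iff (φ : P.UE) {t : ℝ} (ht : 0 < 1 + t) :
    P.minSE φ < P.rate t ↔ P.minSinr φ < t := by
  have h : P.minSE φ < P.rate t ↔ P.minSE φ / P.tauF < Real.logb 2 (1 + t) := by
    rw [div_lt_iff₀ P.tauF_pos, rate, mul_comm]
  rw [h, Real.lt_logb_iff_rpow_lt one_lt_two ht, minSinr]
  constructor <;> intro h <;> linarith

theorem rate_zero : P.rate 0 = 0 := by simp [rate]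

theorem rate_lt_rate {t t' : ℝ} (ht : 0 < 1 + t) (h : t < t') : P.rate t < P.rate t' := by
  unfold rate
  have := P.tauF_pos
  have := Real.logb_lt_logb one_lt_two ht (by linarith : 1 + t < 1 + t')
  gcongr

theorem rate_le_rate {t t' : ℝ} (ht : 0 < 1 + t) (h : t ≤ t') : P.rate t ≤ P.rate t' := by
  rcases h.eq_or_lt with rfl | h
  · exact le_rfl
  · exact (rate_lt_rate ht h).le

theorem rate_nonneg {t : ℝ} (ht : 0 ≤ t) : 0 ≤ P.rate t := by
  rw [← rate_zero (P := P)]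
  exact rate_le_rate (by norm_num) ht

theorem rate_pos {t : ℝ} (ht : 0 < t) : 0 < P.rate t := by
  rw [← rate_zero (P := P)]
  exact rate_lt_rate (by norm_num) ht

theorem concaveOn_rate : ConcaveOn ℝ (Set.Ici 0) P.rate := by
  refine ⟨convex_Ici 0, fun t ht t' ht' a b ha hb hab => ?_⟩
  have h1 : (0 : ℝ) ≤ t := ht
  have h2 : (0 : ℝ) ≤ t' := ht'
  have h := strictConcaveOn_log_Ioi.concaveOn.2 (x := 1 + t) (y := 1 + t')
    (Set.mem_Ioi.2 (by linarith)) (Set.mem_Ioi.2 (by linarith)) ha hb hab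
  have h3 : a • (1 + t) + b • (1 + t') = 1 + (a • t + b • t') := by
    simp only [smul_eq_mul]
    linear_combination hab
  rw [h3] at h
  have h4 : 0 < Real.log 2 := Real.log_pos one_lt_two
  have h5 : 0 ≤ P.tauF / Real.log 2 := (div_pos P.tauF_pos h4).le
  have h6 : ∀ s, P.rate s = P.tauF / Real.log 2 * Real.log (1 + s) := fun s => by
    rw [rate, Real.logb]; ring
  simp only [h6, smul_eq_mul] at h ⊢
  nlinarith [mul_le_mul_of_nonneg_left h h5]

theorem hasDerivAt_rate {t : ℝ} (ht : 0 < 1 + t) :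
    HasDerivAt P.rate (P.tauF * ((1 + t)⁻¹ / Real.log 2)) t := by
  have h1 : HasDerivAt (fun s : ℝ => 1 + s) 1 t := (hasDerivAt_id t).const_add 1
  have h2 : HasDerivAt (fun s => Real.log (1 + s) / Real.log 2) ((1 + t)⁻¹ / Real.log 2) t := by
    have := (h1.log ht.ne').div_const (Real.log 2)
    simpa using this
  exact h2.const_mul P.tauF

theorem continuousAt_rate {t : ℝ} (ht : 0 < 1 + t) : ContinuousAt P.rate t :=
  (hasDerivAt_rate ht).continuousAt

theorem Covered.sinr_nonneg (hP : P.Covered) (φ : P.UE) {x : P.PowerVec} (hx : x ∈ P.orthant) :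
    0 ≤ P.sinr φ x :=
  div_nonneg (sq_nonneg _) (hP.den_pos φ (toEta_mem_orthant hx)).le

theorem se_toEta (φ : P.UE) {x : P.PowerVec} (hx : x ∈ P.orthant) :
    P.se φ (P.toEta x) = P.rate (P.sinr φ x) := by
  cases φ with
  | inl k =>
    simp only [se, seD, rate, sinr, sig, den, toEta, Real.sqrt_sq (hx.1 _)]
  | inr l =>
    have hA : 0 ≤ P.coefAu l := by
      have := P.rhoU_pos
      unfold coefAu
      positivity
    simp only [se, seU, rate, sinr, sig, den, toEta, Real.sq_sqrt (mul_nonneg hA (hx.2 l))]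

theorem wsee_eq (y : P.PowerVec) :
    P.wsee y = ∑ φ, P.weight φ * (P.se φ y / P.pow φ y) := by
  rw [Fintype.sum_sum_type]
  rfl

theorem p2Con_se (φ : P.UE) (y : P.PowerVec) : P.p2Con (.inl φ) y = P.se φ y - P.minSE φ := by
  cases φ <;> rfl

/-- The rate is strictly increasing, so each quality-of-service constraint is a threshold on the
SINR. In this form it can be compared with the linearized constraint. -/
theorem Covered.p2Feasible_toEta_iff (hP : P.Covered) {x : P.PowerVec} (hx : ∀ s, 0 ≤ x.1 s) :
    P.P2Feasible (P.toEta x) ↔ P.PowerFeasible x ∧ ∀ φ, P.minSinr φ ≤ P.sinr φ x := by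
  have key : ∀ (φ : P.UE), x ∈ P.orthant →
      (0 ≤ P.p2Con (.inl φ) (P.toEta x) ↔ P.minSinr φ ≤ P.sinr φ x) := fun φ hx => by
    have := hP.sinr_nonneg φ hx
    rw [p2Con_se, sub_nonneg, se_toEta φ hx, minSE_le_rate_iff φ (by linarith)]
  constructor
  · intro h
    have hT : ∀ l, 0 ≤ x.2 l := fun l => h (.inr (.inr (.inr (.inl l))))
    refine ⟨⟨fun m => sub_nonneg.1 (h (.inr (.inl m))), hx, fun l => ⟨hT l, ?_⟩⟩, fun φ =>
      (key φ ⟨hx, hT⟩).1 (h _)⟩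
    exact sub_nonneg.1 (h (.inr (.inr (.inr (.inr l)))))
  · rintro ⟨h1, h2⟩ i
    rcases i with φ | m | s | l | l
    · exact (key φ h1.mem_orthant).2 (h2 φ)
    · exact sub_nonneg.2 (h1.1 m)
    · exact sq_nonneg (x.1 s)
    · exact (h1.2.2 l).1
    · exact sub_nonneg.2 (h1.2.2 l).2

/-- A point that is strictly feasible for the quality of service constraints can be scaled down to
satisfy the upper power limits strictly, too. -/
theorem Covered.exists_strictly_feasible (hP : P.Covered) {y : P.PowerVec} (hy : P.P2Feasible y)
    (hs : ∀ φ, P.minSE φ < P.se φ y) :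
    ∃ x, x ∈ P.orthant ∧ (∀ φ, P.minSinr φ < P.sinr φ x) ∧
      (∀ m, P.apLoad m (P.toEta x) < 1 / P.Nt) ∧ ∀ l, x.2 l < 1 := by
  have hy1 : ∀ s, 0 ≤ y.1 s := fun s => hy (.inr (.inr (.inl s)))
  have hy2 : ∀ l, 0 ≤ y.2 l := fun l => hy (.inr (.inr (.inr (.inl l))))
  set w : P.PowerVec := (fun s => √(y.1 s), y.2) with hw
  have hwy : P.toEta w = y := by
    refine Prod.ext (funext fun s => ?_) rfl
    exact Real.sq_sqrt (hy1 s)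
  have hwo : w ∈ P.orthant := ⟨fun s => Real.sqrt_nonneg _, hy2⟩
  have hws : ∀ φ, P.minSinr φ < P.sinr φ w := fun φ => by
    have := hP.sinr_nonneg φ hwo
    rw [← minSE_lt_rate_iff φ (by linarith), ← se_toEta φ hwo, hwy]
    exact hs φ
  have hev : ∀ᶠ r : ℝ in 𝓝[<] 1, ∀ φ, P.minSinr φ < r ^ 2 * P.sinr φ w := by
    refine eventually_all.2 fun φ => ?_
    have hc : Continuous fun r : ℝ => r ^ 2 * P.sinr φ w := by fun_prop
    have := hc.continuousWithinAt.tendsto (x := (1 : ℝ)) (s := Set.Iio 1)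
    exact this.eventually (lt_mem_nhds (by simpa using hws φ))
  obtain ⟨r, hr, hr0, hr1⟩ := (hev.and (Ioo_mem_nhdsLT (zero_lt_one (α := ℝ)))).exists
  -- With factors `r` on `C` and r² on Θ all signals scale by exactly `r` and no interference grows,
  -- so each SINR loses at most the factor r². Loads scale by r² < 1.
  set x : P.PowerVec := (fun s => r * w.1 s, fun l => r ^ 2 * w.2 l) with hx
  have hxo : x ∈ P.orthant := ⟨fun s => mul_nonneg hr0.le (hwo.1 s), fun l =>
    mul_nonneg (sq_nonneg r) (hwo.2 l)⟩
  have hr2 : r ^ 2 < 1 := by nlinarith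
  have hxw1 : ∀ s, (P.toEta x).1 s = r ^ 2 * (P.toEta w).1 s := fun s => by
    simp only [hx, toEta]; ring
  have hxw2 : ∀ l, (P.toEta x).2 l = r ^ 2 * (P.toEta w).2 l := fun l => rfl
  have hwe := toEta_mem_orthant hwo
  refine ⟨x, hxo, fun φ => (hr φ).trans_le ?_, fun m => ?_, fun l => ?_⟩
  · have hsig : P.sig φ x = r * P.sig φ w := by
      cases φ with
      | inl k =>
        simp only [sig, hx, Finset.mul_sum]
        exact Finset.sum_congr rfl fun s _ => by ring
      | inr l =>
        simp only [sig, hx]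
        rw [mul_left_comm, Real.sqrt_mul (sq_nonneg r), Real.sqrt_sq hr0.le]
    have hden : P.den φ (P.toEta x) ≤ P.den φ (P.toEta w) := by
      rw [den_eq, den_eq]
      refine affForm_mono (P.denS_nonneg φ) (P.denT_nonneg φ) _ (fun s => ?_) fun l => ?_
      · rw [hxw1]; exact mul_le_of_le_one_left (hwe.1 s) hr2.le
      · rw [hxw2]; exact mul_le_of_le_one_left (hwe.2 l) hr2.le
    have := hP.den_pos φ (toEta_mem_orthant hxo)
    unfold sinr
    rw [hsig, mul_pow, mul_div_assoc]
    gcongr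
  · have h1 : P.apLoad m (P.toEta x) = r ^ 2 * P.apLoad m (P.toEta w) := by
      simp only [apLoad, hxw1, Finset.mul_sum]
      exact Finset.sum_congr rfl fun s _ => by ring
    have h2 : P.apLoad m (P.toEta w) ≤ 1 / P.Nt := by
      rw [hwy]; exact sub_nonneg.1 (hy (.inr (.inl m)))
    have h3 : (0 : ℝ) < 1 / P.Nt := one_div_pos.2 P.Nt_cast_pos
    rw [h1]
    nlinarith [mul_le_mul_of_nonneg_left h2 (sq_nonneg r)]
  · have h1 : y.2 l ≤ 1 := sub_nonneg.1 (hy (.inr (.inr (.inr (.inr l)))))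
    show r ^ 2 * y.2 l < 1
    nlinarith [hy2 l]

/-! ### The concave surrogates, with the slack variables eliminated -/

variable (P)

/-- Lower bound of the SINR; `b` is the quotient `λ / ζ` of the point of linearization. -/
def surSinr (φ : P.UE) (b : ℝ) (x : P.PowerVec) : ℝ :=
  (2 * b * P.sig φ x - P.den φ (P.toEta x)) / b ^ 2

def surRate (φ : P.UE) (b : ℝ) (x : P.PowerVec) : ℝ := P.rate (P.surSinr φ b x)

/-- Lower bound of the energy efficiency; `α` is the quotient `Ψ / f` of the point of
linearization. -/
def surEE (φ : P.UE) (b α : ℝ) (x : P.PowerVec) : ℝ :=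
  (2 * α * √(P.surRate φ b x) - P.pow φ (P.toEta x)) / α ^ 2

/-- The best slack variables of a UE for given powers. -/
def bestSlack (φ : P.UE) (b α : ℝ) (x : P.PowerVec) : UEVars :=
  ⟨P.surEE φ b α x, √(P.surRate φ b x), P.surSinr φ b x, P.sig φ x⟩

/-- The powers that a UE can combine with some slack variables. -/
def surSet (φ : P.UE) (b : ℝ) : Set P.PowerVec :=
  {x | P.PowerFeasible x ∧ P.minSinr φ ≤ P.surSinr φ b x}

/-- A domain on which the surrogates are concave. -/
def surDom (φ : P.UE) (b : ℝ) : Set P.PowerVec := {x ∈ P.orthant | 0 ≤ P.surSinr φ b x}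

variable {P}

theorem surSet_subset_surDom (φ : P.UE) (b : ℝ) : P.surSet φ b ⊆ P.surDom φ b :=
  fun _ hx => ⟨hx.1.mem_orthant, (minSinr_pos φ).le.trans hx.2⟩

/-- The linearized quotient is affine in `x₂` with negative slope, so the constraint is an upper
bound on `x₂`. The next lemma shows that this bound is attained. -/
theorem le_div_sq_of_le_taylorQuot {a₁ a₂ x₁ x₂ y : ℝ} (ha : 0 < a₁ / a₂)
    (h : y ≤ taylorQuot a₁ a₂ x₁ x₂) :
    x₂ ≤ (2 * (a₁ / a₂) * x₁ - y) / (a₁ / a₂) ^ 2 := by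
  rw [le_div_iff₀ (by positivity)]
  unfold taylorQuot at h
  linarith

theorem le_taylorQuot_div_sq {a₁ a₂ x₁ y : ℝ} (ha : 0 < a₁ / a₂) :
    y ≤ taylorQuot a₁ a₂ x₁ ((2 * (a₁ / a₂) * x₁ - y) / (a₁ / a₂) ^ 2) := by
  unfold taylorQuot
  rw [mul_div_cancel₀ _ (by positivity)]
  linarith

/-- Uniform form of the constraints of one UE. -/
theorem ueFeasible_iff {φ : P.UE} {a v : UEVars} {x : P.PowerVec} (hx : x ∈ P.orthant) :
    (P.UEFeasible φ a v x → v.lam ≤ P.sig φ x ∧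
      P.den φ (P.toEta x) ≤ taylorQuot a.lam a.zeta v.lam v.zeta ∧
      0 < 1 + v.zeta ∧ v.psi ^ 2 ≤ P.rate v.zeta ∧
      P.pow φ (P.toEta x) ≤ taylorQuot a.psi a.f v.psi v.f ∧ P.minSinr φ ≤ v.zeta) ∧
    (v.lam = P.sig φ x → P.den φ (P.toEta x) ≤ taylorQuot a.lam a.zeta v.lam v.zeta →
      0 < 1 + v.zeta → v.psi ^ 2 ≤ P.rate v.zeta →
      P.pow φ (P.toEta x) ≤ taylorQuot a.psi a.f v.psi v.f → P.minSinr φ ≤ v.zeta →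
      P.UEFeasible φ a v x) := by
  cases φ with
  | inl k =>
    constructor
    · rintro ⟨h1, -, h3, h4, h5, h6, h7⟩
      exact ⟨h1, h3, h4, h5, h6, (minSE_div_le_logb_iff (.inl k) h4).1 h7⟩
    · intro h1 h3 h4 h5 h6 h7
      refine ⟨h1.le, ?_, h3, h4, h5, h6, (minSE_div_le_logb_iff (.inl k) h4).2 h7⟩
      rw [h1]
      exact sig_nonneg _ hx
  | inr l =>
    constructor
    · rintro ⟨h1, h3, h4, h5, h6, h7⟩
      exact ⟨Real.le_sqrt_of_sq_le h1, h3, h4, h5, h6, (minSE_div_le_logb_iff (.inr l) h4).1 h7⟩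
    · intro h1 h3 h4 h5 h6 h7
      refine ⟨?_, h3, h4, h5, h6, (minSE_div_le_logb_iff (.inr l) h4).2 h7⟩
      have hA : 0 ≤ P.coefAu l := by
        have := P.rhoU_pos
        unfold coefAu
        positivity
      rw [h1, sig, Real.sq_sqrt (mul_nonneg hA (hx.2 l))]

theorem bestSlack_feasible {φ : P.UE} {a : UEVars} (hb : 0 < a.lam / a.zeta)
    (hα : 0 < a.psi / a.f) {x : P.PowerVec} (hx : x ∈ P.surSet φ (a.lam / a.zeta)) :
    P.UEFeasible φ a (P.bestSlack φ (a.lam / a.zeta) (a.psi / a.f) x) x := by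
  have h := (minSinr_pos φ).trans_le hx.2
  refine (ueFeasible_iff hx.1.mem_orthant).2 rfl (le_taylorQuot_div_sq hb) (by
    show 0 < 1 + P.surSinr φ (a.lam / a.zeta) x; linarith) ?_ (le_taylorQuot_div_sq hα) hx.2
  exact (Real.sq_sqrt (rate_nonneg h.le)).le

/-- The bounds on λ, ζ, Ψ and f form a monotone chain. If f attains its maximum, the chain is tight
backwards: Ψ enters with factor 2α > 0, rate and square root are strictly increasing in ζ, and λ
enters with factor 2b > 0. So the optimal slack variables are unique for given powers. -/
theorem UEFeasible.le_surEE {φ : P.UE} {a v : UEVars} (hb : 0 < a.lam / a.zeta)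
    (hα : 0 < a.psi / a.f) {x : P.PowerVec} (hx : P.PowerFeasible x)
    (hv : P.UEFeasible φ a v x) :
    x ∈ P.surSet φ (a.lam / a.zeta) ∧ v.f ≤ P.surEE φ (a.lam / a.zeta) (a.psi / a.f) x ∧
    (v.f = P.surEE φ (a.lam / a.zeta) (a.psi / a.f) x →
      v = P.bestSlack φ (a.lam / a.zeta) (a.psi / a.f) x) := by
  obtain ⟨h1, h2, h3, h4, h5, h6⟩ := (ueFeasible_iff hx.mem_orthant).1 hv
  set b := a.lam / a.zeta with hbdef
  set α := a.psi / a.f with hαdef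
  have k1 : v.zeta ≤ (2 * b * v.lam - P.den φ (P.toEta x)) / b ^ 2 :=
    le_div_sq_of_le_taylorQuot hb h2
  have k2 : (2 * b * v.lam - P.den φ (P.toEta x)) / b ^ 2 ≤ P.surSinr φ b x := by
    unfold surSinr
    gcongr
  have k3 : v.psi ≤ √(P.rate v.zeta) := Real.le_sqrt_of_sq_le h4
  have k4 : √(P.rate v.zeta) ≤ √(P.surRate φ b x) :=
    Real.sqrt_le_sqrt (rate_le_rate h3 (k1.trans k2))
  have k5 : v.f ≤ (2 * α * v.psi - P.pow φ (P.toEta x)) / α ^ 2 :=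
    le_div_sq_of_le_taylorQuot hα h5
  have k6 : (2 * α * v.psi - P.pow φ (P.toEta x)) / α ^ 2 ≤ P.surEE φ b α x := by
    unfold surEE
    gcongr
    exact k3.trans k4
  refine ⟨⟨hx, h6.trans (k1.trans k2)⟩, k5.trans k6, fun h => ?_⟩
  have e1 : v.psi = √(P.surRate φ b x) := by
    have e := le_antisymm k6 (h ▸ k5)
    unfold surEE at e
    rw [div_left_inj' (by positivity)] at e
    have : α * (v.psi - √(P.surRate φ b x)) = 0 := by linarith
    rcases mul_eq_zero.1 this with h | h
    · exact absurd h hα.ne'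
    · linarith
  have hz : 0 < v.zeta := (minSinr_pos φ).trans_le h6
  have e2 : v.zeta = P.surSinr φ b x := by
    refine (k1.trans k2).antisymm (not_lt.1 fun hlt => ?_)
    have := rate_lt_rate (P := P) h3 hlt
    have := Real.sqrt_lt_sqrt (rate_nonneg hz.le) this
    rw [e1] at k3
    exact absurd k3 (not_le.2 this)
  have e3 : v.lam = P.sig φ x := by
    have e := le_antisymm k2 (e2 ▸ k1)
    unfold surSinr at e
    rw [div_left_inj' (by positivity)] at e
    have : b * (v.lam - P.sig φ x) = 0 := by linarith
    rcases mul_eq_zero.1 this with h | h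
    · exact absurd h hb.ne'
    · linarith
  have : v = ⟨v.f, v.psi, v.zeta, v.lam⟩ := rfl
  rw [this, h, e1, e2, e3]
  rfl

/-- After clearing denominators the gap is the square of b · signal − interference. -/
theorem surSinr_le_sinr {φ : P.UE} {b : ℝ} (hb : 0 < b) {x : P.PowerVec}
    (hden : 0 < P.den φ (P.toEta x)) : P.surSinr φ b x ≤ P.sinr φ x := by
  unfold surSinr sinr
  rw [div_le_div_iff₀ (by positivity) hden]
  nlinarith [sq_nonneg (b * P.sig φ x - P.den φ (P.toEta x))]

theorem concaveOn_surSinr (φ : P.UE) {b : ℝ} (hb : 0 < b) :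
    ConcaveOn ℝ P.orthant (P.surSinr φ b) := by
  have h1 := ((concaveOn_sig φ).smul (by positivity : 0 ≤ 2 * b)).sub
    ((convexOn_den_toEta φ).subset (Set.subset_univ _) convex_orthant)
  have h2 := h1.smul (by positivity : 0 ≤ (b ^ 2)⁻¹)
  refine h2.congr fun x _ => ?_
  simp only [surSinr, Pi.sub_apply, smul_eq_mul]
  ring

theorem convex_surDom (φ : P.UE) {b : ℝ} (hb : 0 < b) : Convex ℝ (P.surDom φ b) :=
  (concaveOn_surSinr φ hb).convex_ge 0

theorem concaveOn_surRate (φ : P.UE) {b : ℝ} (hb : 0 < b) :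
    ConcaveOn ℝ (P.surDom φ b) (P.surRate φ b) := by
  refine ⟨convex_surDom φ hb, fun x hx y hy t t' ht ht' htt => ?_⟩
  have h1 := (concaveOn_surSinr φ hb).2 hx.1 hy.1 ht ht' htt
  refine (concaveOn_rate.2 hx.2 hy.2 ht ht' htt).trans (rate_le_rate ?_ h1)
  have := hx.2
  have := hy.2
  simp only [smul_eq_mul]
  positivity

theorem concaveOn_sqrt_surRate (φ : P.UE) {b : ℝ} (hb : 0 < b) :
    ConcaveOn ℝ (P.surDom φ b) fun x => √(P.surRate φ b x) := by
  refine ⟨convex_surDom φ hb, fun x hx y hy t t' ht ht' htt => ?_⟩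
  have h1 := (concaveOn_surRate φ hb).2 hx hy ht ht' htt
  exact (Real.strictConcaveOn_sqrt.concaveOn.2 (rate_nonneg hx.2) (rate_nonneg hy.2) ht ht'
    htt).trans (Real.sqrt_le_sqrt h1)

theorem concaveOn_surEE (φ : P.UE) {b α : ℝ} (hb : 0 < b) (hα : 0 < α) :
    ConcaveOn ℝ (P.surDom φ b) (P.surEE φ b α) := by
  have h1 := ((concaveOn_sqrt_surRate φ hb).smul (by positivity : 0 ≤ 2 * α)).sub
    ((convexOn_pow_toEta φ).subset (Set.subset_univ _) (convex_surDom φ hb))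
  have h2 := h1.smul (by positivity : 0 ≤ (α ^ 2)⁻¹)
  refine h2.congr fun x _ => ?_
  simp only [surEE, Pi.sub_apply, smul_eq_mul]
  ring

theorem convex_surSet (φ : P.UE) {b : ℝ} (hb : 0 < b) : Convex ℝ (P.surSet φ b) := by
  intro x hx y hy t t' ht ht' htt
  exact ⟨convex_powerFeasible hx.1 hy.1 ht ht' htt,
    ((concaveOn_surSinr φ hb).convex_ge (P.minSinr φ) ⟨hx.1.mem_orthant, hx.2⟩
      ⟨hy.1.mem_orthant, hy.2⟩ ht ht' htt).2⟩

theorem continuous_surSinr (φ : P.UE) (b : ℝ) : Continuous (P.surSinr φ b) :=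
  ((continuous_const.mul (continuous_sig φ)).sub (continuous_den_toEta φ)).div_const _

theorem isCompact_surSet (φ : P.UE) (b : ℝ) : IsCompact (P.surSet φ b) :=
  isCompact_powerFeasible.inter_right (isClosed_le continuous_const (continuous_surSinr φ b))

variable (P)

/-! ### The surrogate problem: `P6` with the slack variables eliminated -/

def surFeas (b : P.UE → ℝ) : Set P.PowerVec :=
  {x | P.PowerFeasible x ∧ ∀ φ, P.minSinr φ ≤ P.surSinr φ (b φ) x}

def surObj (b α : P.UE → ℝ) (x : P.PowerVec) : ℝ :=
  ∑ φ, P.weight φ * P.surEE φ (b φ) (α φ) x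

def IsSurOpt (b α : P.UE → ℝ) (z : P.PowerVec) : Prop :=
  z ∈ P.surFeas b ∧ ∀ x ∈ P.surFeas b, P.surObj b α x ≤ P.surObj b α z

/-- Slater points of the surrogate problem. -/
def IsSlater (b : P.UE → ℝ) (x : P.PowerVec) : Prop :=
  x ∈ P.orthant ∧ (∀ φ, P.minSinr φ < P.surSinr φ (b φ) x) ∧
    (∀ m, P.apLoad m (P.toEta x) < 1 / P.Nt) ∧ ∀ l, x.2 l < 1

variable {P}

theorem IsSlater.mem_surFeas {b : P.UE → ℝ} {x : P.PowerVec} (hx : P.IsSlater b x) :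
    x ∈ P.surFeas b :=
  ⟨⟨fun m => (hx.2.2.1 m).le, hx.1.1, fun l => ⟨hx.1.2 l, (hx.2.2.2 l).le⟩⟩, fun φ =>
    (hx.2.1 φ).le⟩

theorem mem_surSet_of_mem_surFeas {b : P.UE → ℝ} {x : P.PowerVec} (hx : x ∈ P.surFeas b)
    (φ : P.UE) : x ∈ P.surSet φ (b φ) := ⟨hx.1, hx.2 φ⟩

theorem isCompact_surFeas (b : P.UE → ℝ) : IsCompact (P.surFeas b) := by
  have : P.surFeas b = {x | P.PowerFeasible x} ∩ ⋂ φ, {x | P.minSinr φ ≤ P.surSinr φ (b φ) x} := by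
    ext x; simp [surFeas]
  rw [this]
  exact isCompact_powerFeasible.inter_right (isClosed_iInter fun φ =>
    isClosed_le continuous_const (continuous_surSinr φ (b φ)))

theorem continuousAt_surRate (φ : P.UE) {b : ℝ} {x : P.PowerVec} (hx : 0 ≤ P.surSinr φ b x) :
    ContinuousAt (P.surRate φ b) x :=
  ContinuousAt.comp (f := P.surSinr φ b) (continuousAt_rate (by linarith))
    (continuous_surSinr φ b).continuousAt

theorem continuousAt_surEE (φ : P.UE) {b : ℝ} (α : ℝ) {x : P.PowerVec}
    (hx : 0 ≤ P.surSinr φ b x) : ContinuousAt (P.surEE φ b α) x :=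
  ((continuousAt_const.mul (continuousAt_surRate φ hx).sqrt).sub
    (continuous_pow_toEta φ).continuousAt).div_const _

theorem continuousOn_surObj (b α : P.UE → ℝ) : ContinuousOn (P.surObj b α) (P.surFeas b) :=
  fun _ hx => (tendsto_finsetSum _ fun φ _ => ((continuousAt_surEE φ (α φ)
    ((minSinr_pos φ).le.trans (hx.2 φ))).tendsto.const_mul _)).mono_left nhdsWithin_le_nhds

theorem exists_isSurOpt {b : P.UE → ℝ} (α : P.UE → ℝ) (hb : (P.surFeas b).Nonempty) :
    ∃ z, P.IsSurOpt b α z := by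
  obtain ⟨z, hz, hmax⟩ := (isCompact_surFeas b).exists_isMaxOn hb (continuousOn_surObj b α)
  exact ⟨z, hz, fun x hx => hmax hx⟩

theorem convex_surFeas {b : P.UE → ℝ} (hb : ∀ φ, 0 < b φ) : Convex ℝ (P.surFeas b) :=
  fun _ hx _ hy _ _ ht ht' htt => ⟨convex_powerFeasible hx.1 hy.1 ht ht' htt, fun φ =>
    (convex_surSet φ (hb φ) ⟨hx.1, hx.2 φ⟩ ⟨hy.1, hy.2 φ⟩ ht ht' htt).2⟩

/-- The domain asks only for nonnegative surrogate SINRs, which suffices for concavity of rate and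
square root. It is larger than `surFeas`, so that the quality-of-service and power limits can be
dualized on it. -/
theorem concaveOn_surObj {b α : P.UE → ℝ} (hb : ∀ φ, 0 < b φ) (hα : ∀ φ, 0 < α φ) :
    ConcaveOn ℝ {x ∈ P.orthant | ∀ φ, 0 ≤ P.surSinr φ (b φ) x} (P.surObj b α) := by
  have hC : Convex ℝ {x ∈ P.orthant | ∀ φ, 0 ≤ P.surSinr φ (b φ) x} :=
    fun x hx y hy t t' ht ht' htt => ⟨convex_orthant hx.1 hy.1 ht ht' htt, fun φ =>
      (convex_surDom φ (hb φ) ⟨hx.1, hx.2 φ⟩ ⟨hy.1, hy.2 φ⟩ ht ht' htt).2⟩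
  refine ⟨hC, fun x hx y hy t t' ht ht' htt => ?_⟩
  simp only [surObj, smul_eq_mul, Finset.mul_sum, ← Finset.sum_add_distrib]
  refine Finset.sum_le_sum fun φ _ => ?_
  have h := (concaveOn_surEE φ (hb φ) (hα φ)).2 ⟨hx.1, hx.2 φ⟩ ⟨hy.1, hy.2 φ⟩ ht ht' htt
  have := mul_le_mul_of_nonneg_left h (P.weight_pos φ).le
  simp only [smul_eq_mul] at this
  linarith

/-- Uniqueness of the optimum: the power terms are strictly convex in `C`, the uplink signals are
strictly concave in `Θ`. -/
theorem IsSurOpt.unique (hP : P.Covered) {b α : P.UE → ℝ} (hb : ∀ φ, 0 < b φ)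
    (hα : ∀ φ, 0 < α φ) {x y : P.PowerVec}
    (hx : P.IsSurOpt b α x) (hy : P.IsSurOpt b α y) : x = y := by
  have hxd : ∀ φ, x ∈ P.surDom φ (b φ) := fun φ =>
    surSet_subset_surDom φ _ (mem_surSet_of_mem_surFeas hx.1 φ)
  have hyd : ∀ φ, y ∈ P.surDom φ (b φ) := fun φ =>
    surSet_subset_surDom φ _ (mem_surSet_of_mem_surFeas hy.1 φ)
  have hxo := hx.1.1.mem_orthant
  have hyo := hy.1.1.mem_orthant
  have h2 : (0 : ℝ) ≤ 1 / 2 := by norm_num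
  have h3 : (1 / 2 : ℝ) + 1 / 2 = 1 := by norm_num
  set m : P.PowerVec := (1 / 2 : ℝ) • x + (1 / 2 : ℝ) • y with hm
  have hmf : m ∈ P.surFeas b := convex_surFeas hb hx.1 hy.1 h2 h2 h3
  have hle : ∀ φ, (P.surEE φ (b φ) (α φ) x + P.surEE φ (b φ) (α φ) y) / 2 ≤
      P.surEE φ (b φ) (α φ) m := fun φ => by
    have := (concaveOn_surEE φ (hb φ) (hα φ)).2 (hxd φ) (hyd φ) h2 h2 h3
    simp only [smul_eq_mul] at this
    linarith
  -- Were one UE strictly better at the midpoint, the midpoint would beat two optima, as no UE is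
  -- worse there and all weights are positive.
  have hnlt : ∀ φ, ¬ (P.surEE φ (b φ) (α φ) x + P.surEE φ (b φ) (α φ) y) / 2 <
      P.surEE φ (b φ) (α φ) m := by
    intro φ hφ
    have h1 : (P.surObj b α x + P.surObj b α y) / 2 < P.surObj b α m := by
      simp only [surObj, ← Finset.sum_add_distrib, Finset.sum_div]
      refine Finset.sum_lt_sum (fun ψ _ => ?_) ⟨φ, Finset.mem_univ φ, ?_⟩
      · nlinarith [mul_le_mul_of_nonneg_left (hle ψ) (P.weight_pos ψ).le]
      · nlinarith [mul_lt_mul_of_pos_left hφ (P.weight_pos φ)]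
    linarith [hx.2 m hmf, hy.2 m hmf, hx.2 y hy.1, hy.2 x hx.1]
  have hroot : ∀ φ, (√(P.surRate φ (b φ) x) + √(P.surRate φ (b φ) y)) / 2 ≤
      √(P.surRate φ (b φ) m) := fun φ => by
    have := (concaveOn_sqrt_surRate φ (hb φ)).2 (hxd φ) (hyd φ) h2 h2 h3
    simp only [smul_eq_mul] at this
    linarith
  have hpow : ∀ φ, P.pow φ (P.toEta m) ≤ (P.pow φ (P.toEta x) + P.pow φ (P.toEta y)) / 2 :=
    fun φ => by
    have := (convexOn_pow_toEta φ).2 (Set.mem_univ x) (Set.mem_univ y) h2 h2 h3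
    simp only [smul_eq_mul] at this
    linarith
  have hEE : ∀ φ, (√(P.surRate φ (b φ) x) + √(P.surRate φ (b φ) y)) / 2 <
      √(P.surRate φ (b φ) m) ∨
      P.pow φ (P.toEta m) < (P.pow φ (P.toEta x) + P.pow φ (P.toEta y)) / 2 → False := by
    intro φ h
    refine hnlt φ ?_
    unfold surEE
    rw [← add_div, div_div, mul_comm _ (2 : ℝ), ← div_div,
      div_lt_div_iff_of_pos_right (pow_pos (hα φ) 2)]
    have := hα φ
    rcases h with h | h
    · nlinarith [mul_lt_mul_of_pos_left h this, hpow φ]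
    · nlinarith [mul_le_mul_of_nonneg_left (hroot φ) this.le]
  refine Prod.ext (funext fun s => ?_) (funext fun l => ?_)
  · by_contra hne
    -- The power of the downlink UE of the pair `s` is strictly convex in the coordinate `s` of `C`.
    refine hEE (.inl s.1.2) (.inr ?_)
    rw [pow_eq, pow_eq, pow_eq]
    simp only [affForm, toEta, powT, Pi.zero_apply, zero_mul, Finset.sum_const_zero, add_zero]
    have h1 : ∀ s' : P.Served, P.powS (.inl s.1.2) s' * m.1 s' ^ 2 =
        (P.powS (.inl s.1.2) s' * x.1 s' ^ 2 + P.powS (.inl s.1.2) s' * y.1 s' ^ 2) / 2 -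
          P.powS (.inl s.1.2) s' * (x.1 s' - y.1 s') ^ 2 / 4 := fun s' => by
      simp only [hm, Prod.fst_add, Prod.smul_fst, Pi.add_apply, Pi.smul_apply, smul_eq_mul]
      ring
    have h4 : 0 < ∑ s', P.powS (.inl s.1.2) s' * (x.1 s' - y.1 s') ^ 2 / 4 := by
      refine Finset.sum_pos' (fun s' _ => ?_) ⟨s, Finset.mem_univ s, ?_⟩
      · exact div_nonneg (mul_nonneg (P.powS_nonneg _ _) (sq_nonneg _)) (by norm_num)
      · have := P.powS_own_pos s
        have : 0 < (x.1 s - y.1 s) ^ 2 := by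
          have := sub_ne_zero.2 hne
          positivity
        positivity
    simp only [h1, Finset.sum_sub_distrib, ← Finset.sum_div, Finset.sum_add_distrib]
    simp only [← Finset.sum_div] at h4
    linarith
  · by_contra hne
    -- The uplink power is affine in Θ, so the strictness has to come from the square root in the
    -- signal; it survives the increasing maps that lead to the root of the rate.
    refine hEE (.inr l) (.inl ?_)
    have hA := P.coefAu_pos (hP.u l)
    have hsig : (P.sig (.inr l) x + P.sig (.inr l) y) / 2 < P.sig (.inr l) m := by
      have := Real.strictConcaveOn_sqrt.2 (x := P.coefAu l * x.2 l) (y := P.coefAu l * y.2 l)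
        (Set.mem_Ici.2 (mul_nonneg hA.le (hxo.2 l))) (Set.mem_Ici.2 (mul_nonneg hA.le (hyo.2 l)))
        (fun h => hne (mul_left_cancel₀ hA.ne' h)) (by norm_num : (0 : ℝ) < 1 / 2)
        (by norm_num : (0 : ℝ) < 1 / 2) h3
      simp only [smul_eq_mul] at this
      have h4 : 1 / 2 * (P.coefAu l * x.2 l) + 1 / 2 * (P.coefAu l * y.2 l) =
          P.coefAu l * m.2 l := by
        simp only [hm, Prod.snd_add, Prod.smul_snd, Pi.add_apply, Pi.smul_apply, smul_eq_mul]
        ring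
      rw [h4] at this
      simp only [sig]
      linarith
    have hden := (convexOn_den_toEta (.inr l)).2 (Set.mem_univ x) (Set.mem_univ y) h2 h2 h3
    simp only [smul_eq_mul] at hden
    have hb' := hb (.inr l)
    have hs : (P.surSinr (.inr l) (b (.inr l)) x + P.surSinr (.inr l) (b (.inr l)) y) / 2 <
        P.surSinr (.inr l) (b (.inr l)) m := by
      unfold surSinr
      rw [← add_div, div_div, mul_comm _ (2 : ℝ), ← div_div,
        div_lt_div_iff_of_pos_right (pow_pos hb' 2)]
      nlinarith [mul_lt_mul_of_pos_left hsig hb']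
    have hsx := (hxd (.inr l)).2
    have hsy := (hyd (.inr l)).2
    have hr := concaveOn_rate (P := P) |>.2 (Set.mem_Ici.2 hsx) (Set.mem_Ici.2 hsy) h2 h2 h3
    have hr2 := rate_lt_rate (P := P) (by linarith) hs
    have hsq := Real.strictConcaveOn_sqrt.concaveOn.2 (rate_nonneg (P := P) hsx)
      (rate_nonneg (P := P) hsy) h2 h2 h3
    simp only [smul_eq_mul] at hr hsq
    have e : 1 / 2 * P.surSinr (.inr l) (b (.inr l)) x + 1 / 2 * P.surSinr (.inr l) (b (.inr l)) y
      = (P.surSinr (.inr l) (b (.inr l)) x + P.surSinr (.inr l) (b (.inr l)) y) / 2 := by ring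
    rw [e] at hr
    have hfin := Real.sqrt_lt_sqrt (by
      have := rate_nonneg (P := P) hsx
      have := rate_nonneg (P := P) hsy
      positivity) (hr.trans_lt hr2)
    simp only [surRate]
    linarith

/-! ### Lagrange multipliers of the surrogate problem -/

variable (P)

/-- The part of the Lagrangian that stems from the upper power limits. -/
def limitTerm (ν : Fin M → ℝ) (σ : Fin Ku → ℝ) (x : P.PowerVec) : ℝ :=
  ∑ m, ν m * (1 / P.Nt - P.apLoad m (P.toEta x)) + ∑ l, σ l * (1 - x.2 l)

/-- The part of the Lagrangian that belongs to one UE. -/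
def ueTerm (φ : P.UE) (b α μ : ℝ) (x : P.PowerVec) : ℝ :=
  P.weight φ * P.surEE φ b α x + μ * (P.surRate φ b x - P.minSE φ)

/-- Multipliers of the surrogate problem at `z`. -/
structure IsMultiplier (b α : P.UE → ℝ) (z : P.PowerVec) (μ : P.UE → ℝ) (ν : Fin M → ℝ)
    (σ : Fin Ku → ℝ) : Prop where
  mu_nonneg : ∀ φ, 0 ≤ μ φ
  nu_nonneg : ∀ m, 0 ≤ ν m
  sigma_nonneg : ∀ l, 0 ≤ σ l
  mu_compl : ∀ φ, μ φ * (P.surRate φ (b φ) z - P.minSE φ) = 0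
  nu_compl : ∀ m, ν m * (1 / P.Nt - P.apLoad m (P.toEta z)) = 0
  sigma_compl : ∀ l, σ l * (1 - z.2 l) = 0
  le : ∀ x ∈ P.orthant, (∀ φ, 0 ≤ P.surSinr φ (b φ) x) →
    ∑ φ, P.ueTerm φ (b φ) (α φ) (μ φ) x + P.limitTerm ν σ x ≤
      ∑ φ, P.ueTerm φ (b φ) (α φ) (μ φ) z + P.limitTerm ν σ z

variable {P}

/-- Nonnegativity of the powers stays in the domain and gets no multiplier. The quality of service
is dualized as a constraint on the rate, not on the SINR, so that its multiplier also serves for the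
constraint of `P2`. -/
theorem IsSurOpt.exists_isMultiplier {b α : P.UE → ℝ} (hb : ∀ φ, 0 < b φ) (hα : ∀ φ, 0 < α φ)
    {z x₁ : P.PowerVec} (hz : P.IsSurOpt b α z) (hx₁ : P.IsSlater b x₁) :
    ∃ μ ν σ, P.IsMultiplier b α z μ ν σ := by
  set C : Set P.PowerVec := {x ∈ P.orthant | ∀ φ, 0 ≤ P.surSinr φ (b φ) x} with hC
  have hobj := concaveOn_surObj hb hα
  rw [← hC] at hobj
  let g : P.UE ⊕ (Fin M ⊕ Fin Ku) → P.PowerVec → ℝ := Sum.elim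
    (fun φ x => P.surRate φ (b φ) x - P.minSE φ)
    (Sum.elim (fun m x => 1 / P.Nt - P.apLoad m (P.toEta x)) (fun l x => 1 - x.2 l))
  have hg : ∀ i, ConcaveOn ℝ C (g i) := by
    rintro (φ | m | l)
    · have := ((concaveOn_surRate φ (hb φ)).subset (fun x hx => ⟨hx.1, hx.2 φ⟩) hobj.1).add_const
        (-P.minSE φ)
      exact this
    · exact (concaveOn_const _ hobj.1).sub
        ((convexOn_apLoad_toEta m).subset (Set.subset_univ _) hobj.1)
    · refine ⟨hobj.1, fun x _ y _ t t' _ _ htt => le_of_eq ?_⟩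
      simp only [g, Sum.elim_inr, Prod.snd_add, Prod.smul_snd, Pi.add_apply, Pi.smul_apply,
        smul_eq_mul]
      linear_combination htt
  have hslater : ∀ i, 0 < g i x₁ := by
    rintro (φ | m | l)
    · have h1 := hx₁.2.1 φ
      have h2 := minSinr_pos φ
      exact sub_pos.2 ((minSE_lt_rate_iff φ (by linarith)).2 h1)
    · exact sub_pos.2 (hx₁.2.2.1 m)
    · exact sub_pos.2 (hx₁.2.2.2 l)
  have hv : ∀ x ∈ C, (∀ i, 0 ≤ g i x) → P.surObj b α x ≤ P.surObj b α z := by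
    intro x hx h
    refine hz.2 x ⟨⟨fun m => sub_nonneg.1 (h (.inr (.inl m))), hx.1.1, fun l => ⟨hx.1.2 l,
      sub_nonneg.1 (h (.inr (.inr l)))⟩⟩, fun φ => ?_⟩
    exact (minSE_le_rate_iff φ (by linarith [hx.2 φ])).1 (sub_nonneg.1 (h (.inl φ)))
  obtain ⟨μ, hμ, hle⟩ := exists_lagrange_multipliers hobj hg
    ⟨hx₁.1, fun φ => ((minSinr_pos φ).trans (hx₁.2.1 φ)).le⟩ hslater hv
  have hzC : z ∈ C := ⟨hz.1.1.mem_orthant, fun φ => (minSinr_pos φ).le.trans (hz.1.2 φ)⟩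
  have hgz : ∀ i, 0 ≤ g i z := by
    rintro (φ | m | l)
    · exact sub_nonneg.2 ((minSE_le_rate_iff φ (by linarith [hzC.2 φ])).2 (hz.1.2 φ))
    · exact sub_nonneg.2 (hz.1.1.1 m)
    · exact sub_nonneg.2 (hz.1.1.2.2 l).2
  have hcompl : ∀ i, μ i * g i z = 0 := by
    have h1 : ∑ i, μ i * g i z = 0 := le_antisymm (by linarith [hle z hzC])
      (Finset.sum_nonneg fun i _ => mul_nonneg (hμ i) (hgz i))
    intro i
    exact (Finset.sum_eq_zero_iff_of_nonneg fun i _ => mul_nonneg (hμ i) (hgz i)).1 h1 i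
      (Finset.mem_univ i)
  have hLag : ∀ x, ∑ φ, P.ueTerm φ (b φ) (α φ) (μ (.inl φ)) x +
      P.limitTerm (fun m => μ (.inr (.inl m))) (fun l => μ (.inr (.inr l))) x =
      P.surObj b α x + ∑ i, μ i * g i x := by
    intro x
    rw [Fintype.sum_sum_type fun i : P.UE ⊕ (Fin M ⊕ Fin Ku) => μ i * g i x,
      Fintype.sum_sum_type fun i : Fin M ⊕ Fin Ku => μ (.inr i) * g (.inr i) x]
    simp only [ueTerm, limitTerm, surObj, Finset.sum_add_distrib, g, Sum.elim_inl, Sum.elim_inr]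
    ring
  refine ⟨fun φ => μ (.inl φ), fun m => μ (.inr (.inl m)), fun l => μ (.inr (.inr l)),
    fun φ => hμ _, fun m => hμ _, fun l => hμ _, fun φ => hcompl (.inl φ),
    fun m => hcompl (.inr (.inl m)), fun l => hcompl (.inr (.inr l)), fun x hx hx' => ?_⟩
  rw [hLag, hLag, Finset.sum_eq_zero fun i _ => hcompl i, add_zero]
  exact hle x ⟨hx, hx'⟩

/-! ### The optimum has positive powers -/

theorem snd_pos_of_surSinr_pos (hP : P.Covered) {l : Fin Ku} {b : ℝ} (hb : 0 < b)
    {x : P.PowerVec} (hx : x ∈ P.orthant) (h : 0 < P.surSinr (.inr l) b x) : 0 < x.2 l := by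
  refine (hx.2 l).lt_of_ne fun h0 => ?_
  have h1 := hP.den_pos (.inr l) (toEta_mem_orthant hx)
  rw [surSinr, div_pos_iff_of_pos_right (by positivity)] at h
  have h2 : P.sig (.inr l) x = 0 := by simp [sig, ← h0]
  rw [h2] at h
  linarith

theorem affForm_toEta_add_single {a : P.Served → ℝ} {b : Fin Ku → ℝ} {c : ℝ} {z : P.PowerVec}
    {s : P.Served} (hs : z.1 s = 0) (t : ℝ) :
    P.affForm a b c (P.toEta (z + t • (Pi.single s 1, 0))) =
      P.affForm a b c (P.toEta z) + a s * t ^ 2 := by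
  have h : ∀ s', a s' * (z.1 s' + t * (Pi.single s 1 : P.Served → ℝ) s') ^ 2 =
      a s' * z.1 s' ^ 2 + if s' = s then a s * t ^ 2 else 0 := by
    intro s'
    by_cases hss : s' = s
    · subst hss; simp [hs]
    · simp [hss]
  simp only [affForm, toEta, Prod.fst_add, Prod.snd_add, Prod.smul_fst, Prod.smul_snd,
    Pi.add_apply, Pi.smul_apply, smul_eq_mul, h, smul_zero, add_zero, Finset.sum_add_distrib,
    Finset.sum_ite_eq', Finset.mem_univ, if_true]
  ring

theorem sig_add_single (φ : P.UE) (s : P.Served) : ∃ d, 0 ≤ d ∧ (φ = .inl s.1.2 → 0 < d) ∧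
    ∀ (z : P.PowerVec) (t : ℝ), P.sig φ (z + t • (Pi.single s 1, 0)) = P.sig φ z + t * d := by
  have hA := P.coefAd_pos s
  cases φ with
  | inl k =>
    refine ⟨if s.1.2 = k then P.coefAd s else 0, by split_ifs <;> positivity, fun h => ?_,
      fun z t => ?_⟩
    · rw [if_pos (Sum.inl_injective h).symm]; exact hA
    · simp only [sig, pairsOfUE, Prod.fst_add, Prod.smul_fst, Pi.add_apply, Pi.smul_apply,
        smul_eq_mul, mul_add, Finset.sum_add_distrib]
      congr 1
      rw [Finset.sum_filter]
      simp only [Pi.single_apply]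
      rw [Finset.sum_eq_single s]
      · rw [if_pos rfl, mul_one]; split_ifs <;> ring
      · intro s' _ hs'; simp [hs']
      · simp
  | inr l =>
    refine ⟨0, le_rfl, fun h => (by cases h), fun z t => ?_⟩
    simp [sig]

/-- Raising a vanishing coordinate of `C` is of first order in the signals, but of second order in
interference and power. -/
theorem hasDerivAt_ueTerm_add_single (φ : P.UE) {b α μ : ℝ} (hb : 0 < b) (hα : 0 < α)
    (hμ : 0 ≤ μ) {z : P.PowerVec} (hz : 0 < P.surSinr φ b z) {s : P.Served} (hs : z.1 s = 0) :
    ∃ d, 0 ≤ d ∧ (φ = .inl s.1.2 → 0 < d) ∧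
      HasDerivAt (fun t : ℝ => P.ueTerm φ b α μ (z + t • (Pi.single s 1, 0))) d 0 := by
  obtain ⟨d, hd, hd', hsig⟩ := sig_add_single φ s
  have h0 : z + (0 : ℝ) • ((Pi.single s 1, 0) : P.PowerVec) = z := by simp
  have hsq : HasDerivAt (fun t : ℝ => t ^ 2) 0 0 := by simpa using hasDerivAt_pow 2 (0 : ℝ)
  have hid : HasDerivAt (fun t : ℝ => t * d) d 0 := by simpa using (hasDerivAt_id (0 : ℝ)).mul_const d
  have h1 : HasDerivAt (fun t : ℝ => P.surSinr φ b (z + t • (Pi.single s 1, 0)))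
      (2 * b * d / b ^ 2) 0 := by
    simp only [surSinr, hsig, den_eq, affForm_toEta_add_single hs]
    have := (((hid.const_add (P.sig φ z)).const_mul (2 * b)).sub
      ((hsq.const_mul (P.denS φ s)).const_add (P.affForm (P.denS φ) (P.denT φ) (P.denC φ)
        (P.toEta z)))).div_const (b ^ 2)
    simpa using this
  have hz1 : 0 < 1 + P.surSinr φ b z := by linarith
  set r : ℝ := P.tauF * ((1 + P.surSinr φ b z)⁻¹ / Real.log 2) with hr
  have hr0 : 0 < r := by
    have := P.tauF_pos
    have := Real.log_pos one_lt_two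
    positivity
  have h2 : HasDerivAt (fun t : ℝ => P.surRate φ b (z + t • (Pi.single s 1, 0)))
      (r * (2 * b * d / b ^ 2)) 0 := by
    have h3 := hasDerivAt_rate (P := P) hz1
    rw [← hr] at h3
    exact HasDerivAt.comp (h₂ := P.rate) (h := fun t : ℝ => P.surSinr φ b
      (z + t • ((Pi.single s 1, 0) : P.PowerVec))) 0 (by rw [h0]; exact h3) h1
  have hR : 0 < P.surRate φ b z := rate_pos hz
  have h3 : HasDerivAt (fun t : ℝ => P.surEE φ b α (z + t • (Pi.single s 1, 0)))
      (2 * α * (r * (2 * b * d / b ^ 2) / (2 * √(P.surRate φ b z))) / α ^ 2) 0 := by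
    have h4 := h2.sqrt (by rw [h0]; exact hR.ne')
    rw [h0] at h4
    have := ((h4.const_mul (2 * α)).sub ((hsq.const_mul (P.powS φ s)).const_add
      (P.pow φ (P.toEta z)))).div_const (α ^ 2)
    simp only [mul_zero, sub_zero] at this
    refine this.congr_of_eventuallyEq (Eventually.of_forall fun t => ?_)
    simp only [surEE, pow_eq, affForm_toEta_add_single hs, Pi.sub_apply]
  have hw := P.weight_pos φ
  refine ⟨_, ?_, fun h => ?_, (h3.const_mul (P.weight φ)).add ((h2.sub_const _).const_mul μ)⟩
  · positivity
  · have := hd' h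
    have := Real.sqrt_pos.2 hR
    positivity

/-- If a coordinate of `C` vanished, the Lagrangian would have a positive right derivative in that
direction: the served UE gains to first order, no other UE loses to first order, and the limits
react only quadratically. -/
theorem IsMultiplier.fst_pos {b α : P.UE → ℝ} (hb : ∀ φ, 0 < b φ) (hα : ∀ φ, 0 < α φ)
    {z : P.PowerVec} (hz : z ∈ P.surFeas b) {μ : P.UE → ℝ} {ν : Fin M → ℝ} {σ : Fin Ku → ℝ}
    (h : P.IsMultiplier b α z μ ν σ) (s : P.Served) : 0 < z.1 s := by
  refine (hz.1.2.1 s).lt_of_ne fun h0 => ?_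
  have h0' : z.1 s = 0 := h0.symm
  have hz0 : ∀ φ, 0 < P.surSinr φ (b φ) z := fun φ => (minSinr_pos φ).trans_le (hz.2 φ)
  choose d hd hd' hder using fun φ =>
    hasDerivAt_ueTerm_add_single φ (hb φ) (hα φ) (h.mu_nonneg φ) (hz0 φ) h0'
  have hzz : z + (0 : ℝ) • ((Pi.single s 1, 0) : P.PowerVec) = z := by simp
  have hlim : HasDerivAt (fun t : ℝ => P.limitTerm ν σ (z + t • (Pi.single s 1, 0))) 0 0 := by
    have hsq : HasDerivAt (fun t : ℝ => t ^ 2) 0 0 := by simpa using hasDerivAt_pow 2 (0 : ℝ)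
    have h1 := (hsq.const_mul (-∑ m, ν m * P.loadS m s)).const_add (P.limitTerm ν σ z)
    rw [mul_zero] at h1
    refine h1.congr_of_eventuallyEq (Eventually.of_forall fun t => ?_)
    simp only [limitTerm, apLoad_eq, affForm_toEta_add_single h0', Prod.snd_add, Prod.smul_snd,
      smul_zero, add_zero, neg_mul, Finset.sum_mul, mul_sub, mul_add, Finset.sum_sub_distrib,
      Finset.sum_add_distrib, mul_assoc]
    ring
  have hL := (HasDerivAt.fun_sum (u := Finset.univ) fun φ _ => hder φ).add hlim
  rw [add_zero] at hL
  have hpos : 0 < ∑ φ, d φ := Finset.sum_pos' (fun φ _ => hd φ)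
    ⟨.inl s.1.2, Finset.mem_univ _, hd' _ rfl⟩
  have hcont : Tendsto (fun t : ℝ => z + t • ((Pi.single s 1, 0) : P.PowerVec)) (𝓝[>] 0) (𝓝 z) := by
    have : Continuous fun t : ℝ => z + t • ((Pi.single s 1, 0) : P.PowerVec) := by fun_prop
    simpa [hzz] using this.continuousWithinAt.tendsto (x := (0 : ℝ)) (s := Set.Ioi 0)
  have hS : ∀ᶠ t : ℝ in 𝓝[>] 0, ∀ φ,
      0 < P.surSinr φ (b φ) (z + t • ((Pi.single s 1, 0) : P.PowerVec)) :=
    eventually_all.2 fun φ => (((continuous_surSinr φ (b φ)).tendsto z).comp hcont).eventually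
      (lt_mem_nhds (hz0 φ))
  -- The ray stays in the domain of the Lagrangian for small t > 0, so maximality makes all these
  -- slopes nonpositive, against the positive derivative.
  have hle := hL.tendsto_slope_zero_right
  refine absurd (le_of_tendsto hle (b := 0) ?_) (not_le.2 hpos)
  filter_upwards [hS, self_mem_nhdsWithin] with t ht ht0
  have ht0' : 0 < t := ht0
  have h3 := h.le (z + t • ((Pi.single s 1, 0) : P.PowerVec)) ?_ fun φ => (ht φ).le
  · simp only [Pi.add_apply, hzz, zero_add, smul_eq_mul]
    exact mul_nonpos_of_nonneg_of_nonpos (inv_nonneg.2 ht0'.le) (by linarith)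
  · refine ⟨fun s' => ?_, fun l => ?_⟩
    · have h5 : (0 : ℝ) ≤ (Pi.single s 1 : P.Served → ℝ) s' := by
        simp only [Pi.single_apply]; split_ifs <;> norm_num
      exact add_nonneg (hz.1.2.1 s') (mul_nonneg ht0'.le h5)
    · simpa using (hz.1.2.2 l).1

/-! ### Differentiability and stationarity -/

theorem differentiableAt_sig (hP : P.Covered) (φ : P.UE) {z : P.PowerVec}
    (hz : ∀ l, 0 < z.2 l) : DifferentiableAt ℝ (P.sig φ) z := by
  cases φ with
  | inl k => simp only [sig]; fun_prop
  | inr l =>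
    have h : P.coefAu l * z.2 l ≠ 0 := (mul_pos (P.coefAu_pos (hP.u l)) (hz l)).ne'
    have h1 : DifferentiableAt ℝ (fun x : P.PowerVec => P.coefAu l * x.2 l) z := by fun_prop
    exact h1.sqrt h

theorem differentiable_den (φ : P.UE) : Differentiable ℝ (P.den φ) := by
  rw [show P.den φ = P.affForm _ _ _ from funext (P.den_eq φ)]
  exact differentiable_affForm _ _ _

theorem differentiable_pow (φ : P.UE) : Differentiable ℝ (P.pow φ) := by
  rw [show P.pow φ = P.affForm _ _ _ from funext (P.pow_eq φ)]
  exact differentiable_affForm _ _ _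

theorem differentiable_apLoad (m : Fin M) : Differentiable ℝ (P.apLoad m) := by
  rw [show P.apLoad m = P.affForm _ _ _ from funext (P.apLoad_eq m)]
  exact differentiable_affForm _ _ _

theorem differentiableAt_surRate (hP : P.Covered) (φ : P.UE) (b : ℝ) {z : P.PowerVec}
    (hz : ∀ l, 0 < z.2 l) (hs : 0 < P.surSinr φ b z) : DifferentiableAt ℝ (P.surRate φ b) z := by
  have hden : Differentiable ℝ fun x => P.den φ (P.toEta x) :=
    (differentiable_den φ).comp differentiable_toEta
  have h1 : DifferentiableAt ℝ (P.surSinr φ b) z := by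
    unfold surSinr
    simp only [div_eq_mul_inv]
    exact (((differentiableAt_sig hP φ hz).const_mul (2 * b)).fun_sub
      hden.differentiableAt).mul_const _
  exact (hasDerivAt_rate (by linarith)).differentiableAt.comp z h1

theorem differentiableAt_surEE (hP : P.Covered) (φ : P.UE) (b α : ℝ) {z : P.PowerVec}
    (hz : ∀ l, 0 < z.2 l) (hs : 0 < P.surSinr φ b z) : DifferentiableAt ℝ (P.surEE φ b α) z := by
  have hpow : Differentiable ℝ fun x => P.pow φ (P.toEta x) :=
    (differentiable_pow φ).comp differentiable_toEta
  unfold surEE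
  simp only [div_eq_mul_inv]
  exact ((((differentiableAt_surRate hP φ b hz hs).sqrt (rate_pos hs).ne').const_mul (2 * α)).fun_sub
      hpow.differentiableAt).mul_const _

theorem differentiableAt_ueTerm (hP : P.Covered) (φ : P.UE) (b α μ : ℝ) {z : P.PowerVec}
    (hz : ∀ l, 0 < z.2 l) (hs : 0 < P.surSinr φ b z) : DifferentiableAt ℝ (P.ueTerm φ b α μ) z :=
  ((differentiableAt_surEE hP φ b α hz hs).const_mul _).add
    (((differentiableAt_surRate hP φ b hz hs).sub_const _).const_mul _)

theorem differentiable_limitTerm (ν : Fin M → ℝ) (σ : Fin Ku → ℝ) :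
    Differentiable ℝ (P.limitTerm ν σ) := by
  have h : ∀ m, Differentiable ℝ fun x => P.apLoad m (P.toEta x) := fun m =>
    (differentiable_apLoad m).comp differentiable_toEta
  unfold limitTerm
  fun_prop

theorem concaveOn_ueTerm (φ : P.UE) {b α μ : ℝ} (hb : 0 < b) (hα : 0 < α) (hμ : 0 ≤ μ) :
    ConcaveOn ℝ (P.surDom φ b) (P.ueTerm φ b α μ) :=
  ((concaveOn_surEE φ hb hα).smul (P.weight_pos φ).le).add
    (((concaveOn_surRate φ hb).add_const (-P.minSE φ)).smul hμ)

theorem concaveOn_limitTerm {ν : Fin M → ℝ} (hν : ∀ m, 0 ≤ ν m) (σ : Fin Ku → ℝ) :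
    ConcaveOn ℝ Set.univ (P.limitTerm ν σ) := by
  refine ⟨convex_univ, fun x hx y hy t t' ht ht' htt => ?_⟩
  simp only [limitTerm, smul_eq_mul, mul_add, Finset.mul_sum]
  rw [add_add_add_comm, ← Finset.sum_add_distrib, ← Finset.sum_add_distrib]
  refine add_le_add (Finset.sum_le_sum fun m _ => ?_) (Finset.sum_le_sum fun l _ => le_of_eq ?_)
  · have h1 := (convexOn_apLoad_toEta m).2 hx hy ht ht' htt
    have h2 := mul_le_mul_of_nonneg_left h1 (hν m)
    simp only [smul_eq_mul] at h2
    have h3 : ν m * (1 / (P.Nt : ℝ)) = (t + t') * (ν m * (1 / (P.Nt : ℝ))) := by rw [htt, one_mul]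
    linarith
  · simp only [Prod.snd_add, Prod.smul_snd, Pi.add_apply, Pi.smul_apply, smul_eq_mul]
    linear_combination σ l * htt

/-- The Lagrangian has a local maximum at the optimum. -/
theorem IsMultiplier.isLocalMax (hP : P.Covered) {b α : P.UE → ℝ} (hb : ∀ φ, 0 < b φ)
    (hα : ∀ φ, 0 < α φ) {z : P.PowerVec} (hz : z ∈ P.surFeas b) {μ : P.UE → ℝ} {ν : Fin M → ℝ}
    {σ : Fin Ku → ℝ} (h : P.IsMultiplier b α z μ ν σ) :
    IsLocalMax (fun x => ∑ φ, P.ueTerm φ (b φ) (α φ) (μ φ) x + P.limitTerm ν σ x) z := by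
  have hz0 : ∀ φ, 0 < P.surSinr φ (b φ) z := fun φ => (minSinr_pos φ).trans_le (hz.2 φ)
  -- All the defining inequalities of the domain are strict at `z`, so the domain is a neighbourhood
  -- of `z`.
  have h1 : ∀ᶠ x in 𝓝 z, ∀ φ, 0 < P.surSinr φ (b φ) x := eventually_all.2 fun φ =>
    ((continuous_surSinr φ (b φ)).tendsto z).eventually (lt_mem_nhds (hz0 φ))
  have h2 : ∀ᶠ x : P.PowerVec in 𝓝 z, ∀ s, 0 < x.1 s := eventually_all.2 fun s =>
    ((by fun_prop : Continuous fun x : P.PowerVec => x.1 s).tendsto z).eventually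
      (lt_mem_nhds (h.fst_pos hb hα hz s))
  have h3 : ∀ᶠ x : P.PowerVec in 𝓝 z, ∀ l, 0 < x.2 l := eventually_all.2 fun l =>
    ((by fun_prop : Continuous fun x : P.PowerVec => x.2 l).tendsto z).eventually
      (lt_mem_nhds (snd_pos_of_surSinr_pos hP (hb _) hz.1.mem_orthant (hz0 (.inr l))))
  filter_upwards [h1, h2, h3] with x hx1 hx2 hx3
  exact h.le x ⟨fun s => (hx2 s).le, fun l => (hx3 l).le⟩ fun φ => (hx1 φ).le

/-- A saddle point of the consensus form of the surrogate problem. -/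
theorem IsMultiplier.exists_saddle [Nonempty P.UE] (hP : P.Covered) {b α : P.UE → ℝ}
    (hb : ∀ φ, 0 < b φ) (hα : ∀ φ, 0 < α φ) {z : P.PowerVec} (hz : z ∈ P.surFeas b)
    {μ : P.UE → ℝ} {ν : Fin M → ℝ} {σ : Fin Ku → ℝ} (h : P.IsMultiplier b α z μ ν σ) :
    ∃ d : P.UE → P.PowerVec →ₗ[ℝ] ℝ, ∑ φ, d φ = 0 ∧ ∀ φ, ∀ x ∈ P.surSet φ (b φ),
      P.weight φ * P.surEE φ (b φ) (α φ) x ≤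
        P.weight φ * P.surEE φ (b φ) (α φ) z + d φ (x - z) := by
  have hz0 : ∀ φ, 0 < P.surSinr φ (b φ) z := fun φ => (minSinr_pos φ).trans_le (hz.2 φ)
  have hz2 : ∀ l, 0 < z.2 l := fun l =>
    snd_pos_of_surSinr_pos hP (hb _) hz.1.mem_orthant (hz0 (.inr l))
  have hD := fun φ => (differentiableAt_ueTerm hP φ (b φ) (α φ) (μ φ) hz2 (hz0 φ)).hasFDerivAt
  have hR := (differentiable_limitTerm (P := P) ν σ z).hasFDerivAt
  set D : P.UE → P.PowerVec →L[ℝ] ℝ := fun φ => fderiv ℝ (P.ueTerm φ (b φ) (α φ) (μ φ)) z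
  set R : P.PowerVec →L[ℝ] ℝ := fderiv ℝ (P.limitTerm ν σ) z
  have hsum : ∑ φ, D φ + R = 0 := (h.isLocalMax hP hb hα hz).hasFDerivAt_eq_zero
    ((HasFDerivAt.fun_sum (u := Finset.univ) fun φ _ => hD φ).add hR)
  have hK : (0 : ℝ) < Fintype.card P.UE := by exact_mod_cast Fintype.card_pos
  -- Each UE gets the gradient of its own term and an equal share of the gradient of the common
  -- limit term. The total is the gradient of the Lagrangian, which vanishes at its local maximum.
  refine ⟨fun φ => ((D φ + (Fintype.card P.UE : ℝ)⁻¹ • R : P.PowerVec →L[ℝ] ℝ) :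
    P.PowerVec →ₗ[ℝ] ℝ), ?_, fun φ x hx => ?_⟩
  · refine LinearMap.ext fun x => ?_
    have h1 := congrArg (fun L : P.PowerVec →L[ℝ] ℝ => L x) hsum
    simp only [LinearMap.sum_apply, ContinuousLinearMap.coe_coe, add_apply,
      smul_apply, sum_apply, Finset.sum_add_distrib,
      Finset.sum_const, Finset.card_univ, nsmul_eq_mul, smul_eq_mul,
      zero_apply, LinearMap.zero_apply] at h1 ⊢
    rw [mul_inv_cancel_left₀ hK.ne']
    exact h1
  · have h1 := (concaveOn_ueTerm φ (hb φ) (hα φ) (h.mu_nonneg φ)).le_add_fderiv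
      (surSet_subset_surDom φ _ ⟨hz.1, hz.2 φ⟩) (surSet_subset_surDom φ _ hx) (hD φ)
    have h2 := (concaveOn_limitTerm h.nu_nonneg σ).le_add_fderiv (Set.mem_univ z)
      (Set.mem_univ x) hR
    -- By complementary slackness the limit term is 0 at `z`, and it is nonnegative at feasible
    -- points; so concavity makes its gradient nonnegative in the direction `x - z`. The
    -- quality-of-service term is treated alike.
    have h3 : P.limitTerm ν σ z = 0 := by
      simp only [limitTerm, h.nu_compl, h.sigma_compl, Finset.sum_const_zero, add_zero]
    have h4 : 0 ≤ P.limitTerm ν σ x := add_nonneg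
      (Finset.sum_nonneg fun m _ => mul_nonneg (h.nu_nonneg m) (sub_nonneg.2 (hx.1.1 m)))
      (Finset.sum_nonneg fun l _ => mul_nonneg (h.sigma_nonneg l)
        (sub_nonneg.2 (hx.1.2.2 l).2))
    have h5 : 0 ≤ μ φ * (P.surRate φ (b φ) x - P.minSE φ) := by
      refine mul_nonneg (h.mu_nonneg φ) (sub_nonneg.2 ((minSE_le_rate_iff φ ?_).2 hx.2))
      linarith [minSinr_pos φ, hx.2]
    have h6 := h.mu_compl φ
    have h7 : 0 ≤ (Fintype.card P.UE : ℝ)⁻¹ * R (x - z) :=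
      mul_nonneg (inv_nonneg.2 hK.le) (by linarith)
    simp only [ueTerm] at h1
    simp only [ContinuousLinearMap.coe_coe, add_apply,
      smul_apply, smul_eq_mul]
    linarith

variable (P)

/-! ### Points of linearization -/

/-- Feasibility for `P2` in terms of `(C, Θ)`. -/
def Admissible (x : P.PowerVec) : Prop :=
  P.PowerFeasible x ∧ ∀ φ, P.minSinr φ ≤ P.sinr φ x

/-- At admissible points this is interference over signal, the value of `b` for which the square in
`surSinr_le_sinr` vanishes. -/
def ancB (x : P.PowerVec) (φ : P.UE) : ℝ := (P.tight x φ).lam / (P.tight x φ).zeta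

/-- At admissible points this is power over the root of the rate, for which the minorant of the
energy efficiency touches. -/
def ancA (x : P.PowerVec) (φ : P.UE) : ℝ := (P.tight x φ).psi / (P.tight x φ).f

def ee (φ : P.UE) (x : P.PowerVec) : ℝ := P.rate (P.sinr φ x) / P.pow φ (P.toEta x)

variable {P}

theorem tight_eq (x : P.PowerVec) (φ : P.UE) :
    P.tight x φ = ⟨√(P.rate (P.sinr φ x)) ^ 2 / P.pow φ (P.toEta x), √(P.rate (P.sinr φ x)),
      P.sinr φ x, P.sig φ x⟩ := by
  cases φ <;> rfl

theorem wsee_toEta {x : P.PowerVec} (hx : x ∈ P.orthant) :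
    P.wsee (P.toEta x) = ∑ φ, P.weight φ * P.ee φ x := by
  rw [wsee_eq]
  exact Finset.sum_congr rfl fun φ _ => by rw [se_toEta φ hx, ee]

namespace Admissible

variable {x : P.PowerVec} (hx : P.Admissible x)
include hx

theorem sinr_pos (φ : P.UE) : 0 < P.sinr φ x := (minSinr_pos φ).trans_le (hx.2 φ)

theorem den_pos (hP : P.Covered) (φ : P.UE) : 0 < P.den φ (P.toEta x) :=
  hP.den_pos φ (toEta_mem_orthant hx.1.mem_orthant)

theorem pow_pos (φ : P.UE) : 0 < P.pow φ (P.toEta x) :=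
  pow_pos' φ (toEta_mem_orthant hx.1.mem_orthant)

theorem sig_pos (φ : P.UE) : 0 < P.sig φ x := by
  refine (sig_nonneg φ hx.1.mem_orthant).lt_of_ne fun h => ?_
  have := hx.sinr_pos φ
  rw [sinr, ← h] at this
  simp at this

theorem rate_pos (φ : P.UE) : 0 < P.rate (P.sinr φ x) := FDSystem.rate_pos (hx.sinr_pos φ)

theorem ancB_eq (φ : P.UE) : P.ancB x φ = P.den φ (P.toEta x) / P.sig φ x := by
  have := hx.sig_pos φ
  rw [ancB, tight_eq]
  simp only [sinr]
  field_simp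

theorem ancA_eq (φ : P.UE) : P.ancA x φ = P.pow φ (P.toEta x) / √(P.rate (P.sinr φ x)) := by
  have := Real.sqrt_pos.2 (hx.rate_pos φ)
  rw [ancA, tight_eq]
  field_simp

theorem ancB_pos (hP : P.Covered) (φ : P.UE) : 0 < P.ancB x φ := by
  rw [hx.ancB_eq]
  exact div_pos (hx.den_pos hP φ) (hx.sig_pos φ)

theorem ancA_pos (φ : P.UE) : 0 < P.ancA x φ := by
  rw [hx.ancA_eq]
  exact div_pos (hx.pow_pos φ) (Real.sqrt_pos.2 (hx.rate_pos φ))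

theorem surSinr_self (hP : P.Covered) (φ : P.UE) : P.surSinr φ (P.ancB x φ) x = P.sinr φ x := by
  have := hx.sig_pos φ
  have := hx.den_pos hP φ
  rw [hx.ancB_eq, surSinr, sinr]
  field_simp
  ring

theorem surEE_self (hP : P.Covered) (φ : P.UE) :
    P.surEE φ (P.ancB x φ) (P.ancA x φ) x = P.ee φ x := by
  have h1 := Real.sqrt_pos.2 (hx.rate_pos φ)
  have h2 := hx.pow_pos φ
  have h3 := Real.sq_sqrt (hx.rate_pos φ).le
  rw [surEE, surRate, hx.surSinr_self hP, hx.ancA_eq, ee]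
  generalize √(P.rate (P.sinr φ x)) = r at *
  rw [← h3]
  field_simp
  ring

theorem mem_surFeas (hP : P.Covered) : x ∈ P.surFeas (P.ancB x) :=
  ⟨hx.1, fun φ => by rw [hx.surSinr_self hP]; exact hx.2 φ⟩

theorem surObj_self (hP : P.Covered) : P.surObj (P.ancB x) (P.ancA x) x = P.wsee (P.toEta x) := by
  rw [wsee_toEta hx.1.mem_orthant]
  exact Finset.sum_congr rfl fun φ _ => by rw [hx.surEE_self hP]

end Admissible

theorem surRate_le_rate (hP : P.Covered) (φ : P.UE) {b : ℝ} (hb : 0 < b) {x : P.PowerVec}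
    (hx : x ∈ P.surDom φ b) : P.surRate φ b x ≤ P.rate (P.sinr φ x) :=
  rate_le_rate (by linarith [hx.2]) (surSinr_le_sinr hb (hP.den_pos φ (toEta_mem_orthant hx.1)))

/-- The same completion of a square as for the SINR, with α√rate and power in place of b · signal
and interference, once the surrogate rate is replaced by the true one. -/
theorem surEE_le_ee (hP : P.Covered) (φ : P.UE) {b α : ℝ} (hb : 0 < b) (hα : 0 < α)
    {x : P.PowerVec} (hx : x ∈ P.surDom φ b) : P.surEE φ b α x ≤ P.ee φ x := by
  have hp := pow_pos' φ (toEta_mem_orthant hx.1)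
  have h1 := surRate_le_rate hP φ hb hx
  have h2 := rate_nonneg (P := P) (hP.sinr_nonneg φ hx.1)
  have h3 := Real.sq_sqrt h2
  have h4 := Real.sqrt_le_sqrt h1
  unfold surEE ee
  rw [div_le_div_iff₀ (by positivity) hp, ← h3]
  generalize √(P.rate (P.sinr φ x)) = r at *
  generalize √(P.surRate φ b x) = r' at *
  have h5 : α * r' * P.pow φ (P.toEta x) ≤ α * r * P.pow φ (P.toEta x) := by gcongr
  nlinarith [sq_nonneg (α * r - P.pow φ (P.toEta x))]

/-- The surrogate constraints are an inner approximation, so the iterates never leave the feasible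
set of `P2`. -/
theorem admissible_of_mem_surFeas (hP : P.Covered) {b : P.UE → ℝ} (hb : ∀ φ, 0 < b φ)
    {x : P.PowerVec} (hx : x ∈ P.surFeas b) : P.Admissible x :=
  ⟨hx.1, fun φ => (hx.2 φ).trans
    (surSinr_le_sinr (hb φ) (hP.den_pos φ (toEta_mem_orthant hx.1.mem_orthant)))⟩

theorem surObj_le_wsee (hP : P.Covered) {b α : P.UE → ℝ} (hb : ∀ φ, 0 < b φ)
    (hα : ∀ φ, 0 < α φ) {x : P.PowerVec} (hx : x ∈ P.surFeas b) :
    P.surObj b α x ≤ P.wsee (P.toEta x) := by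
  rw [wsee_toEta hx.1.mem_orthant]
  exact Finset.sum_le_sum fun φ _ => mul_le_mul_of_nonneg_left (surEE_le_ee hP φ (hb φ) (hα φ)
    (surSet_subset_surDom φ _ (mem_surSet_of_mem_surFeas hx φ))) (P.weight_pos φ).le

/-! ### Slater's condition for the surrogate problem -/

/-- Convex combination in the coordinates `(C, √Θ)`. -/
def rootMix (ε : ℝ) (x y : P.PowerVec) : P.PowerVec :=
  (fun s => (1 - ε) * x.1 s + ε * y.1 s, fun l => ((1 - ε) * √(x.2 l) + ε * √(y.2 l)) ^ 2)

/-- Young's inequality for the mixed term. The parameter κ is free so that, summed over many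
coordinates, it can reproduce a Minkowski inequality. -/
theorem mix_sq_le {ε κ : ℝ} (hε : 0 ≤ ε) (hε1 : ε ≤ 1) (hκ : 0 < κ) (p q : ℝ) :
    ((1 - ε) * p + ε * q) ^ 2 ≤ ((1 - ε) ^ 2 + ε * (1 - ε) * κ) * p ^ 2 +
      (ε ^ 2 + ε * (1 - ε) / κ) * q ^ 2 := by
  have h1 : 2 * p * q ≤ κ * p ^ 2 + q ^ 2 / κ := by
    have : κ * p ^ 2 + q ^ 2 / κ - 2 * p * q = (κ * p - q) ^ 2 / κ := by field_simp; ring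
    have h2 : 0 ≤ (κ * p - q) ^ 2 / κ := by positivity
    linarith
  have h2 := mul_le_mul_of_nonneg_left h1 (mul_nonneg hε (sub_nonneg.2 hε1))
  have h3 : ε * (1 - ε) / κ * q ^ 2 = ε * (1 - ε) * (q ^ 2 / κ) := by ring
  nlinarith

theorem affForm_rootMix_le {ε κ : ℝ} (hε : 0 ≤ ε) (hε1 : ε ≤ 1) (hκ : 0 < κ)
    {a : P.Served → ℝ} {b : Fin Ku → ℝ} {c : ℝ} (ha : ∀ s, 0 ≤ a s) (hb : ∀ l, 0 ≤ b l)
    (hc : 0 ≤ c) {x y : P.PowerVec} (hx : x ∈ P.orthant) (hy : y ∈ P.orthant) :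
    P.affForm a b c (P.toEta (rootMix ε x y)) ≤
      ((1 - ε) ^ 2 + ε * (1 - ε) * κ) * P.affForm a b c (P.toEta x) +
      (ε ^ 2 + ε * (1 - ε) / κ) * P.affForm a b c (P.toEta y) := by
  have h1 : 1 ≤ ((1 - ε) ^ 2 + ε * (1 - ε) * κ) + (ε ^ 2 + ε * (1 - ε) / κ) := by
    simpa using mix_sq_le hε hε1 hκ 1 1
  set A := (1 - ε) ^ 2 + ε * (1 - ε) * κ
  set B := ε ^ 2 + ε * (1 - ε) / κ
  have h2 : A * P.affForm a b c (P.toEta x) + B * P.affForm a b c (P.toEta y) =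
      P.affForm a b ((A + B) * c) (A • P.toEta x + B • P.toEta y) := by
    simp only [affForm, Prod.fst_add, Prod.smul_fst, Prod.snd_add, Prod.smul_snd, Pi.add_apply,
      Pi.smul_apply, smul_eq_mul, mul_add, Finset.sum_add_distrib, Finset.mul_sum,
      mul_left_comm _ A, mul_left_comm _ B]
    ring
  rw [h2]
  refine (affForm_mono ha hb c (y' := A • P.toEta x + B • P.toEta y) (fun s =>
    mix_sq_le hε hε1 hκ _ _) fun l => ?_).trans ?_
  · have := mix_sq_le hε hε1 hκ (√(x.2 l)) (√(y.2 l))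
    rw [Real.sq_sqrt (hx.2 l), Real.sq_sqrt (hy.2 l)] at this
    exact this
  · have : c ≤ (A + B) * c := le_mul_of_one_le_left hc h1
    unfold affForm
    linarith

theorem rootMix_mem_orthant {ε : ℝ} (hε : 0 ≤ ε) (hε1 : ε ≤ 1) {x y : P.PowerVec}
    (hx : x ∈ P.orthant) (hy : y ∈ P.orthant) : rootMix ε x y ∈ P.orthant :=
  ⟨fun s => add_nonneg (mul_nonneg (sub_nonneg.2 hε1) (hx.1 s)) (mul_nonneg hε (hy.1 s)),
    fun _ => sq_nonneg _⟩

theorem sig_rootMix (φ : P.UE) {ε : ℝ} (hε : 0 ≤ ε) (hε1 : ε ≤ 1) (x y : P.PowerVec) :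
    P.sig φ (rootMix ε x y) = (1 - ε) * P.sig φ x + ε * P.sig φ y := by
  cases φ with
  | inl k =>
    simp only [sig, rootMix, Finset.mul_sum, ← Finset.sum_add_distrib]
    exact Finset.sum_congr rfl fun s _ => by ring
  | inr l =>
    have hA : 0 ≤ P.coefAu l := by
      have := P.rhoU_pos
      unfold coefAu
      positivity
    have h1 : 0 ≤ (1 - ε) * √(x.2 l) + ε * √(y.2 l) :=
      add_nonneg (mul_nonneg (sub_nonneg.2 hε1) (Real.sqrt_nonneg _))
        (mul_nonneg hε (Real.sqrt_nonneg _))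
    simp only [sig, rootMix, Real.sqrt_mul hA, Real.sqrt_sq h1]
    ring

/-- The tangent of `λ² / γ` at a feasible point separates, to first order, in the direction of a
strictly feasible point. -/
theorem eventually_mix_lt {γ N N' L L' : ℝ} (hγ : 0 < γ) (hN : 0 < N) (hL : 0 < L) (hL' : 0 < L')
    (h : γ * N ^ 2 ≤ L ^ 2) (h' : γ * N' ^ 2 < L' ^ 2) :
    ∀ᶠ ε : ℝ in 𝓝[>] 0, (N ^ 2 / L) ^ 2 * γ <
      2 * (N ^ 2 / L) * ((1 - ε) * L + ε * L') - ((1 - ε) * N + ε * N') ^ 2 := by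
  -- A slack constraint stays slack for small ε by continuity. For a tight one both sides agree at ε
  -- = 0, and the sign of the term of first order in ε decides.
  rcases h.lt_or_eq with h | h
  · have hc : Continuous fun ε : ℝ =>
        2 * (N ^ 2 / L) * ((1 - ε) * L + ε * L') - ((1 - ε) * N + ε * N') ^ 2 := by fun_prop
    refine (hc.continuousWithinAt.tendsto (x := (0 : ℝ)) (s := Set.Ioi 0)).eventually
      (lt_mem_nhds ?_)
    have h1 : 2 * (N ^ 2 / L) * ((1 - 0) * L + 0 * L') - ((1 - 0) * N + 0 * N') ^ 2 = N ^ 2 := by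
      field_simp
      ring
    rw [h1, div_pow, div_mul_eq_mul_div, div_lt_iff₀ (by positivity)]
    have := mul_lt_mul_of_pos_left h (by positivity : 0 < N ^ 2)
    nlinarith
  · set g := √γ with hg
    have hg0 : 0 < g := Real.sqrt_pos.2 hγ
    have hgg : γ = g ^ 2 := (Real.sq_sqrt hγ.le).symm
    have hLg : L = g * N := by
      have : L ^ 2 = (g * N) ^ 2 := by rw [← h, hgg]; ring
      exact (sq_eq_sq₀ hL.le (by positivity)).1 this
    have hs : g * N' < L' := by
      refine lt_of_pow_lt_pow_left₀ 2 hL'.le ?_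
      rw [mul_pow, ← hgg]
      exact h'
    have hb : N ^ 2 / L = N / g := by rw [hLg]; field_simp
    have hlim : ∀ᶠ ε : ℝ in 𝓝[>] 0, ε * (N' - N) ^ 2 < 2 * N * (L' / g - N') := by
      have hc : Continuous fun ε : ℝ => ε * (N' - N) ^ 2 := by fun_prop
      refine (hc.continuousWithinAt.tendsto (x := (0 : ℝ)) (s := Set.Ioi 0)).eventually
        (gt_mem_nhds ?_)
      have : N' < L' / g := by rw [lt_div_iff₀ hg0]; linarith
      have : 0 < L' / g - N' := by linarith
      rw [zero_mul]
      positivity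
    filter_upwards [hlim, self_mem_nhdsWithin] with ε hε hε0
    have hε0' : 0 < ε := hε0
    -- With L = gN the zeroth-order terms cancel. The first-order coefficient is positive because
    -- the target point satisfies its constraint strictly, and it dominates the ε² term.
    have h1 : 2 * (N ^ 2 / L) * ((1 - ε) * L + ε * L') - ((1 - ε) * N + ε * N') ^ 2 -
        (N ^ 2 / L) ^ 2 * γ = ε * (2 * N * (L' / g - N') - ε * (N' - N) ^ 2) := by
      rw [hb, hLg, hgg]
      field_simp
      ring
    have h2 : 0 < ε * (2 * N * (L' / g - N') - ε * (N' - N) ^ 2) :=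
      mul_pos hε0' (by linarith)
    linarith

/-- The SINR constraint √γ · √den ≤ sig is of cone type in (C, √Θ), where `sig` is linear. So a
short step of `rootMix` towards a strictly feasible point improves all its linearizations
simultaneously, wherever `x` lies in the feasible set. -/
theorem Admissible.exists_isSlater (hP : P.Covered) {x y : P.PowerVec} (hx : P.Admissible x)
    (hy : y ∈ P.orthant) (hys : ∀ φ, P.minSinr φ < P.sinr φ y)
    (hyl : ∀ m, P.apLoad m (P.toEta y) < 1 / P.Nt) (hyt : ∀ l, y.2 l < 1) :
    ∃ w, P.IsSlater (P.ancB x) w := by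
  have hxo := hx.1.mem_orthant
  have hyd : ∀ φ, 0 < P.den φ (P.toEta y) := fun φ => hP.den_pos φ (toEta_mem_orthant hy)
  have hev : ∀ᶠ ε : ℝ in 𝓝[>] 0, ∀ φ,
      (√(P.den φ (P.toEta x)) ^ 2 / P.sig φ x) ^ 2 * P.minSinr φ <
      2 * (√(P.den φ (P.toEta x)) ^ 2 / P.sig φ x) * ((1 - ε) * P.sig φ x + ε * P.sig φ y) -
        ((1 - ε) * √(P.den φ (P.toEta x)) + ε * √(P.den φ (P.toEta y))) ^ 2 := by
    refine eventually_all.2 fun φ => eventually_mix_lt (minSinr_pos φ)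
      (Real.sqrt_pos.2 (hx.den_pos hP φ)) (hx.sig_pos φ) ?_ ?_ ?_
    · refine (sig_nonneg φ hy).lt_of_ne fun h => ?_
      have := (minSinr_pos φ).trans (hys φ)
      rw [sinr, ← h] at this
      simp at this
    · rw [Real.sq_sqrt (hx.den_pos hP φ).le]
      exact (le_div_iff₀ (hx.den_pos hP φ)).1 (hx.2 φ)
    · rw [Real.sq_sqrt (hyd φ).le]
      exact (lt_div_iff₀ (hyd φ)).1 (hys φ)
  obtain ⟨ε, hε, hε0, hε1⟩ := (hev.and (Ioo_mem_nhdsGT (zero_lt_one (α := ℝ)))).exists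
  refine ⟨rootMix ε x y, rootMix_mem_orthant hε0.le hε1.le hxo hy, fun φ => ?_, fun m => ?_,
    fun l => ?_⟩
  · have h := hε φ
    set N := √(P.den φ (P.toEta x)) with hN
    set N' := √(P.den φ (P.toEta y)) with hN'
    have hN0 : 0 < N := Real.sqrt_pos.2 (hx.den_pos hP φ)
    have hN'0 : 0 < N' := Real.sqrt_pos.2 (hyd φ)
    have hNx : P.den φ (P.toEta x) = N ^ 2 := (Real.sq_sqrt (hx.den_pos hP φ).le).symm
    have hNy : P.den φ (P.toEta y) = N' ^ 2 := (Real.sq_sqrt (hyd φ).le).symm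
    have hden : P.den φ (P.toEta (rootMix ε x y)) ≤ ((1 - ε) * N + ε * N') ^ 2 := by
      -- κ = N'/N is the optimal Young parameter: the bound becomes the perfect square ((1 - ε)N +
      -- εN')².
      have h1 := affForm_rootMix_le hε0.le hε1.le (div_pos hN'0 hN0) (P.denS_nonneg φ)
        (P.denT_nonneg φ) (hP.denC_pos φ).le hxo hy
      rw [← den_eq, ← den_eq, ← den_eq, hNx, hNy] at h1
      refine h1.trans (le_of_eq ?_)
      field_simp
      ring
    have hB := hx.ancB_pos hP φ
    rw [← hNx, ← hx.ancB_eq] at h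
    unfold surSinr
    rw [sig_rootMix φ hε0.le hε1.le, lt_div_iff₀ (by positivity)]
    linarith
  · have h1 := affForm_rootMix_le hε0.le hε1.le one_pos (P.loadS_nonneg m) (b := 0)
      (fun _ => le_rfl) (le_refl 0) hxo hy
    rw [← apLoad_eq, ← apLoad_eq, ← apLoad_eq] at h1
    have h2 := hx.1.1 m
    have h3 := mul_lt_mul_of_pos_left (hyl m) hε0
    have h4 := mul_le_mul_of_nonneg_left h2 (sub_nonneg.2 hε1.le)
    refine h1.trans_lt ?_
    rw [show (1 - ε) ^ 2 + ε * (1 - ε) * 1 = 1 - ε by ring,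
      show ε ^ 2 + ε * (1 - ε) / 1 = ε by ring]
    linarith
  · have h1 := mix_sq_le hε0.le hε1.le one_pos (√(x.2 l)) (√(y.2 l))
    rw [Real.sq_sqrt (hxo.2 l), Real.sq_sqrt (hy.2 l)] at h1
    refine h1.trans_lt ?_
    rw [show (1 - ε) ^ 2 + ε * (1 - ε) * 1 = 1 - ε by ring,
      show ε ^ 2 + ε * (1 - ε) / 1 = ε by ring]
    have h3 := mul_lt_mul_of_pos_left (hyt l) hε0
    have h4 := mul_le_mul_of_nonneg_left (hx.1.2.2 l).2 (sub_nonneg.2 hε1.le)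
    linarith

/-! ### Elimination of the slack variables from `P6`, `P7` and `P8` -/

section Slack

variable {x : P.PowerVec} (hP : P.Covered) (hx : P.Admissible x)
include hP hx

theorem mk_bestSlack_mem_localSet {φ : P.UE} {y : P.PowerVec} (hy : y ∈ P.surSet φ (P.ancB x φ)) :
    (⟨P.bestSlack φ (P.ancB x φ) (P.ancA x φ) y, y⟩ : P.LocalVars) ∈
      P.localSet (P.tight x) φ :=
  ⟨hy.1, bestSlack_feasible (hx.ancB_pos hP φ) (hx.ancA_pos φ) hy⟩

theorem le_surEE_of_mem_localSet {φ : P.UE} {Ω : P.LocalVars}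
    (hΩ : Ω ∈ P.localSet (P.tight x) φ) :
    Ω.pw ∈ P.surSet φ (P.ancB x φ) ∧ Ω.ue.f ≤ P.surEE φ (P.ancB x φ) (P.ancA x φ) Ω.pw ∧
    (Ω.ue.f = P.surEE φ (P.ancB x φ) (P.ancA x φ) Ω.pw →
      Ω.ue = P.bestSlack φ (P.ancB x φ) (P.ancA x φ) Ω.pw) :=
  UEFeasible.le_surEE (hx.ancB_pos hP φ) (hx.ancA_pos φ) hΩ.1 hΩ.2

theorem IsSurOpt.isOptimalP6 {z : P.PowerVec} (hz : P.IsSurOpt (P.ancB x) (P.ancA x) z) :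
    P.IsOptimalP6 (P.tight x) ⟨fun φ => P.bestSlack φ (P.ancB x φ) (P.ancA x φ) z, z⟩ := by
  refine ⟨⟨hz.1.1, fun φ => (mk_bestSlack_mem_localSet hP hx
    (mem_surSet_of_mem_surFeas hz.1 φ)).2⟩, fun v' hv' => ?_⟩
  have h := fun φ => le_surEE_of_mem_localSet hP hx
    (Ω := ⟨v'.ue φ, v'.pw⟩) (φ := φ) ⟨hv'.1, hv'.2 φ⟩
  exact (Finset.sum_le_sum fun φ _ => mul_le_mul_of_nonneg_left (h φ).2.1
    (P.weight_pos φ).le).trans (hz.2 _ ⟨hv'.1, fun φ => (h φ).1.2⟩)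

theorem IsSurOpt.isOptimalP7 {z : P.PowerVec} (hz : P.IsSurOpt (P.ancB x) (P.ancA x) z) :
    P.IsOptimalP7 (P.tight x) z
      (fun φ => ⟨P.bestSlack φ (P.ancB x φ) (P.ancA x φ) z, z⟩) := by
  refine ⟨fun φ => ⟨mk_bestSlack_mem_localSet hP hx (mem_surSet_of_mem_surFeas hz.1 φ), rfl⟩,
    fun z' Ω' hΩ' => ?_⟩
  rcases isEmpty_or_nonempty P.UE with hE | ⟨⟨φ₀⟩⟩
  · simp
  have h := fun φ => le_surEE_of_mem_localSet hP hx (hΩ' φ).1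
  simp only [(hΩ' _).2] at h
  exact (Finset.sum_le_sum fun φ _ => mul_le_mul_of_nonneg_left (h φ).2.1
    (P.weight_pos φ).le).trans (hz.2 _ ⟨(h φ₀).1.1, fun φ => (h φ).1.2⟩)

end Slack

/-! ### The weighted inner product of the ADMM -/

variable (P)

/-- The inner product on the power variables that is weighted with the penalties. -/
def penaltyForm (rC rT : ℝ) : P.PowerVec →ₗ[ℝ] P.PowerVec →ₗ[ℝ] ℝ :=
  LinearMap.mk₂ ℝ (fun u v => rC * ∑ s, u.1 s * v.1 s + rT * ∑ l, u.2 l * v.2 l)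
    (fun u u' v => by
      simp only [Prod.fst_add, Prod.snd_add, Pi.add_apply, add_mul, Finset.sum_add_distrib]; ring)
    (fun c u v => by
      simp only [Prod.smul_fst, Prod.smul_snd, Pi.smul_apply, smul_eq_mul, mul_assoc,
        ← Finset.mul_sum]; ring)
    (fun u v v' => by
      simp only [Prod.fst_add, Prod.snd_add, Pi.add_apply, mul_add, Finset.sum_add_distrib]; ring)
    (fun c u v => by
      simp only [Prod.smul_fst, Prod.smul_snd, Pi.smul_apply, smul_eq_mul, mul_left_comm _ c,
        ← Finset.mul_sum]; ring)

variable {P}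

theorem penaltyForm_apply (rC rT : ℝ) (u v : P.PowerVec) :
    P.penaltyForm rC rT u v = rC * ∑ s, u.1 s * v.1 s + rT * ∑ l, u.2 l * v.2 l := rfl

theorem penaltyForm_symm (rC rT : ℝ) (u v : P.PowerVec) :
    P.penaltyForm rC rT u v = P.penaltyForm rC rT v u := by
  simp only [penaltyForm_apply, mul_comm]

theorem norm_sq_le (v : P.PowerVec) : ‖v‖ ^ 2 ≤ ∑ s, v.1 s ^ 2 + ∑ l, v.2 l ^ 2 := by
  have h1 : 0 ≤ ∑ s, v.1 s ^ 2 := Finset.sum_nonneg fun s _ => sq_nonneg _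
  have h2 : 0 ≤ ∑ l, v.2 l ^ 2 := Finset.sum_nonneg fun l _ => sq_nonneg _
  rw [← Real.le_sqrt (norm_nonneg _) (by positivity), Prod.norm_def, max_le_iff,
    pi_norm_le_iff_of_nonneg (Real.sqrt_nonneg _), pi_norm_le_iff_of_nonneg (Real.sqrt_nonneg _)]
  refine ⟨fun s => Real.abs_le_sqrt ?_, fun l => Real.abs_le_sqrt ?_⟩
  · have := Finset.single_le_sum (f := fun s => v.1 s ^ 2) (fun s _ => sq_nonneg _)
      (Finset.mem_univ s)
    linarith
  · have := Finset.single_le_sum (f := fun l => v.2 l ^ 2) (fun s _ => sq_nonneg _)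
      (Finset.mem_univ l)
    linarith

theorem le_penaltyForm {rC rT : ℝ} (hC : 0 < rC) (hT : 0 < rT) (v : P.PowerVec) :
    min rC rT * ‖v‖ ^ 2 ≤ P.penaltyForm rC rT v v := by
  have h0 : 0 < min rC rT := lt_min hC hT
  have h1 : 0 ≤ ∑ s, v.1 s ^ 2 := Finset.sum_nonneg fun s _ => sq_nonneg _
  have h2 : 0 ≤ ∑ l, v.2 l ^ 2 := Finset.sum_nonneg fun l _ => sq_nonneg _
  have h3 := mul_le_mul_of_nonneg_left (norm_sq_le v) h0.le
  have h4 := mul_le_mul_of_nonneg_right (min_le_left rC rT) h1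
  have h5 := mul_le_mul_of_nonneg_right (min_le_right rC rT) h2
  simp only [penaltyForm_apply, ← sq]
  linarith

/-- Scaled form of a multiplier. -/
def scaled (rC rT : ℝ) (χ : P.PowerVec) : P.PowerVec :=
  (fun s => χ.1 s / rC, fun l => χ.2 l / rT)

/-- Scaled multipliers merge the two penalties into one inner product, so that the local problem is
a proximal step for it. -/
theorem localObj_eq (φ : P.UE) (χ z : P.PowerVec) {rC rT : ℝ} (hC : rC ≠ 0) (hT : rT ≠ 0)
    (Ω : P.LocalVars) :
    P.localObj φ χ z rC rT Ω = P.weight φ * Ω.ue.f -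
      P.penaltyForm rC rT (scaled rC rT χ) (Ω.pw - z) -
      P.penaltyForm rC rT (Ω.pw - z) (Ω.pw - z) / 2 := by
  have h1 : ∀ a b : ℝ, rC * (a / rC * b) = a * b := fun a b => by field_simp
  have h2 : ∀ a b : ℝ, rT * (a / rT * b) = a * b := fun a b => by field_simp
  simp only [localObj, penaltyForm_apply, scaled, Prod.fst_sub, Prod.snd_sub, Pi.sub_apply,
    Finset.mul_sum, h1, h2, add_div, Finset.sum_div]
  simp only [sq, div_mul_eq_mul_div]
  ring

/-! ### Existence of ADMM runs -/

/-- The local feasible set is not bounded, as f may be arbitrarily small. The maximum is taken over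
the compact set of powers with the best slack variables filled in. -/
theorem exists_local_max (hP : P.Covered) {x : P.PowerVec} (hx : P.Admissible x) (φ : P.UE)
    (χ z : P.PowerVec) (rC rT : ℝ) :
    ∃ Ω ∈ P.localSet (P.tight x) φ, ∀ Ω' ∈ P.localSet (P.tight x) φ,
      P.localObj φ χ z rC rT Ω' ≤ P.localObj φ χ z rC rT Ω := by
  have hcont : ContinuousOn (fun y => P.localObj φ χ z rC rT
      ⟨P.bestSlack φ (P.ancB x φ) (P.ancA x φ) y, y⟩) (P.surSet φ (P.ancB x φ)) := by
    intro y hy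
    have h := continuousAt_surEE φ (P.ancA x φ) (surSet_subset_surDom φ _ hy).2
    have : ContinuousAt (fun y => P.localObj φ χ z rC rT
      ⟨P.bestSlack φ (P.ancB x φ) (P.ancA x φ) y, y⟩) y := by
      simp only [localObj, bestSlack]
      fun_prop
    exact this.continuousWithinAt
  obtain ⟨y, hy, hmax⟩ := (isCompact_surSet φ (P.ancB x φ)).exists_isMaxOn
    ⟨x, mem_surSet_of_mem_surFeas (hx.mem_surFeas hP) φ⟩ hcont
  refine ⟨_, mk_bestSlack_mem_localSet hP hx hy, fun Ω' hΩ' => ?_⟩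
  obtain ⟨h1, h2, -⟩ := le_surEE_of_mem_localSet hP hx hΩ'
  refine le_trans ?_ (hmax h1)
  have := mul_le_mul_of_nonneg_left h2 (P.weight_pos φ).le
  simp only [localObj, bestSlack]
  linarith

theorem exists_isADMMRun (hP : P.Covered) (q : PenaltyParams) {x : P.PowerVec}
    (hx : P.Admissible x) : ∃ st, P.IsADMMRun q x st := by
  choose Ω hΩ hmax using fun φ χ z rC rT => exists_local_max hP hx φ χ z rC rT
  let next : P.ADMMState → P.ADMMState := fun st =>
    let loc : P.UE → P.LocalVars := fun φ => Ω φ (st.mult φ) st.glob st.rC st.rT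
    let mult : P.UE → P.PowerVec := fun φ =>
      (fun s => (st.mult φ).1 s + st.rC * ((loc φ).pw.1 s - st.glob.1 s),
        fun l => (st.mult φ).2 l + st.rT * ((loc φ).pw.2 l - st.glob.2 l))
    ⟨(fun s => 1 / ((Kd : ℝ) + (Ku : ℝ)) * ∑ φ, ((loc φ).pw.1 s + 1 / st.rC * (mult φ).1 s),
      fun l => 1 / ((Kd : ℝ) + (Ku : ℝ)) * ∑ φ, ((loc φ).pw.2 l + 1 / st.rT * (mult φ).2 l)),
      loc, mult, st.rC, st.rT⟩
  -- Constant penalties are an admissible run: the balancing phase may have length 0.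
  let st₀ : P.ADMMState := ⟨x, fun φ => ⟨P.tight x φ, x⟩, 0, 1, 1⟩
  refine ⟨fun p => next^[p] st₀, rfl, fun _ => rfl, one_pos, one_pos, fun p => ?_, 0,
    fun p hp => absurd hp (Nat.not_lt_zero p), fun p _ => ?_⟩
  · rw [Function.iterate_succ_apply']
    exact ⟨fun φ => ⟨hΩ _ _ _ _ _, hmax _ _ _ _ _⟩, fun _ _ => rfl, fun _ _ => rfl,
      fun _ => rfl, fun _ => rfl⟩
  · rw [Function.iterate_succ_apply']
    exact ⟨rfl, rfl⟩

/-! ### Convergence of ADMM runs -/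

theorem penaltyUpdate_pos (q : PenaltyParams) (st st' : P.ADMMState) {r : ℝ} (hr : 0 < r) :
    0 < P.penaltyUpdate q st st' r := by
  have h1 := q.incr_gt
  have h2 := q.decr_gt
  unfold penaltyUpdate
  split_ifs <;> positivity

theorem IsADMMRun.penalties_pos {q : PenaltyParams} {x : P.PowerVec} {st : ℕ → P.ADMMState}
    (h : P.IsADMMRun q x st) (p : ℕ) : 0 < (st p).rC ∧ 0 < (st p).rT := by
  obtain ⟨N, h1, h2⟩ := h.penalty
  induction p with
  | zero => exact ⟨h.rC_pos, h.rT_pos⟩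
  | succ p ih =>
    rcases lt_or_ge p N with hp | hp
    · rw [(h1 p hp).1, (h1 p hp).2]
      exact ⟨penaltyUpdate_pos q _ _ ih.1, penaltyUpdate_pos q _ _ ih.2⟩
    · rw [(h2 p hp).1, (h2 p hp).2]
      exact ih

/-- After a local update, the slack variables are the best ones for the local powers. -/
theorem ADMMStep.local_spec (hP : P.Covered) {x : P.PowerVec} (hx : P.Admissible x)
    {st st' : P.ADMMState} (h : P.ADMMStep (P.tight x) st st') (φ : P.UE) :
    (st'.loc φ).pw ∈ P.surSet φ (P.ancB x φ) ∧
    (st'.loc φ).ue = P.bestSlack φ (P.ancB x φ) (P.ancA x φ) (st'.loc φ).pw := by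
  obtain ⟨h1, h2⟩ := h.1 φ
  obtain ⟨h3, h4, h5⟩ := le_surEE_of_mem_localSet hP hx h1
  refine ⟨h3, h5 (le_antisymm h4 ?_)⟩
  have h6 := h2 _ (mk_bestSlack_mem_localSet hP hx h3)
  simp only [localObj, bestSlack] at h6
  exact le_of_mul_le_mul_left (by linarith) (P.weight_pos φ)

theorem ADMMStep.prox (hP : P.Covered) {x : P.PowerVec} (hx : P.Admissible x)
    {st st' : P.ADMMState} (h : P.ADMMStep (P.tight x) st st') (hC : st.rC ≠ 0) (hT : st.rT ≠ 0)
    (φ : P.UE) {y : P.PowerVec} (hy : y ∈ P.surSet φ (P.ancB x φ)) :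
    P.weight φ * P.surEE φ (P.ancB x φ) (P.ancA x φ) y ≤
      P.weight φ * P.surEE φ (P.ancB x φ) (P.ancA x φ) (st'.loc φ).pw +
      P.penaltyForm st.rC st.rT (scaled st.rC st.rT (st.mult φ) + ((st'.loc φ).pw - st.glob))
        (y - (st'.loc φ).pw) := by
  obtain ⟨h1, h2⟩ := h.local_spec hP hx φ
  have hcv : ConcaveOn ℝ (P.surSet φ (P.ancB x φ))
      (fun y => P.weight φ * P.surEE φ (P.ancB x φ) (P.ancA x φ) y) :=
    ((concaveOn_surEE φ (hx.ancB_pos hP φ) (hx.ancA_pos φ)).subset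
      (surSet_subset_surDom φ _) (convex_surSet φ (hx.ancB_pos hP φ))).smul (P.weight_pos φ).le
  refine le_add_of_isMax_prox (P.penaltyForm st.rC st.rT) (penaltyForm_symm _ _) hcv h1
    (fun w hw => ?_) hy
  have h6 := (h.1 φ).2 _ (mk_bestSlack_mem_localSet hP hx hw)
  rw [localObj_eq _ _ _ hC hT, localObj_eq _ _ _ hC hT, h2] at h6
  exact h6

theorem ADMMStep.scaled_mult {a : P.UE → UEVars} {st st' : P.ADMMState}
    (h : P.ADMMStep a st st') (hC : st.rC ≠ 0) (hT : st.rT ≠ 0) (φ : P.UE) :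
    scaled st.rC st.rT (st'.mult φ) =
      scaled st.rC st.rT (st.mult φ) + ((st'.loc φ).pw - st.glob) := by
  refine Prod.ext (funext fun s => ?_) (funext fun l => ?_)
  · simp only [scaled, h.2.1 φ s, Prod.fst_add, Prod.fst_sub, Pi.add_apply, Pi.sub_apply]
    field_simp
  · simp only [scaled, h.2.2.1 φ l, Prod.snd_add, Prod.snd_sub, Pi.add_apply, Pi.sub_apply]
    field_simp

/-- The global update is the mean of local powers plus scaled multipliers, so the deviations from it
cancel. This is the balance that the Fejér estimate needs. -/
theorem ADMMStep.sum_eq_zero {a : P.UE → UEVars} {st st' : P.ADMMState}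
    (h : P.ADMMStep a st st') :
    ∑ φ, (scaled st.rC st.rT (st'.mult φ) + ((st'.loc φ).pw - st'.glob)) = 0 := by
  rcases isEmpty_or_nonempty P.UE with hE | hE
  · simp
  have hcard : (Fintype.card P.UE : ℝ) = (Kd : ℝ) + Ku := by simp
  have hK : (0 : ℝ) < (Kd : ℝ) + Ku := by
    rw [← hcard]
    exact_mod_cast Fintype.card_pos
  have key : ∀ (g : ℝ) (r : ℝ) (m p : P.UE → ℝ),
      g = 1 / ((Kd : ℝ) + Ku) * ∑ φ, (p φ + 1 / r * m φ) → ∑ φ, (m φ / r + (p φ - g)) = 0 := by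
    intro g r m p hg
    have h1 : ((Kd : ℝ) + Ku) * g = ∑ φ, (p φ + 1 / r * m φ) := by
      rw [hg]; field_simp
    have h2 : ∑ φ, (m φ / r + (p φ - g)) = ∑ φ, (p φ + 1 / r * m φ) - ∑ _φ : P.UE, g := by
      rw [← Finset.sum_sub_distrib]
      exact Finset.sum_congr rfl fun φ _ => by ring
    rw [h2, Finset.sum_const, Finset.card_univ, nsmul_eq_mul, hcard, h1, sub_self]
  refine Prod.ext (funext fun s => ?_) (funext fun l => ?_)
  · simp only [Prod.fst_sum, Finset.sum_apply, Prod.fst_add, Prod.fst_sub, Pi.add_apply,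
      Pi.sub_apply, scaled, Prod.fst_zero, Pi.zero_apply]
    exact key _ _ _ _ (h.2.2.2.1 s)
  · simp only [Prod.snd_sum, Finset.sum_apply, Prod.snd_add, Prod.snd_sub, Pi.add_apply,
      Pi.sub_apply, scaled, Prod.snd_zero, Pi.zero_apply]
    exact key _ _ _ _ (h.2.2.2.2 l)

/-- The power variables of an ADMM run converge to the optimum of the surrogate problem. -/
theorem IsADMMRun.tendsto_powers (hP : P.Covered) {q : PenaltyParams} {x x₁ : P.PowerVec}
    (hx : P.Admissible x) (hx₁ : P.IsSlater (P.ancB x) x₁) {st : ℕ → P.ADMMState}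
    (h : P.IsADMMRun q x st) :
    ∃ z, P.IsSurOpt (P.ancB x) (P.ancA x) z ∧ Tendsto (fun p => (st p).glob) atTop (𝓝 z) ∧
      ∀ φ, Tendsto (fun p => ((st p).loc φ).pw) atTop (𝓝 z) := by
  have hb := hx.ancB_pos hP
  have hα := hx.ancA_pos
  obtain ⟨zs, hzs⟩ := exists_isSurOpt (P.ancA x) ⟨x, hx.mem_surFeas hP⟩
  rcases isEmpty_or_nonempty P.UE with hE | hE
  -- Without UEs there are no power variables and the global update has nothing to average;
  -- everything is trivially constant.
  · have hsub : Subsingleton P.PowerVec := ⟨fun y y' => Prod.ext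
      (funext fun s => hE.elim (.inl s.1.2)) (funext fun l => hE.elim (.inr l))⟩
    exact ⟨zs, hzs, tendsto_const_nhds.congr fun p => Subsingleton.elim _ _,
      fun φ => hE.elim φ⟩
  obtain ⟨μ, ν, σ, hmul⟩ := hzs.exists_isMultiplier hb hα hx₁
  obtain ⟨d, hd, hds⟩ := hmul.exists_saddle hP hb hα hzs.1
  obtain ⟨N, -, hN⟩ := h.penalty
  set rC := (st N).rC with hrC
  set rT := (st N).rT with hrT
  have hr : ∀ k, (st (k + N)).rC = rC ∧ (st (k + N)).rT = rT := by
    intro k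
    induction k with
    | zero => rw [zero_add]; exact ⟨rfl, rfl⟩
    | succ k ih =>
      rw [add_right_comm, (hN (k + N) (by omega)).1, (hN (k + N) (by omega)).2]
      exact ih
  have hC : 0 < rC := (h.penalties_pos N).1
  have hT : 0 < rT := (h.penalties_pos N).2
  have hstep : ∀ k, P.ADMMStep (P.tight x) (st (k + N)) (st (k + (N + 1))) := fun k => h.step _
  have hpC : ∀ k, (st (k + N)).rC ≠ 0 := fun k => by rw [(hr k).1]; exact hC.ne'
  have hpT : ∀ k, (st (k + N)).rT ≠ 0 := fun k => by rw [(hr k).2]; exact hT.ne'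
  -- The convergence result is applied from one step after the penalties have become constant: by
  -- then the local powers are proximal points, and multipliers and global variables are balanced,
  -- all with respect to the final penalties. The earlier history is just an arbitrary start.
  obtain ⟨z, hz1, hz2, hz3, hz4⟩ := admm_consensus_tendsto (P.penaltyForm rC rT)
    (penaltyForm_symm rC rT) (lt_min hC hT) (le_penaltyForm hC hT)
    (X := fun φ => P.surSet φ (P.ancB x φ)) (fun φ => (isCompact_surSet φ _).isClosed)
    (h := fun φ y => P.weight φ * P.surEE φ (P.ancB x φ) (P.ancA x φ) y)
    (fun φ y hy => ((continuousAt_surEE φ (P.ancA x φ)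
      (surSet_subset_surDom φ _ hy).2).const_mul _).continuousWithinAt)
    (z := fun k => (st (k + (N + 1))).glob) (x := fun k φ => ((st (k + (N + 1))).loc φ).pw)
    (u := fun k φ => scaled rC rT ((st (k + (N + 1))).mult φ))
    (fun k φ => ((hstep k).local_spec hP hx φ).1)
    (fun k φ y hy => by
      have h1 := (hstep k).prox hP hx (hpC k) (hpT k) φ hy
      rw [← (hstep k).scaled_mult (hpC k) (hpT k), (hr k).1, (hr k).2] at h1
      exact h1)
    (fun k φ => by
      have h1 := (hstep (k + 1)).scaled_mult (hpC (k + 1)) (hpT (k + 1)) φ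
      rw [(hr (k + 1)).1, (hr (k + 1)).2, show k + 1 + N = k + (N + 1) by ring] at h1
      exact h1)
    (fun k => by
      have h1 := (hstep k).sum_eq_zero
      rw [(hr k).1, (hr k).2] at h1
      exact h1)
    (mem_surSet_of_mem_surFeas hzs.1) hd hds
  refine ⟨z, ⟨⟨(hz1 (Classical.arbitrary _)).1, fun φ => (hz1 φ).2⟩, fun y hy =>
    hz2 y (mem_surSet_of_mem_surFeas hy)⟩, ?_, fun φ => ?_⟩
  · exact (tendsto_add_atTop_iff_nat (f := fun p => (st p).glob) (N + 1)).1 hz3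
  · exact (tendsto_add_atTop_iff_nat (f := fun p => ((st p).loc φ).pw) (N + 1)).1 (hz4 φ)

theorem continuous_distSq : Continuous fun w : P.PowerVec × P.PowerVec => P.distSq w.1 w.2 := by
  unfold distSq
  fun_prop

theorem distSq_self (x : P.PowerVec) : P.distSq x x = 0 := by simp [distSq]

/-- After the first step the slack variables are continuous functions of the local powers
(`ADMMStep.local_spec`), so convergence of the powers is enough. -/
theorem IsADMMRun.solves (hP : P.Covered) {q : PenaltyParams} {x x₁ : P.PowerVec}
    (hx : P.Admissible x) (hx₁ : P.IsSlater (P.ancB x) x₁) {st : ℕ → P.ADMMState}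
    (h : P.IsADMMRun q x st) :
    ∃ z, P.IsSurOpt (P.ancB x) (P.ancA x) z ∧ P.ADMMSolves (P.tight x) st z := by
  obtain ⟨z, hz, hglob, hloc⟩ := h.tendsto_powers hP hx hx₁
  have hdist : ∀ {u v : ℕ → P.PowerVec}, Tendsto u atTop (𝓝 z) → Tendsto v atTop (𝓝 z) →
      Tendsto (fun p => P.distSq (u p) (v p)) atTop (𝓝 0) := by
    intro u v hu hv
    have := (continuous_distSq.tendsto (z, z)).comp (hu.prodMk_nhds hv)
    rwa [distSq_self] at this
  refine ⟨z, hz, ?_, ?_, hglob, _, hz.isOptimalP6 hP hx, hz.isOptimalP7 hP hx, fun φ =>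
    ⟨hloc φ, ?_⟩⟩
  · have := (tendsto_finsetSum Finset.univ fun φ _ => hdist (hloc φ) hglob).sqrt
    rwa [Finset.sum_const_zero, Real.sqrt_zero] at this
  · have := ((hdist (hglob.comp (tendsto_add_atTop_nat 1)) hglob).const_mul
      ((Kd : ℝ) + (Ku : ℝ))).sqrt
    rwa [mul_zero, Real.sqrt_zero] at this
  · have hz0 : 0 ≤ P.surSinr φ (P.ancB x φ) z := (minSinr_pos φ).le.trans (hz.1.2 φ)
    have hue : ∀ᶠ p in atTop, ((st p).loc φ).ue =
        P.bestSlack φ (P.ancB x φ) (P.ancA x φ) ((st p).loc φ).pw := by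
      filter_upwards [eventually_ge_atTop 1] with p hp
      obtain ⟨k, rfl⟩ := Nat.exists_eq_add_of_le' hp
      exact ((h.step k).local_spec hP hx φ).2
    have hc : ∀ (g : UEVars → ℝ), ContinuousAt
        (fun y => g (P.bestSlack φ (P.ancB x φ) (P.ancA x φ) y)) z →
        Tendsto (fun p => g ((st p).loc φ).ue) atTop
          (𝓝 (g (P.bestSlack φ (P.ancB x φ) (P.ancA x φ) z))) := by
      intro g hg
      refine (hg.tendsto.comp (hloc φ)).congr' ?_
      filter_upwards [hue] with p hp
      simp only [Function.comp, hp]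
    exact ⟨hc UEVars.f (continuousAt_surEE φ _ hz0), hc UEVars.psi (continuousAt_surRate φ hz0).sqrt,
      hc UEVars.zeta (continuous_surSinr φ _).continuousAt,
      hc UEVars.lam (continuous_sig φ).continuousAt⟩

/-! ### Limits of points of linearization -/

section Limits

variable {β : Type*} {F : Filter β} {x y : β → P.PowerVec} {x' y' : P.PowerVec}

theorem Covered.tendsto_sinr (hP : P.Covered) (hx : Tendsto x F (𝓝 x')) (hx' : x' ∈ P.orthant)
    (φ : P.UE) : Tendsto (fun n => P.sinr φ (x n)) F (𝓝 (P.sinr φ x')) :=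
  ((((continuous_sig φ).tendsto x').comp hx).pow 2).div
    (((continuous_den_toEta φ).tendsto x').comp hx) (hP.den_pos φ (toEta_mem_orthant hx')).ne'

theorem Covered.tendsto_rate_sinr (hP : P.Covered) (hx : Tendsto x F (𝓝 x'))
    (hx' : x' ∈ P.orthant) (φ : P.UE) :
    Tendsto (fun n => P.rate (P.sinr φ (x n))) F (𝓝 (P.rate (P.sinr φ x'))) := by
  have := hP.sinr_nonneg φ hx'
  exact (continuousAt_rate (by linarith)).tendsto.comp (hP.tendsto_sinr hx hx' φ)

theorem Admissible.of_tendsto [F.NeBot] (hP : P.Covered) (hx : Tendsto x F (𝓝 x'))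
    (h : ∀ n, P.Admissible (x n)) : P.Admissible x' := by
  have h1 : P.PowerFeasible x' :=
    isClosed_powerFeasible.mem_of_tendsto hx (Eventually.of_forall fun n => (h n).1)
  exact ⟨h1, fun φ => ge_of_tendsto (hP.tendsto_sinr hx h1.mem_orthant φ)
    (Eventually.of_forall fun n => (h n).2 φ)⟩

theorem Covered.tendsto_wsee (hP : P.Covered) (hx : Tendsto x F (𝓝 x'))
    (h : ∀ n, P.Admissible (x n)) (h' : P.Admissible x') :
    Tendsto (fun n => P.wsee (P.toEta (x n))) F (𝓝 (P.wsee (P.toEta x'))) := by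
  simp only [fun n => wsee_toEta (h n).1.mem_orthant, wsee_toEta h'.1.mem_orthant]
  exact tendsto_finsetSum _ fun φ _ => ((hP.tendsto_rate_sinr hx h'.1.mem_orthant φ).div
    (((continuous_pow_toEta φ).tendsto x').comp hx) (h'.pow_pos φ).ne').const_mul _

theorem Admissible.tendsto_ancB (hx : Tendsto x F (𝓝 x'))
    (h : ∀ n, P.Admissible (x n)) (h' : P.Admissible x') (φ : P.UE) :
    Tendsto (fun n => P.ancB (x n) φ) F (𝓝 (P.ancB x' φ)) := by
  simp only [fun n => (h n).ancB_eq, h'.ancB_eq]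
  exact (((continuous_den_toEta φ).tendsto x').comp hx).div
    (((continuous_sig φ).tendsto x').comp hx) (h'.sig_pos φ).ne'

theorem Admissible.tendsto_ancA (hP : P.Covered) (hx : Tendsto x F (𝓝 x'))
    (h : ∀ n, P.Admissible (x n)) (h' : P.Admissible x') (φ : P.UE) :
    Tendsto (fun n => P.ancA (x n) φ) F (𝓝 (P.ancA x' φ)) := by
  simp only [fun n => (h n).ancA_eq, h'.ancA_eq]
  exact (((continuous_pow_toEta φ).tendsto x').comp hx).div
    (hP.tendsto_rate_sinr hx h'.1.mem_orthant φ).sqrt (Real.sqrt_pos.2 (h'.rate_pos φ)).ne'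

theorem tendsto_surSinr (φ : P.UE) {b : β → ℝ} {b' : ℝ} (hb : Tendsto b F (𝓝 b')) (hb' : 0 < b')
    (hy : Tendsto y F (𝓝 y')) :
    Tendsto (fun n => P.surSinr φ (b n) (y n)) F (𝓝 (P.surSinr φ b' y')) :=
  (((hb.const_mul 2).mul (((continuous_sig φ).tendsto y').comp hy)).sub
    (((continuous_den_toEta φ).tendsto y').comp hy)).div (hb.pow 2) (by positivity)

theorem tendsto_surEE (φ : P.UE) {b α : β → ℝ} {b' α' : ℝ} (hb : Tendsto b F (𝓝 b'))
    (hb' : 0 < b') (hα : Tendsto α F (𝓝 α')) (hα' : 0 < α') (hy : Tendsto y F (𝓝 y'))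
    (h : 0 ≤ P.surSinr φ b' y') :
    Tendsto (fun n => P.surEE φ (b n) (α n) (y n)) F (𝓝 (P.surEE φ b' α' y')) :=
  (((hα.const_mul 2).mul ((continuousAt_rate (P := P) (by linarith)).tendsto.comp
    (tendsto_surSinr φ hb hb' hy)).sqrt).sub
    (((continuous_pow_toEta φ).tendsto y').comp hy)).div (hα.pow 2) (by positivity)

/-- Limits of optima of surrogate problems are optima of the limit problem, if the latter satisfies
Slater's condition. -/
theorem IsSurOpt.of_tendsto [F.NeBot] (hP : P.Covered) (hx : Tendsto x F (𝓝 x'))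
    (h : ∀ n, P.Admissible (x n)) (hy : Tendsto y F (𝓝 y'))
    (hopt : ∀ n, P.IsSurOpt (P.ancB (x n)) (P.ancA (x n)) (y n)) {w : P.PowerVec}
    (hw : P.IsSlater (P.ancB x') w) : P.IsSurOpt (P.ancB x') (P.ancA x') y' := by
  have h' := Admissible.of_tendsto hP hx h
  have hb := Admissible.tendsto_ancB hx h h'
  have hα := Admissible.tendsto_ancA hP hx h h'
  have hb' := h'.ancB_pos hP
  have hα' := h'.ancA_pos
  have hy' : y' ∈ P.surFeas (P.ancB x') :=
    ⟨isClosed_powerFeasible.mem_of_tendsto hy (Eventually.of_forall fun n => (hopt n).1.1),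
      fun φ => ge_of_tendsto (tendsto_surSinr φ (hb φ) (hb' φ) hy)
        (Eventually.of_forall fun n => (hopt n).1.2 φ)⟩
  have hlim : ∀ {u : β → P.PowerVec} {u' : P.PowerVec}, Tendsto u F (𝓝 u') →
      u' ∈ P.surFeas (P.ancB x') → Tendsto (fun n => P.surObj (P.ancB (x n)) (P.ancA (x n)) (u n)) F
        (𝓝 (P.surObj (P.ancB x') (P.ancA x') u')) := fun hu hu' =>
    tendsto_finsetSum _ fun φ _ => (tendsto_surEE φ (hb φ) (hb' φ) (hα φ) (hα' φ) hu
      ((minSinr_pos φ).le.trans (hu'.2 φ))).const_mul _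
  -- A point that is strictly feasible in the limit is feasible for the surrogate problems nearby,
  -- hence beaten by their optima.
  have hstrict : ∀ u : P.PowerVec, P.PowerFeasible u →
      (∀ φ, P.minSinr φ < P.surSinr φ (P.ancB x' φ) u) →
      P.surObj (P.ancB x') (P.ancA x') u ≤ P.surObj (P.ancB x') (P.ancA x') y' := by
    intro u hu hus
    refine le_of_tendsto_of_tendsto (hlim tendsto_const_nhds ⟨hu, fun φ => (hus φ).le⟩)
      (hlim hy hy') ?_
    have hev : ∀ᶠ n in F, ∀ φ, P.minSinr φ < P.surSinr φ (P.ancB (x n) φ) u :=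
      eventually_all.2 fun φ => (tendsto_surSinr φ (hb φ) (hb' φ)
        tendsto_const_nhds).eventually (lt_mem_nhds (hus φ))
    filter_upwards [hev] with n hn
    exact (hopt n).2 u ⟨hu, fun φ => (hn φ).le⟩
  refine ⟨hy', fun u hu => ?_⟩
  have hwf := hw.mem_surFeas
  -- A general feasible point becomes strictly feasible after mixing in a bit of the Slater point
  -- `w`; then t → 0.
  have hmix : ∀ t : ℝ, 0 < t → t < 1 →
      (1 - t) * P.surObj (P.ancB x') (P.ancA x') u + t * P.surObj (P.ancB x') (P.ancA x') w ≤
        P.surObj (P.ancB x') (P.ancA x') y' := by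
    intro t ht ht1
    have e : (1 - t) + t = 1 := by ring
    have h1 := (concaveOn_surObj hb' hα').2
      ⟨hu.1.mem_orthant, fun φ => (minSinr_pos φ).le.trans (hu.2 φ)⟩
      ⟨hw.1, fun φ => (minSinr_pos φ).le.trans (hwf.2 φ)⟩ (sub_nonneg.2 ht1.le) ht.le e
    refine h1.trans (hstrict _ (convex_powerFeasible hu.1 hwf.1 (sub_nonneg.2 ht1.le) ht.le e)
      fun φ => ?_)
    have h2 := (concaveOn_surSinr φ (hb' φ)).2 hu.1.mem_orthant hw.1 (sub_nonneg.2 ht1.le) ht.le e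
    refine lt_of_lt_of_le ?_ h2
    simp only [smul_eq_mul]
    nlinarith [mul_lt_mul_of_pos_left (hw.2.1 φ) ht,
      mul_le_mul_of_nonneg_left (hu.2 φ) (sub_nonneg.2 ht1.le)]
  have hc : Continuous fun t : ℝ => (1 - t) * P.surObj (P.ancB x') (P.ancA x') u +
      t * P.surObj (P.ancB x') (P.ancA x') w := by fun_prop
  have hc' := hc.continuousWithinAt.tendsto (x := (0 : ℝ)) (s := Set.Ioi 0)
  simp only [sub_zero, one_mul, zero_mul, add_zero] at hc'
  refine le_of_tendsto hc' ?_
  filter_upwards [Ioo_mem_nhdsGT (zero_lt_one (α := ℝ))] with t ht using hmix t ht.1 ht.2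

end Limits

/-! ### Fixed points of the algorithm are KKT points -/

theorem differentiableAt_div {E : Type*} [NormedAddCommGroup E] [NormedSpace ℝ E] {f g : E → ℝ}
    {x : E} (hf : DifferentiableAt ℝ f x) (hg : DifferentiableAt ℝ g x) (h : g x ≠ 0) :
    DifferentiableAt ℝ (fun y => f y / g y) x := by
  simp only [div_eq_mul_inv]
  exact hf.fun_mul (hg.fun_inv h)

theorem differentiableAt_rate_comp {E : Type*} [NormedAddCommGroup E] [NormedSpace ℝ E]
    {f : E → ℝ} {x : E} (hf : DifferentiableAt ℝ f x) (h : 0 < 1 + f x) :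
    DifferentiableAt ℝ (fun y => P.rate (f y)) x :=
  (hasDerivAt_rate (P := P) h).differentiableAt.comp x hf

theorem differentiableAt_se (hP : P.Covered) (φ : P.UE) {y : P.PowerVec} (h1 : ∀ s, 0 < y.1 s)
    (h2 : ∀ l, 0 < y.2 l) : DifferentiableAt ℝ (P.se φ) y := by
  have hy : y ∈ P.orthant := ⟨fun s => (h1 s).le, fun l => (h2 l).le⟩
  have hden := hP.den_pos φ hy
  have hd := (differentiable_den φ).differentiableAt (x := y)
  cases φ with
  | inl k =>
    have hs : ∀ s : P.Served, DifferentiableAt ℝ (fun y : P.PowerVec => √(y.1 s)) y := fun s =>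
      DifferentiableAt.sqrt (f := fun y : P.PowerVec => y.1 s) (by fun_prop) (h1 s).ne'
    have hn : DifferentiableAt ℝ (fun y : P.PowerVec =>
        (∑ s ∈ P.pairsOfUE k, P.coefAd s * √(y.1 s)) ^ 2) y := by fun_prop
    have hq := differentiableAt_div hn hd hden.ne'
    have hpos : 0 < 1 + (∑ s ∈ P.pairsOfUE k, P.coefAd s * √(y.1 s)) ^ 2 / P.den (.inl k) y := by
      positivity
    exact differentiableAt_rate_comp hq hpos
  | inr l =>
    have hn : DifferentiableAt ℝ (fun y : P.PowerVec => P.coefAu l * y.2 l) y := by fun_prop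
    have hq := differentiableAt_div hn hd hden.ne'
    have hpos : 0 < 1 + P.coefAu l * y.2 l / P.den (.inr l) y := by
      have := P.coefAu_pos (hP.u l)
      have := h2 l
      positivity
    exact differentiableAt_rate_comp hq hpos

theorem differentiableAt_wsee (hP : P.Covered) {y : P.PowerVec} (h1 : ∀ s, 0 < y.1 s)
    (h2 : ∀ l, 0 < y.2 l) : DifferentiableAt ℝ P.wsee y := by
  have hy : y ∈ P.orthant := ⟨fun s => (h1 s).le, fun l => (h2 l).le⟩
  rw [show P.wsee = fun y => ∑ φ, P.weight φ * (P.se φ y / P.pow φ y) from funext wsee_eq]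
  exact DifferentiableAt.fun_sum fun φ _ => (differentiableAt_div (differentiableAt_se hP φ h1 h2)
    (differentiable_pow φ).differentiableAt (pow_pos' φ hy).ne').const_mul _

theorem differentiableAt_p2Con (hP : P.Covered) {y : P.PowerVec} (h1 : ∀ s, 0 < y.1 s)
    (h2 : ∀ l, 0 < y.2 l) (i : P.P2Index) : DifferentiableAt ℝ (P.p2Con i) y := by
  rcases i with φ | m | s | l | l
  · rw [show P.p2Con (.inl φ) = fun y => P.se φ y - P.minSE φ from funext (p2Con_se φ)]
    exact (differentiableAt_se hP φ h1 h2).sub_const _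
  · exact ((differentiable_apLoad m).differentiableAt).const_sub _
  · show DifferentiableAt ℝ (fun y : P.PowerVec => y.1 s) y
    fun_prop
  · show DifferentiableAt ℝ (fun y : P.PowerVec => y.2 l) y
    fun_prop
  · show DifferentiableAt ℝ (fun y : P.PowerVec => 1 - y.2 l) y
    fun_prop

theorem hasFDerivAt_toEta (x : P.PowerVec) : ∃ T : P.PowerVec →L[ℝ] P.PowerVec,
    HasFDerivAt P.toEta T x ∧ ∀ v, T v = (fun s => 2 * x.1 s * v.1 s, v.2) := by
  let p : P.Served → P.PowerVec →L[ℝ] ℝ := fun s =>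
    (ContinuousLinearMap.proj s).comp (ContinuousLinearMap.fst ℝ (P.Served → ℝ) (Fin Ku → ℝ))
  have h1 : ∀ s, HasFDerivAt (fun x : P.PowerVec => x.1 s ^ 2) ((2 * x.1 s) • p s) x := by
    intro s
    have := (p s).hasFDerivAt (x := x) |>.pow 2
    simpa [p] using this
  exact ⟨_, (hasFDerivAt_pi.2 h1).prodMk hasFDerivAt_snd, fun v => rfl⟩

/-- A point that solves its own surrogate problem is a KKT point of `P2`. -/
theorem IsSurOpt.isKKTP2 (hP : P.Covered) {x w : P.PowerVec} (hx : P.Admissible x)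
    (hopt : P.IsSurOpt (P.ancB x) (P.ancA x) x) (hw : P.IsSlater (P.ancB x) w) :
    P.IsKKTP2 (P.toEta x) := by
  have hb := hx.ancB_pos hP
  have hα := hx.ancA_pos
  obtain ⟨μ, ν, σ, hmul⟩ := hopt.exists_isMultiplier hb hα hw
  have hxo := hx.1.mem_orthant
  have hz0 : ∀ φ, 0 < P.surSinr φ (P.ancB x φ) x :=
    fun φ => (minSinr_pos φ).trans_le (hopt.1.2 φ)
  have hc : ∀ s, 0 < x.1 s := hmul.fst_pos hb hα hopt.1
  have ht : ∀ l, 0 < x.2 l := fun l => snd_pos_of_surSinr_pos hP (hb _) hxo (hz0 (.inr l))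
  have hη : ∀ s, 0 < (P.toEta x).1 s := fun s => pow_pos (hc s) 2
  have hdW := differentiableAt_wsee hP hη ht
  have hdc := differentiableAt_p2Con hP hη ht
  -- The constraints η ≥ 0 and Θ ≥ 0 are inactive at positive powers and get multiplier 0; the
  -- others keep the multipliers of the surrogate problem.
  let m : P.P2Index → ℝ := Sum.elim μ (Sum.elim ν (Sum.elim 0 (Sum.elim 0 σ)))
  have hself : ∀ φ, P.surRate φ (P.ancB x φ) x = P.rate (P.sinr φ x) := fun φ => by
    rw [surRate, hx.surSinr_self hP]
  refine ⟨(hP.p2Feasible_toEta_iff hxo.1).2 hx, hdW, hdc, m, ?_, ?_, ?_⟩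
  · rintro (φ | i | s | l | l)
    exacts [hmul.mu_nonneg φ, hmul.nu_nonneg i, le_rfl, le_rfl, hmul.sigma_nonneg l]
  · rintro (φ | i | s | l | l)
    · rw [p2Con_se, se_toEta φ hxo, ← hself]
      exact hmul.mu_compl φ
    · exact hmul.nu_compl i
    · exact zero_mul _
    · exact zero_mul _
    · exact hmul.sigma_compl l
  · obtain ⟨T, hT, hTv⟩ := hasFDerivAt_toEta x
    set G : P.PowerVec →L[ℝ] ℝ := fderiv ℝ P.wsee (P.toEta x) +
      ∑ i, m i • fderiv ℝ (P.p2Con i) (P.toEta x) with hG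
    have hLT : HasFDerivAt (fun x => P.wsee (P.toEta x) + ∑ i, m i * P.p2Con i (P.toEta x))
        (G.comp T) x := by
      have h1 : HasFDerivAt (fun y => P.wsee y + ∑ i, m i * P.p2Con i y) G (P.toEta x) :=
        hdW.hasFDerivAt.add (HasFDerivAt.fun_sum fun i _ => (hdc i).hasFDerivAt.const_mul (m i))
      exact h1.comp x hT
    have hexp : ∀ x ∈ P.orthant, P.wsee (P.toEta x) + ∑ i, m i * P.p2Con i (P.toEta x) =
        ∑ φ, (P.weight φ * P.ee φ x + μ φ * (P.rate (P.sinr φ x) - P.minSE φ)) +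
          P.limitTerm ν σ x := by
      intro x hx
      rw [wsee_toEta hx, Fintype.sum_sum_type fun i : P.P2Index => m i * P.p2Con i (P.toEta x),
        Fintype.sum_sum_type fun i => m (.inr i) * P.p2Con (.inr i) (P.toEta x),
        Fintype.sum_sum_type fun i => m (.inr (.inr i)) * P.p2Con (.inr (.inr i)) (P.toEta x),
        Fintype.sum_sum_type fun i =>
          m (.inr (.inr (.inr i))) * P.p2Con (.inr (.inr (.inr i))) (P.toEta x)]
      simp only [m, Sum.elim_inl, Sum.elim_inr, Pi.zero_apply, zero_mul, Finset.sum_const_zero,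
        zero_add, limitTerm, Finset.sum_add_distrib, p2Con_se, se_toEta _ hx]
      simp only [p2Con, toEta]
      ring
    have hL : HasFDerivAt (fun u => ∑ φ, P.ueTerm φ (P.ancB x φ) (P.ancA x φ) (μ φ) u +
        P.limitTerm ν σ u) (0 : P.PowerVec →L[ℝ] ℝ) x := by
      have hd : DifferentiableAt ℝ (fun u => ∑ φ, P.ueTerm φ (P.ancB x φ) (P.ancA x φ) (μ φ) u +
          P.limitTerm ν σ u) x :=
        (DifferentiableAt.fun_sum fun φ _ => differentiableAt_ueTerm hP φ _ _ _ ht (hz0 φ)).fun_add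
          (differentiable_limitTerm ν σ x)
      have h0 := (hmul.isLocalMax hP hb hα hopt.1).fderiv_eq_zero
      rw [← h0]
      exact hd.hasFDerivAt
    -- The surrogate Lagrangian lies below that of `P2` near `x`, with equality at `x`, since all
    -- weights and multipliers are nonnegative. Hence both have the same derivative there, namely 0.
    have hmin : IsLocalMin (fun u => (P.wsee (P.toEta u) + ∑ i, m i * P.p2Con i (P.toEta u)) -
        (∑ φ, P.ueTerm φ (P.ancB x φ) (P.ancA x φ) (μ φ) u + P.limitTerm ν σ u)) x := by
      have h1 : ∀ᶠ u in 𝓝 x, ∀ φ, 0 < P.surSinr φ (P.ancB x φ) u := eventually_all.2 fun φ =>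
        ((continuous_surSinr φ _).tendsto x).eventually (lt_mem_nhds (hz0 φ))
      have h2 : ∀ᶠ u : P.PowerVec in 𝓝 x, ∀ s, 0 < u.1 s := eventually_all.2 fun s =>
        ((by fun_prop : Continuous fun u : P.PowerVec => u.1 s).tendsto x).eventually
          (lt_mem_nhds (hc s))
      have h3 : ∀ᶠ u : P.PowerVec in 𝓝 x, ∀ l, 0 < u.2 l := eventually_all.2 fun l =>
        ((by fun_prop : Continuous fun u : P.PowerVec => u.2 l).tendsto x).eventually
          (lt_mem_nhds (ht l))
      filter_upwards [h1, h2, h3] with u hu1 hu2 hu3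
      have huo : u ∈ P.orthant := ⟨fun s => (hu2 s).le, fun l => (hu3 l).le⟩
      rw [hexp u huo, hexp x hxo, add_sub_add_right_eq_sub, add_sub_add_right_eq_sub,
        ← Finset.sum_sub_distrib, ← Finset.sum_sub_distrib]
      refine Finset.sum_le_sum fun φ _ => ?_
      simp only [ueTerm, hself, hx.surEE_self hP]
      have hd : u ∈ P.surDom φ (P.ancB x φ) := ⟨huo, (hu1 φ).le⟩
      have h4 := mul_le_mul_of_nonneg_left (surEE_le_ee hP φ (hb φ) (hα φ) hd) (P.weight_pos φ).le
      have h5 := mul_le_mul_of_nonneg_left (surRate_le_rate hP φ (hb φ) hd) (hmul.mu_nonneg φ)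
      linarith
    have hGT : G.comp T = 0 := by
      have := hmin.hasFDerivAt_eq_zero (hLT.sub hL)
      simpa using this
    refine ContinuousLinearMap.ext fun v => ?_
    -- As all c are positive, the derivative of c ↦ c² is onto, so stationarity in (C, Θ) implies
    -- stationarity in (η, Θ).
    have h1 : T (fun s => v.1 s / (2 * x.1 s), v.2) = v := by
      rw [hTv]
      refine Prod.ext (funext fun s => ?_) rfl
      have := hc s
      simp only
      field_simp
    have h2 := congrArg (fun L : P.PowerVec →L[ℝ] ℝ => L (fun s => v.1 s / (2 * x.1 s), v.2)) hGT
    simp only [ContinuousLinearMap.comp_apply, h1] at h2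
    exact h2

/-! ### Convergence of the successive convex approximation -/

variable (P)

/-- All points of linearization satisfy Slater's condition. -/
def SlaterEverywhere : Prop :=
  ∀ x, P.Admissible x → ∃ w, P.IsSlater (P.ancB x) w

/-- A sequence of successive convex approximation: each point solves the surrogate problem of its
predecessor. -/
structure IsSCASequence (x : ℕ → P.PowerVec) : Prop where
  adm : ∀ n, P.Admissible (x n)
  opt : ∀ n, P.IsSurOpt (P.ancB (x n)) (P.ancA (x n)) (x (n + 1))

variable {P}

namespace IsSCASequence

variable {x : ℕ → P.PowerVec} (h : P.IsSCASequence x) (hP : P.Covered)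
include h hP

/-- The old WSEE is the surrogate value at the old point; it is at most the surrogate value at the
new point, and this is at most the new WSEE. -/
theorem monotone_wsee : Monotone fun n => P.wsee (P.toEta (x n)) :=
  monotone_nat_of_le_succ fun n => by
    rw [← (h.adm n).surObj_self hP]
    exact ((h.opt n).2 _ ((h.adm n).mem_surFeas hP)).trans
      (surObj_le_wsee hP ((h.adm n).ancB_pos hP) (h.adm n).ancA_pos (h.opt n).1)

theorem exists_tendsto (U : Ultrafilter ℕ) (k : ℕ) :
    ∃ x', P.Admissible x' ∧ Tendsto (fun n => x (n + k)) U (𝓝 x') := by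
  obtain ⟨x', -, hx'⟩ := (isCompact_powerFeasible (P := P)).ultrafilter_le_nhds
    (U.map fun n => x (n + k)) (by
      rw [le_principal_iff, Ultrafilter.mem_coe, Ultrafilter.mem_map]
      exact Filter.mem_of_superset univ_mem fun n _ => (h.adm (n + k)).1)
  have hx'' : Tendsto (fun n => x (n + k)) U (𝓝 x') := hx'
  exact ⟨x', Admissible.of_tendsto hP hx'' fun n => h.adm (n + k), hx''⟩

theorem exists_tendsto_wsee : ∃ W, Tendsto (fun n => P.wsee (P.toEta (x n))) atTop (𝓝 W) := by
  rcases tendsto_atTop_of_monotone (h.monotone_wsee hP) with h1 | h1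
  · obtain ⟨x', hx', hlim⟩ := h.exists_tendsto hP (hyperfilter ℕ) 0
    exact absurd (h1.mono_left Nat.hyperfilter_le_atTop)
      (not_tendsto_atTop_of_tendsto_nhds (hP.tendsto_wsee hlim h.adm hx'))
  · exact h1

/-- Along every ultrafilter, the sequence and its shift have the same limit, which is a fixed point
of the algorithm. -/
theorem exists_fixed_point (hS : P.SlaterEverywhere) {U : Ultrafilter ℕ}
    (hU : (U : Filter ℕ) ≤ atTop) :
    ∃ x', P.IsKKTP2 (P.toEta x') ∧ Tendsto x U (𝓝 x') ∧
      Tendsto (fun n => x (n + 1)) U (𝓝 x') := by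
  obtain ⟨x', hx', hlim⟩ := h.exists_tendsto hP U 0
  obtain ⟨y', hy', hlim'⟩ := h.exists_tendsto hP U 1
  obtain ⟨w, hw⟩ := hS x' hx'
  obtain ⟨W, hW⟩ := h.exists_tendsto_wsee hP
  have hopt := IsSurOpt.of_tendsto hP hlim h.adm hlim' h.opt hw
  have hb := hx'.ancB_pos hP
  have e1 := tendsto_nhds_unique (hP.tendsto_wsee hlim h.adm hx') (hW.mono_left hU)
  have e2 := tendsto_nhds_unique (hP.tendsto_wsee hlim' (fun n => h.adm (n + 1)) hy')
    ((hW.comp (tendsto_add_atTop_nat 1)).mono_left hU)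
  -- The surrogate optimum at y' is at most the WSEE at y', which equals the WSEE at x', the
  -- surrogate value at x'. So x' is optimal as well, and uniqueness applies.
  have hopt' : P.IsSurOpt (P.ancB x') (P.ancA x') x' := by
    refine ⟨hx'.mem_surFeas hP, fun u hu => (hopt.2 u hu).trans ?_⟩
    rw [hx'.surObj_self hP, e1, ← e2]
    exact surObj_le_wsee hP hb hx'.ancA_pos hopt.1
  rw [hopt.unique hP hb hx'.ancA_pos hopt'] at hlim'
  exact ⟨x', hopt'.isKKTP2 hP hx' hw, hlim, hlim'⟩

theorem tendsto_distSq (hS : P.SlaterEverywhere) :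
    Tendsto (fun n => √(P.distSq (x (n + 1)) (x n))) atTop (𝓝 0) := by
  rw [tendsto_iff_ultrafilter]
  intro U hU
  obtain ⟨x', -, h1, h2⟩ := h.exists_fixed_point hP hS hU
  have := ((continuous_distSq.tendsto (x', x')).comp (h2.prodMk_nhds h1)).sqrt
  rwa [distSq_self, Real.sqrt_zero] at this

theorem tendsto_dist_toEta (hS : P.SlaterEverywhere) :
    Tendsto (fun n => dist (P.toEta (x (n + 1))) (P.toEta (x n))) atTop (𝓝 0) := by
  rw [tendsto_iff_ultrafilter]
  intro U hU
  obtain ⟨x', -, h1, h2⟩ := h.exists_fixed_point hP hS hU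
  have := ((continuous_toEta.tendsto x').comp h2).dist ((continuous_toEta.tendsto x').comp h1)
  rwa [dist_self] at this

theorem exists_mapClusterPt (hS : P.SlaterEverywhere) :
    ∃ y, MapClusterPt y atTop fun n => P.toEta (x n) := by
  obtain ⟨x', -, h1, -⟩ := h.exists_fixed_point hP hS Nat.hyperfilter_le_atTop
  exact ⟨P.toEta x', mapClusterPt_iff_ultrafilter.2
    ⟨hyperfilter ℕ, Nat.hyperfilter_le_atTop, (continuous_toEta.tendsto x').comp h1⟩⟩

theorem isKKTP2_of_mapClusterPt (hS : P.SlaterEverywhere) {y : P.PowerVec}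
    (hy : MapClusterPt y atTop fun n => P.toEta (x n)) : P.IsKKTP2 y := by
  obtain ⟨U, hU, hyU⟩ := mapClusterPt_iff_ultrafilter.1 hy
  obtain ⟨x', hK, h1, -⟩ := h.exists_fixed_point hP hS hU
  rwa [tendsto_nhds_unique hyU ((continuous_toEta.tendsto x').comp h1)]

/-- `Metric.infDist` to the empty set is 0 by convention, but the set here is not empty: the limit
along every ultrafilter is a KKT point. -/
theorem tendsto_infDist (hS : P.SlaterEverywhere) :
    Tendsto (fun n => Metric.infDist (P.toEta (x n)) {y | P.IsKKTP2 y}) atTop (𝓝 0) := by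
  rw [tendsto_iff_ultrafilter]
  intro U hU
  obtain ⟨x', hK, h1, -⟩ := h.exists_fixed_point hP hS hU
  have := ((Metric.continuous_infDist_pt {y | P.IsKKTP2 y}).tendsto (P.toEta x')).comp
    ((continuous_toEta.tendsto x').comp h1)
  rwa [Metric.infDist_zero_of_mem (show P.toEta x' ∈ {y | P.IsKKTP2 y} from hK)] at this

end IsSCASequence

end FDSystem

end

/-! ### Assembly of the theorem. -/

theorem mainTheorem3 {M Kd Ku : ℕ} (P : FDSystem M Kd Ku) (q : PenaltyParams)
    (hstrict : ∃ y, P.P2Feasible y ∧ (∀ k, P.SoD k < P.seD k y) ∧ ∀ l, P.SoU l < P.seU l y)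
    (x₀ : P.PowerVec) (hx₀ : ∀ s, 0 ≤ x₀.1 s) (hfeas : P.P2Feasible (P.toEta x₀)) :
    (∃ x st, P.IsDecentralizedRun q x st ∧ x 0 = x₀) ∧
    ∀ x st, P.IsDecentralizedRun q x st → x 0 = x₀ →
      (∀ n, (∀ s, 0 ≤ (x n).1 s) ∧ P.P2Feasible (P.toEta (x n))) ∧
      (∀ n, P.ADMMSolves (P.tight (x n)) (st n) (x (n + 1))) ∧
      Monotone (fun n => P.wsee (P.toEta (x n))) ∧
      (∃ W, Tendsto (fun n => P.wsee (P.toEta (x n))) atTop (𝓝 W)) ∧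
      Tendsto (fun n => √(P.distSq (x (n + 1)) (x n))) atTop (𝓝 0) ∧
      (∃ y, MapClusterPt y atTop fun n => P.toEta (x n)) ∧
      (∀ y, MapClusterPt y atTop (fun n => P.toEta (x n)) → P.IsKKTP2 y) ∧
      Tendsto (fun n => Metric.infDist (P.toEta (x n)) {y | P.IsKKTP2 y}) atTop (𝓝 0) ∧
      (∀ y, MapClusterPt y atTop (fun n => P.toEta (x n)) →
        (∃ U ∈ 𝓝 y, ∀ y' ∈ U, P.IsKKTP2 y' → y' = y) →
          Tendsto (fun n => P.toEta (x n)) atTop (𝓝 y)) := by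
  obtain ⟨y, hy, hyD, hyU⟩ := hstrict
  have hP : P.Covered := P.covered_of_feasible hy
  have hS : P.SlaterEverywhere := by
    obtain ⟨x₁, h1, h2, h3, h4⟩ := hP.exists_strictly_feasible hy (by
      rintro (k | l)
      exacts [hyD k, hyU l])
    exact fun x hx => hx.exists_isSlater hP h1 h2 h3 h4
  have hadm₀ : P.Admissible x₀ := (hP.p2Feasible_toEta_iff hx₀).1 hfeas
  have hsolve : ∀ x, P.Admissible x → ∀ st, P.IsADMMRun q x st →
      ∃ z, P.IsSurOpt (P.ancB x) (P.ancA x) z ∧ P.ADMMSolves (P.tight x) st z := by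
    intro x hx st hst
    obtain ⟨w, hw⟩ := hS x hx
    exact hst.solves hP hx hw
  refine ⟨?_, fun x st hrun hx0 => ?_⟩
  · choose run hrun using fun x : {x // P.Admissible x} => FDSystem.exists_isADMMRun hP q x.2
    choose next hopt hnext using fun x => hsolve x.1 x.2 (run x) (hrun x)
    -- The recursion runs on admissible points, since Slater's condition, and with it convergence of
    -- the inner loop, is available only there.
    let it : ℕ → {x // P.Admissible x} := fun n =>
      (fun x => ⟨next x, FDSystem.admissible_of_mem_surFeas hP (x.2.ancB_pos hP) (hopt x).1⟩)^[n]
        ⟨x₀, hadm₀⟩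
    refine ⟨fun n => (it n).1, fun n => run (it n), ⟨fun n => hrun (it n), fun n x' hx' => ?_⟩, rfl⟩
    have h1 : (it (n + 1)).1 = next (it n) := by
      simp only [it, Function.iterate_succ_apply']
    exact h1.trans (tendsto_nhds_unique (hnext (it n)).2.2.1 hx')
  -- Convergence of the inner loop is proved first; only then does the field `outer` identify the
  -- next iterate with the limit.
  · have key : ∀ n, P.Admissible (x n) → P.IsSurOpt (P.ancB (x n)) (P.ancA (x n)) (x (n + 1)) ∧
        P.ADMMSolves (P.tight (x n)) (st n) (x (n + 1)) := by
      intro n hn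
      obtain ⟨z, hz, hsol⟩ := hsolve _ hn _ (hrun.inner n)
      rw [hrun.outer n z hsol.2.2.1]
      exact ⟨hz, hsol⟩
    have hadm : ∀ n, P.Admissible (x n) := by
      intro n
      induction n with
      | zero => rw [hx0]; exact hadm₀
      | succ n ih =>
        exact FDSystem.admissible_of_mem_surFeas hP (ih.ancB_pos hP) (key n ih).1.1
    have hseq : P.IsSCASequence x := ⟨hadm, fun n => (key n (hadm n)).1⟩
    refine ⟨fun n => ⟨(hadm n).1.2.1, (hP.p2Feasible_toEta_iff (hadm n).1.2.1).2 (hadm n)⟩,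
      fun n => (key n (hadm n)).2, hseq.monotone_wsee hP, hseq.exists_tendsto_wsee hP,
      hseq.tendsto_distSq hP hS, hseq.exists_mapClusterPt hP hS,
      fun y hy => hseq.isKKTP2_of_mapClusterPt hP hS hy, hseq.tendsto_infDist hP hS,
      fun y hy hiso => ?_⟩
    obtain ⟨U, hU, hUy⟩ := hiso
    exact tendsto_of_isolated_mapClusterPt (hseq.tendsto_dist_toEta hP hS) hy
      ⟨U, hU, fun y' hy' hc => hUy y' hy' (hseq.isKKTP2_of_mapClusterPt hP hS hc)⟩
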